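/- A complex Hadamard matrix is a square complex matrix whose entries have modulus $1$ and whose rows are pairwise orthogonal. Two complex $n\times n$ matrices are called equivalent if one can pass from one to the other by permuting the rows, permuting the columns, and multiplying rows and columns by complex numbers of modulus $1$ (transposition is not allowed). For a prime $p$, a $p$-cycle is a formal sum $a+a\omega+\dots+a\omega^{p-1}$ with $\omega=e^{2\pi i/p}$ and $a\in\mathbb C$, $|a|=1$. A complex Hadamard matrix $h=(h_{xy})\in M_n(\mathbb C)$ is called regular if for any two distinct rows $x\ne y$ the formal sum $\sum_{z=1}^n h_{xz}\overline{h_{yz}}$ (that is, the multiset of its $n$ terms) decomposes as a sum of cycles, where $p$-cycles for different primes $p$ may be used. Let $j=e^{2\pi i/3}$, $F_n=(e^{2\pi i(a-1)(b-1)/n})_{a,b=1}^n$, and, for $h\in M_n(\mathbb C)$, $k\in M_m(\mathbb C)$ and $l\in M_{m\times n}(\mathbb C)$, let $h\otimes_l k=(h_{xy}l_{ay}k_{ab})_{xa,yb}\in M_{nm}(\mathbb C)$, with the index pairs ordered lexicographically. For $q,r,s\in\mathbb C$ of modulus $1$ put $$T=\begin{pmatrix}1&1&1&1&1&1\\1&1&j&j&j^2&j^2\\1&j&1&j^2&j^2&j\\1&j&j^2&1&j&j^2\\1&j^2&j^2&j&1&j\\1&j^2&j&j^2&j&1\end{pmatrix},\qquad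 H^q=\begin{pmatrix}1&1&1&1&1&1\\1&-1&i&i&-i&-i\\1&i&-1&-i&q&-q\\1&i&-i&-1&-q&q\\1&-i&\bar q&-\bar q&i&-1\\1&-i&-\bar q&\bar q&-1&i\end{pmatrix},$$ $$F_{23}^{rs}=F_2\otimes_{\begin{pmatrix}1&1\\1&r\\1&s\end{pmatrix}}F_3,\qquad F_{32}^{rs}=F_3\otimes_{\begin{pmatrix}1&1&1\\1&r&s\end{pmatrix}}F_2 .$$ Theorem. A matrix $h\in M_6(\mathbb C)$ is a regular complex Hadamard matrix if and only if it is equivalent to one of the following: (1) the Tao matrix $T$; (2) a Haagerup matrix $H^q$, with $|q|=1$; (3) a Diţă deformation $F_{23}^{rs}$, with $|r|=|s|=1$; (4) a Diţă deformation $F_{32}^{rs}$, with $|r|=|s|=1$. -/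

import Mathlib

open Complex Matrix

noncomputable section

/-- The formal sum of all `p`-th roots of unity rotated by `a`, as a multiset of complex numbers. -/
def rotatedCycle (p : ℕ) (a : ℂ) : Multiset ℂ :=
  (Multiset.range p).map fun k => a * exp (2 * Real.pi * I / p) ^ k

/-- `c` is a (prime) cycle: all the `p`-th roots of unity, for some prime `p`, rotated by a complex
number of modulus 1. -/
def IsPrimeCycle (c : Multiset ℂ) : Prop :=
  ∃ (p : ℕ) (a : ℂ), p.Prime ∧ ‖a‖ = 1 ∧ c = rotatedCycle p a

/-- A formal sum `s` of complex numbers (a multiset) decomposes as a sum of prime cycles. The sum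
of the multiset `C` is taken in the additive monoid of multisets, i.e. it is the formal sum of the
members of `C`. -/
def IsSumOfCycles (s : Multiset ℂ) : Prop :=
  ∃ C : Multiset (Multiset ℂ), (∀ c ∈ C, IsPrimeCycle c) ∧ C.sum = s

/-- The formal scalar product of two vectors: the multiset of the terms `u k * conj (v k)`. -/
def formalScalarProduct {n : ℕ} (u v : Fin n → ℂ) : Multiset ℂ :=
  Finset.univ.val.map fun k => u k * star (v k)

/-- A regular complex Hadamard matrix: a complex Hadamard matrix for which all the scalar products
between distinct rows decompose as sums of prime cycles. -/
def IsRegularHadamard {n : ℕ} (h : Matrix (Fin n) (Fin n) ℂ) : Prop :=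
  h.IsHadamard ∧ ∀ i j, i ≠ j → IsSumOfCycles (formalScalarProduct (h i) (h j))

/-- Equivalence of matrices: one passes from `k` to `h` by permuting the rows and the columns, and
by multiplying them by complex numbers of modulus 1 (transposition is not allowed). -/
def HadamardEquiv {n : ℕ} (h k : Matrix (Fin n) (Fin n) ℂ) : Prop :=
  ∃ (σ τ : Equiv.Perm (Fin n)) (a b : Fin n → ℂ),
    (∀ i, ‖a i‖ = 1) ∧ (∀ j, ‖b j‖ = 1) ∧ ∀ i j, h i j = a i * b j * k (σ i) (τ j)

/-- The Fourier matrix `F_n`, with rows and columns indexed from 0. -/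
def fourierMatrix (n : ℕ) : Matrix (Fin n) (Fin n) ℂ :=
  Matrix.of fun i j => exp (2 * Real.pi * I / n) ^ ((i : ℕ) * (j : ℕ))

/-- The Diţă deformation `h ⊗_l k = (h_{ij} l_{aj} k_{ab})_{ia,jb}`, with the pairs `(i, a)`
ordered lexicographically. -/
def ditaDeformation {n m : ℕ} (h : Matrix (Fin n) (Fin n) ℂ) (l : Matrix (Fin m) (Fin n) ℂ)
    (k : Matrix (Fin m) (Fin m) ℂ) : Matrix (Fin (n * m)) (Fin (n * m)) ℂ :=
  Matrix.reindex finProdFinEquiv finProdFinEquiv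
    (Matrix.of fun (x y : Fin n × Fin m) => h x.1 y.1 * l x.2 y.1 * k x.2 y.2)

/-- The cubic root of unity `j = e^{2πi/3}`. -/
def jRoot : ℂ := exp (2 * Real.pi * I / 3)

/-- The Tao matrix `T`. -/
def taoMatrix : Matrix (Fin 6) (Fin 6) ℂ :=
  !![1, 1,         1,         1,         1,         1;
     1, 1,         jRoot,     jRoot,     jRoot ^ 2, jRoot ^ 2;
     1, jRoot,     1,         jRoot ^ 2, jRoot ^ 2, jRoot;
     1, jRoot,     jRoot ^ 2, 1,         jRoot,     jRoot ^ 2;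
     1, jRoot ^ 2, jRoot ^ 2, jRoot,     1,         jRoot;
     1, jRoot ^ 2, jRoot,     jRoot ^ 2, jRoot,     1]

/-- The Haagerup matrix `H^q`. -/
def haagerupMatrix (q : ℂ) : Matrix (Fin 6) (Fin 6) ℂ :=
  !![1, 1,  1,       1,       1,  1;
     1, -1, I,       I,       -I, -I;
     1, I,  -1,      -I,      q,  -q;
     1, I,  -I,      -1,      -q, q;
     1, -I, star q,  -star q, I,  -1;
     1, -I, -star q, star q,  -1, I]

/-- The Diţă deformation `F_{23}^{rs}` of `F_2 ⊗ F_3`. -/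
def ditaF23 (r s : ℂ) : Matrix (Fin 6) (Fin 6) ℂ :=
  ditaDeformation (fourierMatrix 2) !![1, 1; 1, r; 1, s] (fourierMatrix 3)

/-- The Diţă deformation `F_{32}^{rs}` of `F_3 ⊗ F_2`. -/
def ditaF32 (r s : ℂ) : Matrix (Fin 6) (Fin 6) ℂ :=
  ditaDeformation (fourierMatrix 3) !![1, 1, 1; 1, r, s] (fourierMatrix 2)

end

/-! A sum of six terms made of prime cycles has shape 2+2+2 or 3+3, so every quotient of two rows is
of two-type or of three-type (`isTwoType_or_isThreeType`). This colours the edges of the complete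
graph on the six rows, and Ramsey's theorem gives a monochromatic triangle
(`exists_monochromatic_triple`).

Three-type triangle. The three quotients multiply to one, which forces a common splitting of the
columns into two triples on which each is a rotated triple of cube roots (`exists_isCompleteOn`).
Hence three rows form two copies of F_3 up to phases. Column orthogonality makes the two lower 3×3
blocks Fourier-like as well, with equal or opposite orientation (`exists_blockMatrix`).
Orthogonality of upper and lower rows becomes a relation between Fourier transforms on Z/3. With
equal orientations its solutions are F_23 or F_32 (`isClassified_blockMatrix_one`). With opposite
orientations the transforms have constant modulus and the matrix is Tao's
(`isClassified_blockMatrix_two`). Only orthogonality is used for the other rows.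

Two-type triangle. Comparing three perfect matchings of the columns shows that a quotient of two
rows is proportional to a permutation of (1,-1,i,-i,q,-q) (`exists_sq_eq_neg_sq`). Such quotients
exclude a three-type relation with any further row, so all rows are pairwise of two-type
(`isTwoType_of_two_triangle`). Once a row is normalized to (1,-1,i,-i,q,-q), sixteen candidate rows
remain; the only ways to choose four compatible ones give Haagerup matrices
(`isClassified_of_isTwoType`).

Conversely, the entries of the four families are monomials in a root of unity and the parameters, so
regularity is a finite check on exponents. -/

/-! ### Cube roots of unity and numbers of modulus one. -/

theorem jRoot_pow_three : jRoot ^ 3 = 1 := by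
  rw [jRoot, ← Complex.exp_nat_mul, ← Complex.exp_two_pi_mul_I]
  congr 1
  push_cast
  ring

theorem isPrimitiveRoot_jRoot : IsPrimitiveRoot jRoot 3 := by
  have := Complex.isPrimitiveRoot_exp 3 (by norm_num)
  simpa [jRoot] using this

theorem jRoot_ne_one : jRoot ≠ 1 := isPrimitiveRoot_jRoot.ne_one (by norm_num)

theorem jRoot_sq : jRoot ^ 2 = -1 - jRoot := by
  have h : (jRoot - 1) * (jRoot ^ 2 + jRoot + 1) = 0 := by
    linear_combination jRoot_pow_three
  have h' := (mul_eq_zero.mp h).resolve_left (sub_ne_zero.mpr jRoot_ne_one)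
  linear_combination h'

theorem norm_jRoot : ‖jRoot‖ = 1 :=
  isPrimitiveRoot_jRoot.norm'_eq_one (by norm_num)

theorem jRoot_ne_zero : jRoot ≠ 0 := isPrimitiveRoot_jRoot.ne_zero (by norm_num)

theorem star_eq_inv_of_norm {z : ℂ} (hz : ‖z‖ = 1) : star z = z⁻¹ := by
  rw [Complex.inv_def, Complex.normSq_eq_norm_sq, hz]
  simp

theorem ne_zero_of_norm {z : ℂ} (hz : ‖z‖ = 1) : z ≠ 0 := by
  rintro rfl
  simp at hz

/-- Two families with the same multiset of values differ by a permutation. -/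
theorem exists_perm_of_map_eq {n : ℕ} {α : Type*} {f g : Fin n → α}
    (h : (Finset.univ : Finset (Fin n)).val.map f = (Finset.univ : Finset (Fin n)).val.map g) :
    ∃ σ : Equiv.Perm (Fin n), ∀ a, f (σ a) = g a := by
  classical
  have hc : ∀ c, Nonempty ({a // g a = c} ≃ {b // f b = c}) := by
    intro c
    have := congrArg (Multiset.count c) h
    rw [Multiset.count_map, Multiset.count_map] at this
    refine ⟨Fintype.equivOfCardEq ?_⟩
    rw [Fintype.card_subtype, Fintype.card_subtype]
    simp only [Finset.card_def, Finset.filter_val]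
    simpa only [eq_comm] using this.symm
  exact ⟨Equiv.ofFiberEquiv fun c => (hc c).some, fun a => Equiv.ofFiberEquiv_map _ a⟩

/-! ### Perfect matchings, and the two shapes of a six-term sum of cycles. -/

/-- The perfect matchings of six points, as fixed-point-free involutions. -/
def matching : Fin 15 → Fin 6 → Fin 6 :=
  ![![1, 0, 3, 2, 5, 4], ![1, 0, 4, 5, 2, 3], ![1, 0, 5, 4, 3, 2],
    ![2, 3, 0, 1, 5, 4], ![2, 4, 0, 5, 1, 3], ![2, 5, 0, 4, 3, 1],
    ![3, 2, 1, 0, 5, 4], ![3, 4, 5, 0, 1, 2], ![3, 5, 4, 0, 2, 1],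
    ![4, 2, 1, 5, 0, 3], ![4, 3, 5, 1, 0, 2], ![4, 5, 3, 2, 0, 1],
    ![5, 2, 1, 4, 3, 0], ![5, 3, 4, 1, 2, 0], ![5, 4, 3, 2, 1, 0]]

theorem matching_matching : ∀ m a, matching m (matching m a) = a := by decide +kernel

theorem matching_ne : ∀ m a, matching m a ≠ a := by decide +kernel

theorem matching_injective (m : Fin 15) : Function.Injective (matching m) :=
  Function.LeftInverse.injective (matching_matching m)

/-- The numbers `a`, ..., `f` are the values of an involution. The hypotheses are placed between the
quantifiers so that most branches of the enumeration are cut early. -/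
theorem exists_matching_aux : ∀ a b : Fin 6, a ≠ 0 ∧ b ≠ 1 ∧ (a = 1 ↔ b = 0) →
    ∀ c d : Fin 6, c ≠ 2 ∧ d ≠ 3 ∧ (c = 3 ↔ d = 2) → ∀ e f : Fin 6, e ≠ 4 ∧ f ≠ 5 →
    (∀ i : Fin 6, ![a, b, c, d, e, f] (![a, b, c, d, e, f] i) = i) →
    ∃ m, ∀ i, matching m i = ![a, b, c, d, e, f] i := by
  decide +kernel

theorem exists_matching (g : Fin 6 → Fin 6) (h1 : ∀ a, g (g a) = a) (h2 : ∀ a, g a ≠ a) :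
    ∃ m, matching m = g := by
  have hg : g = ![g 0, g 1, g 2, g 3, g 4, g 5] := by
    ext i; fin_cases i <;> rfl
  have h3 : ∀ a b, g a = b ↔ g b = a :=
    fun a b => ⟨fun h => by rw [← h, h1], fun h => by rw [← h, h1]⟩
  obtain ⟨m, hm⟩ := exists_matching_aux (g 0) (g 1) ⟨h2 0, h2 1, h3 0 1⟩
    (g 2) (g 3) ⟨h2 2, h2 3, h3 2 3⟩ (g 4) (g 5) ⟨h2 4, h2 5⟩ (by rw [← hg]; exact h1)
  exact ⟨m, by rw [hg]; exact funext hm⟩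

theorem univ_val_eq_matching : ∀ m : Fin 15, ∃ a b c : Fin 6,
    (Finset.univ : Finset (Fin 6)).val =
      {a, matching m a} + ({b, matching m b} + {c, matching m c}) := by
  decide +kernel

/-- The values of `w` form three pairs of opposite numbers. -/
def IsTwoType (w : Fin 6 → ℂ) : Prop :=
  ∃ m, ∀ a, w (matching m a) = -w a

/-- The values of `w` form two rotated triples of cubic roots of unity. -/
def IsThreeType (w : Fin 6 → ℂ) : Prop :=
  ∃ (e : Equiv.Perm (Fin 6)) (α β : ℂ), ∀ a, w (e a) = (if a < 3 then α else β) * jRoot ^ (a : ℕ)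

theorem rotatedCycle_two (a : ℂ) : rotatedCycle 2 a = {a, -a} := by
  have : exp (2 * Real.pi * I / (2 : ℕ)) = -1 := by
    rw [← Complex.exp_pi_mul_I]; congr 1; push_cast; ring
  rw [rotatedCycle, this]
  simp only [Multiset.range_succ, Multiset.range_zero, Multiset.map_cons, Multiset.map_zero,
    pow_zero, mul_one, pow_one, mul_neg]
  exact Multiset.cons_swap _ _ _

theorem rotatedCycle_three (a : ℂ) :
    rotatedCycle 3 a = {a, a * jRoot, a * jRoot ^ 2} := by
  have : exp (2 * Real.pi * I / (3 : ℕ)) = jRoot := by simp [jRoot]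
  rw [rotatedCycle, this]
  simp only [Multiset.range_succ, Multiset.range_zero, Multiset.map_cons, Multiset.map_zero,
    pow_zero, mul_one, pow_one]
  rw [Multiset.cons_swap (a * jRoot) a, Multiset.cons_swap (a * jRoot ^ 2) a,
    Multiset.cons_swap (a * jRoot ^ 2)]
  rfl

theorem card_rotatedCycle (p : ℕ) (a : ℂ) : Multiset.card (rotatedCycle p a) = p := by
  simp [rotatedCycle]

theorem IsTwoType.isSumOfCycles {w : Fin 6 → ℂ} (hw : ∀ a, ‖w a‖ = 1) (h : IsTwoType w) :
    IsSumOfCycles ((Finset.univ : Finset (Fin 6)).val.map w) := by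
  obtain ⟨m, hm⟩ := h
  obtain ⟨a, b, c, habc⟩ := univ_val_eq_matching m
  refine ⟨{rotatedCycle 2 (w a), rotatedCycle 2 (w b), rotatedCycle 2 (w c)}, ?_, ?_⟩
  · intro s hs
    simp only [Multiset.insert_eq_cons, Multiset.mem_cons, Multiset.mem_singleton] at hs
    rcases hs with rfl | rfl | rfl
    exacts [⟨2, _, Nat.prime_two, hw _, rfl⟩, ⟨2, _, Nat.prime_two, hw _, rfl⟩,
      ⟨2, _, Nat.prime_two, hw _, rfl⟩]
  · rw [habc]
    simp [rotatedCycle_two, hm]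

theorem IsThreeType.isSumOfCycles {w : Fin 6 → ℂ} (hw : ∀ a, ‖w a‖ = 1) (h : IsThreeType w) :
    IsSumOfCycles ((Finset.univ : Finset (Fin 6)).val.map w) := by
  obtain ⟨e, α, β, he⟩ := h
  have hmap : (Finset.univ : Finset (Fin 6)).val.map w
      = (Finset.univ : Finset (Fin 6)).val.map (w ∘ e) := by
    rw [← Multiset.map_map, Multiset.map_univ_val_equiv]
  have h0 : w (e 0) = α := by simpa using he 0
  have h3 : w (e 3) = β := by simpa [jRoot_pow_three] using he 3
  have h4 : w (e 4) = β * jRoot := by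
    have := he 4
    rw [this]; simp [pow_succ _ 3, jRoot_pow_three]
  have h5 : w (e 5) = β * jRoot ^ 2 := by
    have := he 5
    rw [this]; simp [pow_add _ 3 2, show (5 : ℕ) = 3 + 2 from rfl, jRoot_pow_three]
  have h1 : w (e 1) = α * jRoot := by simpa using he 1
  have h2 : w (e 2) = α * jRoot ^ 2 := by
    have := he 2
    rw [this]; rw [if_pos (by decide)]; rfl
  refine ⟨{rotatedCycle 3 α, rotatedCycle 3 β}, ?_, ?_⟩
  · intro s hs
    simp only [Multiset.insert_eq_cons, Multiset.mem_cons, Multiset.mem_singleton] at hs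
    rcases hs with rfl | rfl
    exacts [⟨3, _, Nat.prime_three, h0 ▸ hw _, rfl⟩, ⟨3, _, Nat.prime_three, h3 ▸ hw _, rfl⟩]
  · have hu : (Finset.univ : Finset (Fin 6)).val = {0, 1, 2} + {3, 4, 5} := by decide
    rw [hmap, hu]
    simp [rotatedCycle_three, h0, h1, h2, h3, h4, h5]

theorem isTwoType_of_map_eq {w : Fin 6 → ℂ} {a b c : ℂ}
    (h : (Finset.univ : Finset (Fin 6)).val.map w = {a, -a} + ({b, -b} + {c, -c})) :
    IsTwoType w := by
  have hu : (Finset.univ : Finset (Fin 6)).val = {0, 1} + ({2, 3} + {4, 5}) := by decide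
  obtain ⟨σ, hσ⟩ := exists_perm_of_map_eq (f := w) (g := ![a, -a, b, -b, c, -c])
    (by rw [h, hu]; simp)
  obtain ⟨m, hm⟩ := exists_matching (fun x => σ (matching 0 (σ.symm x)))
    (fun x => by simp [matching_matching])
    (fun x hx => matching_ne 0 (σ.symm x) (σ.injective (by rw [hx]; simp)))
  refine ⟨m, fun x => ?_⟩
  obtain ⟨y, rfl⟩ := σ.surjective x
  rw [hm]
  simp only [Equiv.symm_apply_apply, hσ]
  fin_cases y <;> simp [matching]

theorem isThreeType_of_map_eq {w : Fin 6 → ℂ} {a b : ℂ}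
    (h : (Finset.univ : Finset (Fin 6)).val.map w
      = {a, a * jRoot, a * jRoot ^ 2} + {b, b * jRoot, b * jRoot ^ 2}) :
    IsThreeType w := by
  have hu : (Finset.univ : Finset (Fin 6)).val = {0, 1, 2} + {3, 4, 5} := by decide
  obtain ⟨σ, hσ⟩ := exists_perm_of_map_eq (f := w)
    (g := ![a, a * jRoot, a * jRoot ^ 2, b, b * jRoot, b * jRoot ^ 2])
    (by rw [h, hu]; simp)
  refine ⟨σ, a, b, fun x => ?_⟩
  rw [hσ]
  have h3 := jRoot_pow_three
  fin_cases x
  · simp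
  · simp
  · rw [if_pos (by decide)]; rfl
  · simp [h3]
  · simp [pow_succ _ 3, h3]
  · simp [pow_add _ 3 2, show (5 : ℕ) = 3 + 2 from rfl, h3]

/-- Cycles are removed one at a time. A remainder of one term is impossible, which excludes 5+1,
3+2+1 and 2+3+1, and leaves only 2+2+2 and 3+3. -/
theorem isTwoType_or_isThreeType {w : Fin 6 → ℂ}
    (h : IsSumOfCycles ((Finset.univ : Finset (Fin 6)).val.map w)) :
    IsTwoType w ∨ IsThreeType w := by
  obtain ⟨C, hC, hs⟩ := h
  have key : ∀ (n : ℕ) (C : Multiset (Multiset ℂ)), (∀ c ∈ C, IsPrimeCycle c) →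
      Multiset.card C.sum = n → 0 < n → ∃ (p : ℕ) (a : ℂ) (D : Multiset (Multiset ℂ)),
        p.Prime ∧ (∀ c ∈ D, IsPrimeCycle c) ∧ C.sum = rotatedCycle p a + D.sum ∧
        Multiset.card D.sum + p = n := by
    intro n C hC hn hpos
    obtain ⟨c, hc⟩ : ∃ c, c ∈ C := by
      apply Multiset.exists_mem_of_ne_zero
      rintro rfl
      simp at hn
      omega
    obtain ⟨D, rfl⟩ := Multiset.exists_cons_of_mem hc
    obtain ⟨p, a, hp, -, rfl⟩ := hC _ (Multiset.mem_cons_self _ _)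
    refine ⟨p, a, D, hp, fun c hc => hC c (Multiset.mem_cons_of_mem hc), by simp, ?_⟩
    rw [← hn]
    simp [card_rotatedCycle, add_comm]
  have hcard : Multiset.card C.sum = 6 := by rw [hs]; simp
  have small : ∀ (n : ℕ) (C : Multiset (Multiset ℂ)), (∀ c ∈ C, IsPrimeCycle c) →
      Multiset.card C.sum = n → n ≠ 1 := by
    rintro n C hC hn rfl
    obtain ⟨p, a, D, hp, -, -, h⟩ := key 1 C hC hn one_pos
    have := hp.two_le
    omega
  obtain ⟨p, a, D, hp, hD, h1, h2⟩ := key 6 C hC hcard (by norm_num)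
  have hple : p ≤ 6 := by omega
  interval_cases p
  all_goals first | (exfalso; revert hp; norm_num; done) | skip
  all_goals simp only [Nat.reduceEqDiff] at h2
  · obtain ⟨p', b, D', hp', hD', h1', h2'⟩ := key 4 D hD h2 (by norm_num)
    have hp'le : p' ≤ 4 := by omega
    interval_cases p'
    all_goals first | (exfalso; revert hp'; norm_num; done) | skip
    all_goals simp only [Nat.reduceEqDiff] at h2'
    · obtain ⟨p'', c, D'', hp'', hD'', h1'', h2''⟩ := key 2 D' hD' h2' (by norm_num)
      have : p'' = 2 := by have := hp''.two_le; omega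
      subst this
      have h0 : D''.sum = 0 := by
        rw [← Multiset.card_eq_zero]; omega
      left
      apply isTwoType_of_map_eq (a := a) (b := b) (c := c)
      rw [← hs, h1, h1', h1'', h0]
      simp [rotatedCycle_two]
    · exact absurd rfl (small 1 D' hD' h2')
  · obtain ⟨p', b, D', hp', hD', h1', h2'⟩ := key 3 D hD h2 (by norm_num)
    have hp'le : p' ≤ 3 := by omega
    interval_cases p'
    all_goals first | (exfalso; revert hp'; norm_num; done) | skip
    all_goals simp only [Nat.reduceEqDiff] at h2'
    · exact absurd rfl (small 1 D' hD' h2')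
    · have h0 : D'.sum = 0 := by
        rw [← Multiset.card_eq_zero]; omega
      right
      apply isThreeType_of_map_eq (a := a) (b := b)
      rw [← hs, h1, h1', h0]
      simp [rotatedCycle_three]
  · exact absurd rfl (small 1 D hD h2)

/-! ### Equivalence of matrices, quotients of rows, and regularity in terms of the two types. -/

theorem HadamardEquiv.refl {n : ℕ} (h : Matrix (Fin n) (Fin n) ℂ) : HadamardEquiv h h :=
  ⟨1, 1, fun _ => 1, fun _ => 1, by simp, by simp, by simp⟩

theorem HadamardEquiv.symm {n : ℕ} {h k : Matrix (Fin n) (Fin n) ℂ} (H : HadamardEquiv h k) :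
    HadamardEquiv k h := by
  obtain ⟨σ, τ, a, b, ha, hb, H⟩ := H
  refine ⟨σ.symm, τ.symm, fun i => (a (σ.symm i))⁻¹, fun j => (b (τ.symm j))⁻¹,
    fun i => by simp [ha], fun j => by simp [hb], fun i j => ?_⟩
  have h1 := ne_zero_of_norm (ha (σ.symm i))
  have h2 := ne_zero_of_norm (hb (τ.symm j))
  rw [H]
  simp only [Equiv.apply_symm_apply]
  field_simp

theorem HadamardEquiv.trans {n : ℕ} {h k l : Matrix (Fin n) (Fin n) ℂ} (H : HadamardEquiv h k)
    (K : HadamardEquiv k l) : HadamardEquiv h l := by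
  obtain ⟨σ, τ, a, b, ha, hb, H⟩ := H
  obtain ⟨σ', τ', a', b', ha', hb', K⟩ := K
  refine ⟨σ.trans σ', τ.trans τ', fun i => a i * a' (σ i), fun j => b j * b' (τ j),
    fun i => by simp [ha, ha'], fun j => by simp [hb, hb'], fun i j => ?_⟩
  rw [H, K]
  simp only [Equiv.trans_apply]
  ring

theorem IsTwoType.const_mul_comp {w : Fin 6 → ℂ} (h : IsTwoType w) (τ : Equiv.Perm (Fin 6))
    (c : ℂ) : IsTwoType fun a => c * w (τ a) := by
  obtain ⟨m, hm⟩ := h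
  obtain ⟨m', hm'⟩ := exists_matching (fun x => τ.symm (matching m (τ x)))
    (fun x => by simp [matching_matching])
    (fun x hx => matching_ne m (τ x) (τ.symm.injective (by rw [hx]; simp)))
  exact ⟨m', fun a => by rw [hm']; simp [hm]⟩

theorem IsThreeType.const_mul_comp {w : Fin 6 → ℂ} (h : IsThreeType w) (τ : Equiv.Perm (Fin 6))
    (c : ℂ) : IsThreeType fun a => c * w (τ a) := by
  obtain ⟨e, α, β, he⟩ := h
  refine ⟨e.trans τ.symm, c * α, c * β, fun a => ?_⟩
  simp only [Equiv.trans_apply, Equiv.apply_symm_apply, he]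
  split_ifs <;> ring

theorem IsTwoType.inv {w : Fin 6 → ℂ} (h : IsTwoType w) : IsTwoType fun a => (w a)⁻¹ := by
  obtain ⟨m, hm⟩ := h
  exact ⟨m, fun a => by simp only [hm, inv_neg]⟩

theorem jRoot_pow_mod (n : ℕ) : jRoot ^ n = jRoot ^ (n % 3) := by
  conv_lhs => rw [← Nat.div_add_mod n 3, pow_add, pow_mul, jRoot_pow_three, one_pow, one_mul]

theorem jRoot_inv_pow (n : ℕ) : (jRoot ^ n)⁻¹ = jRoot ^ (2 * n) := by
  have h := jRoot_pow_three
  refine inv_eq_of_mul_eq_one_right ?_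
  rw [← pow_add, ← one_add_mul, show 1 + 2 = 3 from rfl, pow_mul, h, one_pow]

theorem IsThreeType.inv {w : Fin 6 → ℂ} (h : IsThreeType w) : IsThreeType fun a => (w a)⁻¹ := by
  obtain ⟨e, α, β, he⟩ := h
  -- Inversion exchanges `j` and `j²` inside each triple.
  refine ⟨(Equiv.swap 1 2 * Equiv.swap 4 5 : Equiv.Perm (Fin 6)).trans e, α⁻¹, β⁻¹, fun a => ?_⟩
  have key : ∀ a : Fin 6, ((Equiv.swap 1 2 * Equiv.swap 4 5 : Equiv.Perm (Fin 6)) a < 3 ↔ a < 3) ∧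
      2 * ((Equiv.swap 1 2 * Equiv.swap 4 5 : Equiv.Perm (Fin 6)) a : ℕ) % 3 = a % 3 := by
    decide
  simp only [Equiv.trans_apply, he, mul_inv, jRoot_inv_pow, key]
  rw [jRoot_pow_mod, (key a).2, ← jRoot_pow_mod]
  split_ifs <;> rfl

theorem IsTwoType.sum_eq_zero {w : Fin 6 → ℂ} (h : IsTwoType w) : ∑ a, w a = 0 := by
  obtain ⟨m, hm⟩ := h
  have : ∑ a, w (matching m a) = ∑ a, w a :=
    Function.Bijective.sum_comp (Finite.injective_iff_bijective.mp (matching_injective m)) w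
  simp only [hm, Finset.sum_neg_distrib] at this
  linear_combination -this / 2

theorem IsThreeType.sum_eq_zero {w : Fin 6 → ℂ} (h : IsThreeType w) : ∑ a, w a = 0 := by
  obtain ⟨e, α, β, he⟩ := h
  rw [← Equiv.sum_comp e, Finset.sum_congr rfl fun a _ => he a, Fin.sum_univ_six]
  have h3 := jRoot_pow_three
  have h2 := jRoot_sq
  norm_num [Fin.lt_def]
  linear_combination (α + β * jRoot ^ 3) * h2

/-- The entrywise quotient of two rows. -/
noncomputable def rowRatio (h : Matrix (Fin 6) (Fin 6) ℂ) (i j : Fin 6) : Fin 6 → ℂ :=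
  fun a => h i a / h j a

theorem formalScalarProduct_eq {h : Matrix (Fin 6) (Fin 6) ℂ} (hu : ∀ i j, ‖h i j‖ = 1)
    (i j : Fin 6) : formalScalarProduct (h i) (h j) = Finset.univ.val.map (rowRatio h i j) := by
  rw [formalScalarProduct]
  congr 1
  funext a
  rw [star_eq_inv_of_norm (hu j a), rowRatio, div_eq_mul_inv]

theorem norm_rowRatio {h : Matrix (Fin 6) (Fin 6) ℂ} (hu : ∀ i j, ‖h i j‖ = 1)
    (i j a : Fin 6) : ‖rowRatio h i j a‖ = 1 := by
  simp [rowRatio, hu]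

theorem Matrix.IsHadamard.norm_apply {h : Matrix (Fin 6) (Fin 6) ℂ} (H : h.IsHadamard)
    (i j : Fin 6) : ‖h i j‖ = 1 :=
  CStarRing.norm_of_mem_unitary (H.apply_mem i j)

theorem Matrix.IsHadamard.row_orthogonal {h : Matrix (Fin 6) (Fin 6) ℂ} (H : h.IsHadamard)
    {i j : Fin 6} (hij : i ≠ j) : ∑ a, h i a * star (h j a) = 0 := by
  have := congrFun (congrFun H.mul_conjTranspose i) j
  simpa [Matrix.mul_apply, hij] using this

theorem Matrix.IsHadamard.col_orthogonal {h : Matrix (Fin 6) (Fin 6) ℂ} (H : h.IsHadamard)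
    {i j : Fin 6} (hij : i ≠ j) : ∑ a, star (h a i) * h a j = 0 := by
  have := congrFun (congrFun H.conjTranspose_mul i) j
  simpa [Matrix.mul_apply, hij] using this

theorem isHadamard_of_row_orthogonal {h : Matrix (Fin 6) (Fin 6) ℂ} (hu : ∀ i j, ‖h i j‖ = 1)
    (ho : ∀ i j, i ≠ j → ∑ a, rowRatio h i j a = 0) : h.IsHadamard := by
  refine IsHadamard.of_mul_conjTranspose (fun i j => ?_) ?_ ?_
  · rw [Unitary.mem_iff, star_eq_inv_of_norm (hu i j)]
    have := ne_zero_of_norm (hu i j)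
    simp [this]
  · ext i j
    have hs : (h * hᴴ) i j = ∑ a, rowRatio h i j a := by
      rw [Matrix.mul_apply]
      refine Finset.sum_congr rfl fun a _ => ?_
      rw [conjTranspose_apply, star_eq_inv_of_norm (hu j a), rowRatio, div_eq_mul_inv]
    rw [hs]
    by_cases hij : i = j
    · subst hij
      have : ∀ a, rowRatio h i i a = 1 := fun a => div_self (ne_zero_of_norm (hu i a))
      simp [this]
    · rw [ho i j hij]
      simp [hij]
  · exact IsRegular.of_ne_zero (by simp)

theorem isRegularHadamard_iff {h : Matrix (Fin 6) (Fin 6) ℂ} :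
    IsRegularHadamard h ↔ (∀ i j, ‖h i j‖ = 1) ∧
      ∀ i j, i ≠ j → IsTwoType (rowRatio h i j) ∨ IsThreeType (rowRatio h i j) := by
  constructor
  · rintro ⟨H, hr⟩
    refine ⟨H.norm_apply, fun i j hij => isTwoType_or_isThreeType ?_⟩
    rw [← formalScalarProduct_eq H.norm_apply]
    exact hr i j hij
  · rintro ⟨hu, hr⟩
    refine ⟨isHadamard_of_row_orthogonal hu fun i j hij =>
      (hr i j hij).elim IsTwoType.sum_eq_zero IsThreeType.sum_eq_zero, fun i j hij => ?_⟩
    rw [formalScalarProduct_eq hu]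
    exact (hr i j hij).elim (IsTwoType.isSumOfCycles (norm_rowRatio hu i j))
      (IsThreeType.isSumOfCycles (norm_rowRatio hu i j))

theorem rowRatio_of_equiv {h k : Matrix (Fin 6) (Fin 6) ℂ} {σ τ : Equiv.Perm (Fin 6)}
    {a b : Fin 6 → ℂ} (hb : ∀ j, ‖b j‖ = 1)
    (H : ∀ i j, h i j = a i * b j * k (σ i) (τ j)) (i j : Fin 6) :
    rowRatio h i j = fun x => (a i / a j) * rowRatio k (σ i) (σ j) (τ x) := by
  funext x
  have := ne_zero_of_norm (hb x)
  simp only [rowRatio, H]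
  rw [div_mul_div_comm, mul_right_comm, mul_right_comm (a j), mul_div_mul_right _ _ this]

theorem IsRegularHadamard.of_equiv {h k : Matrix (Fin 6) (Fin 6) ℂ} (H : HadamardEquiv h k)
    (hk : IsRegularHadamard k) : IsRegularHadamard h := by
  obtain ⟨σ, τ, a, b, ha, hb, H⟩ := H
  rw [isRegularHadamard_iff] at hk ⊢
  refine ⟨fun i j => by simp [H, ha, hb, hk.1], fun i j hij => ?_⟩
  rw [rowRatio_of_equiv hb H]
  exact (hk.2 (σ i) (σ j) (σ.injective.ne hij)).imp (fun h => h.const_mul_comp τ _)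
    (fun h => h.const_mul_comp τ _)

theorem isTwoType_rowRatio_comm {h : Matrix (Fin 6) (Fin 6) ℂ} {i j : Fin 6} :
    IsTwoType (rowRatio h i j) ↔ IsTwoType (rowRatio h j i) := by
  have : ∀ i j, IsTwoType (rowRatio h i j) → IsTwoType (rowRatio h j i) := fun i j H => by
    have := H.inv
    simp only [rowRatio, inv_div] at this
    exact this
  exact ⟨this i j, this j i⟩

theorem isThreeType_rowRatio_comm {h : Matrix (Fin 6) (Fin 6) ℂ} {i j : Fin 6} :
    IsThreeType (rowRatio h i j) ↔ IsThreeType (rowRatio h j i) := by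
  have : ∀ i j, IsThreeType (rowRatio h i j) → IsThreeType (rowRatio h j i) := fun i j H => by
    have := H.inv
    simp only [rowRatio, inv_div] at this
    exact this
  exact ⟨this i j, this j i⟩

/-! ### Monomials, and decidable tests for the types and for equivalence. -/

/-- The formal monomial `ζ ^ k * r ^ e * s ^ f`, encoded as `(k, e, f)`. -/
abbrev Mono := ℕ × ℤ × ℤ

/-- The value of a formal monomial. -/
noncomputable def Mono.eval (ζ r s : ℂ) (x : Mono) : ℂ := ζ ^ x.1 * r ^ x.2.1 * s ^ x.2.2

/-- The product of formal monomials. -/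
def Mono.mul (x y : Mono) : Mono := (x.1 + y.1, x.2.1 + y.2.1, x.2.2 + y.2.2)

/-- The formal relation `x = ζ ^ c * y`, when `ζ` has order dividing `N`. -/
def Mono.rel (N c : ℕ) (x y : Mono) : Bool :=
  (x.1 % N == (y.1 + c) % N) && (x.2.1 == y.2.1) && (x.2.2 == y.2.2)

theorem Mono.eval_mul {ζ r s : ℂ} (hr : r ≠ 0) (hs : s ≠ 0) (x y : Mono) :
    (x.mul y).eval ζ r s = x.eval ζ r s * y.eval ζ r s := by
  simp only [Mono.eval, Mono.mul, pow_add, zpow_add₀ hr, zpow_add₀ hs]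
  ring

theorem Mono.eval_of_rel {ζ r s : ℂ} {N c : ℕ} (hζ : ζ ^ N = 1) {x y : Mono}
    (h : x.rel N c y) : x.eval ζ r s = ζ ^ c * y.eval ζ r s := by
  simp only [Mono.rel, Bool.and_eq_true, beq_iff_eq] at h
  obtain ⟨⟨h1, h2⟩, h3⟩ := h
  have hmod : ∀ n, ζ ^ n = ζ ^ (n % N) := fun n => by
    conv_lhs => rw [← Nat.div_add_mod n N, pow_add, pow_mul, hζ, one_pow, one_mul]
  rw [Mono.eval, Mono.eval, h2, h3, hmod, h1, ← hmod, pow_add]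
  ring

theorem Mono.norm_eval {ζ r s : ℂ} (hζ : ‖ζ‖ = 1) (hr : ‖r‖ = 1) (hs : ‖s‖ = 1) (x : Mono) :
    ‖x.eval ζ r s‖ = 1 := by
  simp [Mono.eval, hζ, hr, hs]

/-- The partitions of six points into two triples. -/
def tripleSplit : Fin 10 → Fin 6 → Fin 6 :=
  ![![0, 1, 2, 3, 4, 5], ![0, 1, 3, 2, 4, 5], ![0, 1, 4, 2, 3, 5], ![0, 1, 5, 2, 3, 4],
    ![0, 2, 3, 1, 4, 5], ![0, 2, 4, 1, 3, 5], ![0, 2, 5, 1, 3, 4], ![0, 3, 4, 1, 2, 5],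
    ![0, 3, 5, 1, 2, 4], ![0, 4, 5, 1, 2, 3]]

theorem tripleSplit_injective : ∀ t, Function.Injective (tripleSplit t) := by decide +kernel

/-- The exponents `c` and `d` record the cyclic orientation of each triple. An orientation 2 is
reversed by swapping the last two points of the triple, so unordered splittings suffice in the
tests. -/
theorem isThreeType_of_triples {w : Fin 6 → ℂ} (e : Equiv.Perm (Fin 6)) {c d : ℕ}
    (hc : c = 1 ∨ c = 2) (hd : d = 1 ∨ d = 2)
    (h1 : w (e 1) = jRoot ^ c * w (e 0)) (h2 : w (e 2) = jRoot ^ (2 * c) * w (e 0))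
    (h3 : w (e 4) = jRoot ^ d * w (e 3)) (h4 : w (e 5) = jRoot ^ (2 * d) * w (e 3)) :
    IsThreeType w := by
  have std : ∀ f : Equiv.Perm (Fin 6), w (f 1) = jRoot ^ 1 * w (f 0) →
      w (f 2) = jRoot ^ (2 * 1) * w (f 0) → w (f 4) = jRoot ^ 1 * w (f 3) →
      w (f 5) = jRoot ^ (2 * 1) * w (f 3) → IsThreeType w := by
    intro f g1 g2 g3 g4
    refine ⟨f, w (f 0), w (f 3), fun a => ?_⟩
    have h3 := jRoot_pow_three
    rw [jRoot_pow_mod]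
    fin_cases a
    · simp
    · simp only [pow_one] at g1; simp [g1, mul_comm]
    · rw [if_pos (by decide)]; simpa [mul_comm] using g2
    · simp
    · simp only [pow_one] at g3; simp [g3, mul_comm]
    · simpa [mul_comm] using g4
  have h4' : jRoot ^ (2 * 2) = jRoot ^ 1 := by rw [jRoot_pow_mod]
  have key : ∀ f : Equiv.Perm (Fin 6), w (f 1) = jRoot ^ 1 * w (f 0) →
      w (f 2) = jRoot ^ (2 * 1) * w (f 0) → w (f 4) = jRoot ^ d * w (f 3) →
      w (f 5) = jRoot ^ (2 * d) * w (f 3) → IsThreeType w := by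
    intro f g1 g2 g3 g4
    rcases hd with rfl | rfl
    · exact std f g1 g2 g3 g4
    · have s : ∀ i : Fin 6, i ≠ 4 → i ≠ 5 → (Equiv.swap 4 5) i = i :=
        fun i => Equiv.swap_apply_of_ne_of_ne
      refine std ((Equiv.swap 4 5).trans f) ?_ ?_ ?_ ?_ <;>
        simp only [Equiv.trans_apply, Equiv.swap_apply_left, Equiv.swap_apply_right]
      · rwa [s _ (by decide) (by decide), s _ (by decide) (by decide)]
      · rwa [s _ (by decide) (by decide), s _ (by decide) (by decide)]
      · rwa [s _ (by decide) (by decide), ← h4']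
      · rwa [s _ (by decide) (by decide), mul_one]
  rcases hc with rfl | rfl
  · exact key e h1 h2 h3 h4
  · have s : ∀ i : Fin 6, i ≠ 1 → i ≠ 2 → (Equiv.swap 1 2) i = i :=
      fun i => Equiv.swap_apply_of_ne_of_ne
    refine key ((Equiv.swap 1 2).trans e) ?_ ?_ ?_ ?_ <;>
      simp only [Equiv.trans_apply, Equiv.swap_apply_left, Equiv.swap_apply_right]
    · rwa [s _ (by decide) (by decide), ← h4']
    · rwa [s _ (by decide) (by decide), mul_one]
    · rwa [s _ (by decide) (by decide), s _ (by decide) (by decide)]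
    · rwa [s _ (by decide) (by decide), s _ (by decide) (by decide)]

/-- Formal test for the quotient of two rows of monomials to be of two-type. -/
def twoTest (N : ℕ) (x y : Fin 6 → Mono) : Prop :=
  ∃ m, ∀ a, ((x (matching m a)).mul (y a)).rel N (N / 2) ((x a).mul (y (matching m a)))

/-- Formal test for the quotient of two rows of monomials to be of three-type. -/
def threeTest (N : ℕ) (x y : Fin 6 → Mono) : Prop :=
  ∃ t, ∃ c ∈ [1, 2], ∃ d ∈ [1, 2], ∀ u ∈ [((1 : Fin 6), (0 : Fin 6), c), (2, 0, 2 * c),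
    (4, 3, d), (5, 3, 2 * d)],
    ((x (tripleSplit t u.1)).mul (y (tripleSplit t u.2.1))).rel N (N / 3 * u.2.2)
      ((x (tripleSplit t u.2.1)).mul (y (tripleSplit t u.1)))

instance (N : ℕ) (x y : Fin 6 → Mono) : Decidable (twoTest N x y) := by
  unfold twoTest; infer_instance

instance (N : ℕ) (x y : Fin 6 → Mono) : Decidable (threeTest N x y) := by
  unfold threeTest; infer_instance

/-- The matrix of values of a matrix of formal monomials. -/
noncomputable def evalMatrix (ζ r s : ℂ) (A : Fin 6 → Fin 6 → Mono) : Matrix (Fin 6) (Fin 6) ℂ :=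
  Matrix.of fun i j => (A i j).eval ζ r s

theorem div_eq_mul_div {x y x' y' c : ℂ} (hy : y ≠ 0) (hy' : y' ≠ 0)
    (h : x' * y = c * (x * y')) : x' / y' = c * (x / y) := by
  field_simp
  linear_combination h

theorem isTwoType_of_twoTest {N : ℕ} {ζ r s : ℂ} (hζ : ‖ζ‖ = 1) (hr : ‖r‖ = 1) (hs : ‖s‖ = 1)
    (hN : ζ ^ N = 1) (h2 : ζ ^ (N / 2) = -1) {x y : Fin 6 → Mono} (h : twoTest N x y) :
    IsTwoType fun a => (x a).eval ζ r s / (y a).eval ζ r s := by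
  obtain ⟨m, hm⟩ := h
  refine ⟨m, fun a => ?_⟩
  have hne : ∀ x : Mono, x.eval ζ r s ≠ 0 := fun x => ne_zero_of_norm (x.norm_eval hζ hr hs)
  have := Mono.eval_of_rel (r := r) (s := s) hN (hm a)
  rw [Mono.eval_mul (ne_zero_of_norm hr) (ne_zero_of_norm hs),
    Mono.eval_mul (ne_zero_of_norm hr) (ne_zero_of_norm hs), h2] at this
  rw [← neg_one_mul]
  exact div_eq_mul_div (hne _) (hne _) this

theorem isThreeType_of_threeTest {N : ℕ} {ζ r s : ℂ} (hζ : ‖ζ‖ = 1) (hr : ‖r‖ = 1) (hs : ‖s‖ = 1)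
    (hN : ζ ^ N = 1) (h3 : ζ ^ (N / 3) = jRoot) {x y : Fin 6 → Mono} (h : threeTest N x y) :
    IsThreeType fun a => (x a).eval ζ r s / (y a).eval ζ r s := by
  obtain ⟨t, c, hc, d, hd, h⟩ := h
  have hne : ∀ x : Mono, x.eval ζ r s ≠ 0 := fun x => ne_zero_of_norm (x.norm_eval hζ hr hs)
  have key : ∀ u ∈ [((1 : Fin 6), (0 : Fin 6), c), (2, 0, 2 * c), (4, 3, d), (5, 3, 2 * d)],
      (x (tripleSplit t u.1)).eval ζ r s / (y (tripleSplit t u.1)).eval ζ r s =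
      jRoot ^ u.2.2 *
        ((x (tripleSplit t u.2.1)).eval ζ r s / (y (tripleSplit t u.2.1)).eval ζ r s) := by
    intro u hu
    have := Mono.eval_of_rel (r := r) (s := s) hN (h u hu)
    rw [Mono.eval_mul (ne_zero_of_norm hr) (ne_zero_of_norm hs),
      Mono.eval_mul (ne_zero_of_norm hr) (ne_zero_of_norm hs), pow_mul, h3] at this
    exact div_eq_mul_div (hne _) (hne _) this
  exact isThreeType_of_triples
    (Equiv.ofBijective _ (Finite.injective_iff_bijective.mp (tripleSplit_injective t)))
    (by simpa using hc) (by simpa using hd) (key (1, 0, c) (by simp))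
    (key (2, 0, 2 * c) (by simp)) (key (4, 3, d) (by simp)) (key (5, 3, 2 * d) (by simp))

/-- The condition on `ζ ^ (N / 3)` accompanies the three-type alternative only, so that `N = 4`,
where there is no cube root of unity other than 1 among the powers of `ζ`, is also covered. -/
theorem isRegularHadamard_evalMatrix {N : ℕ} {ζ r s : ℂ} (hζ : ‖ζ‖ = 1) (hr : ‖r‖ = 1)
    (hs : ‖s‖ = 1) (hN : ζ ^ N = 1) (h2 : ζ ^ (N / 2) = -1)
    (A : Fin 6 → Fin 6 → Mono)
    (hA : ∀ i j, i ≠ j → twoTest N (A i) (A j) ∨ threeTest N (A i) (A j) ∧ ζ ^ (N / 3) = jRoot) :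
    IsRegularHadamard (evalMatrix ζ r s A) := by
  rw [isRegularHadamard_iff]
  refine ⟨fun i j => Mono.norm_eval hζ hr hs _, fun i j hij => ?_⟩
  refine (hA i j hij).imp (fun h => ?_) (fun h => ?_)
  · exact isTwoType_of_twoTest hζ hr hs hN h2 h
  · exact isThreeType_of_threeTest hζ hr hs hN h.2 h.1

/-- The cross ratios of entries with the first row and column are unchanged by row and column
phases, and they determine the matrix up to such phases. Writing them without division makes the
condition an identity of monomials. -/
theorem hadamardEquiv_of_cross {h k : Matrix (Fin 6) (Fin 6) ℂ} (hh : ∀ i j, ‖h i j‖ = 1)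
    (hk : ∀ i j, ‖k i j‖ = 1) (σ τ : Equiv.Perm (Fin 6))
    (H : ∀ i j, h i j * h 0 0 * (k (σ i) (τ 0) * k (σ 0) (τ j)) =
      h i 0 * h 0 j * (k (σ 0) (τ 0) * k (σ i) (τ j))) : HadamardEquiv h k := by
  refine ⟨σ, τ, fun i => h i 0 / k (σ i) (τ 0),
    fun j => h 0 j * k (σ 0) (τ 0) / (h 0 0 * k (σ 0) (τ j)), fun i => by simp [hh, hk],
    fun j => by simp [hh, hk], fun i j => ?_⟩
  have h1 := ne_zero_of_norm (hh 0 0)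
  have h2 := ne_zero_of_norm (hk (σ i) (τ 0))
  have h3 := ne_zero_of_norm (hk (σ 0) (τ j))
  field_simp
  linear_combination H i j

/-- Formal test for the equivalence of two matrices of monomials. -/
def equivTest (N : ℕ) (A B : Fin 6 → Fin 6 → Mono) (σ τ : Fin 6 → Fin 6) : Prop :=
  ∀ i j, Mono.rel N 0
    (((A i j).mul (A 0 0)).mul ((B (σ i) (τ 0)).mul (B (σ 0) (τ j))))
    (((A i 0).mul (A 0 j)).mul ((B (σ 0) (τ 0)).mul (B (σ i) (τ j))))

instance (N : ℕ) (A B : Fin 6 → Fin 6 → Mono) (σ τ : Fin 6 → Fin 6) :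
    Decidable (equivTest N A B σ τ) := by
  unfold equivTest; infer_instance

theorem hadamardEquiv_of_equivTest {N : ℕ} {ζ r s : ℂ} (hζ : ‖ζ‖ = 1) (hr : ‖r‖ = 1)
    (hs : ‖s‖ = 1) (hN : ζ ^ N = 1) {A B : Fin 6 → Fin 6 → Mono} {σ τ : Fin 6 → Fin 6}
    (hσ : Function.Injective σ) (hτ : Function.Injective τ) (H : equivTest N A B σ τ) :
    HadamardEquiv (evalMatrix ζ r s A) (evalMatrix ζ r s B) := by
  refine hadamardEquiv_of_cross (fun i j => Mono.norm_eval hζ hr hs _)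
    (fun i j => Mono.norm_eval hζ hr hs _)
    (Equiv.ofBijective _ (Finite.injective_iff_bijective.mp hσ))
    (Equiv.ofBijective _ (Finite.injective_iff_bijective.mp hτ)) fun i j => ?_
  have := Mono.eval_of_rel (r := r) (s := s) hN (H i j)
  simp only [Mono.eval_mul (ne_zero_of_norm hr) (ne_zero_of_norm hs), pow_zero, one_mul] at this
  exact this

/-! ### The matrices of the four families are regular. -/

/-- The exponents of the Tao matrix. -/
def taoMono : Fin 6 → Fin 6 → Mono :=
  ![![(0, 0, 0), (0, 0, 0), (0, 0, 0), (0, 0, 0), (0, 0, 0), (0, 0, 0)],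
    ![(0, 0, 0), (0, 0, 0), (2, 0, 0), (2, 0, 0), (4, 0, 0), (4, 0, 0)],
    ![(0, 0, 0), (2, 0, 0), (0, 0, 0), (4, 0, 0), (4, 0, 0), (2, 0, 0)],
    ![(0, 0, 0), (2, 0, 0), (4, 0, 0), (0, 0, 0), (2, 0, 0), (4, 0, 0)],
    ![(0, 0, 0), (4, 0, 0), (4, 0, 0), (2, 0, 0), (0, 0, 0), (2, 0, 0)],
    ![(0, 0, 0), (4, 0, 0), (2, 0, 0), (4, 0, 0), (2, 0, 0), (0, 0, 0)]]

/-- The exponents of the Haagerup matrix. -/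
def haagerupMono : Fin 6 → Fin 6 → Mono :=
  ![![(0, 0, 0), (0, 0, 0), (0, 0, 0), (0, 0, 0), (0, 0, 0), (0, 0, 0)],
    ![(0, 0, 0), (2, 0, 0), (1, 0, 0), (1, 0, 0), (3, 0, 0), (3, 0, 0)],
    ![(0, 0, 0), (1, 0, 0), (2, 0, 0), (3, 0, 0), (0, 1, 0), (2, 1, 0)],
    ![(0, 0, 0), (1, 0, 0), (3, 0, 0), (2, 0, 0), (2, 1, 0), (0, 1, 0)],
    ![(0, 0, 0), (3, 0, 0), (0, -1, 0), (2, -1, 0), (1, 0, 0), (2, 0, 0)],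
    ![(0, 0, 0), (3, 0, 0), (2, -1, 0), (0, -1, 0), (2, 0, 0), (1, 0, 0)]]

/-- The exponents of the deformation `F_{23}^{rs}`. -/
def ditaMono23 : Fin 6 → Fin 6 → Mono :=
  ![![(0, 0, 0), (0, 0, 0), (0, 0, 0), (0, 0, 0), (0, 0, 0), (0, 0, 0)],
    ![(0, 0, 0), (2, 0, 0), (4, 0, 0), (0, 1, 0), (2, 1, 0), (4, 1, 0)],
    ![(0, 0, 0), (4, 0, 0), (2, 0, 0), (0, 0, 1), (4, 0, 1), (2, 0, 1)],
    ![(0, 0, 0), (0, 0, 0), (0, 0, 0), (3, 0, 0), (3, 0, 0), (3, 0, 0)],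
    ![(0, 0, 0), (2, 0, 0), (4, 0, 0), (3, 1, 0), (5, 1, 0), (1, 1, 0)],
    ![(0, 0, 0), (4, 0, 0), (2, 0, 0), (3, 0, 1), (1, 0, 1), (5, 0, 1)]]

/-- The exponents of the deformation `F_{32}^{rs}`. -/
def ditaMono32 : Fin 6 → Fin 6 → Mono :=
  ![![(0, 0, 0), (0, 0, 0), (0, 0, 0), (0, 0, 0), (0, 0, 0), (0, 0, 0)],
    ![(0, 0, 0), (3, 0, 0), (0, 1, 0), (3, 1, 0), (0, 0, 1), (3, 0, 1)],
    ![(0, 0, 0), (0, 0, 0), (2, 0, 0), (2, 0, 0), (4, 0, 0), (4, 0, 0)],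
    ![(0, 0, 0), (3, 0, 0), (2, 1, 0), (5, 1, 0), (4, 0, 1), (1, 0, 1)],
    ![(0, 0, 0), (0, 0, 0), (4, 0, 0), (4, 0, 0), (2, 0, 0), (2, 0, 0)],
    ![(0, 0, 0), (3, 0, 0), (4, 1, 0), (1, 1, 0), (2, 0, 1), (5, 0, 1)]]

/-- The primitive sixth root of unity `-j²`. -/
noncomputable def sixthRoot : ℂ := -jRoot ^ 2

theorem sixthRoot_sq : sixthRoot ^ 2 = jRoot := by
  rw [sixthRoot]; linear_combination jRoot * jRoot_pow_three

theorem sixthRoot_pow_three : sixthRoot ^ 3 = -1 := by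
  rw [sixthRoot]; linear_combination (-1 - jRoot ^ 3) * jRoot_pow_three

theorem sixthRoot_pow_six : sixthRoot ^ 6 = 1 := by
  rw [show 6 = 3 * 2 from rfl, pow_mul, sixthRoot_pow_three]; norm_num

theorem norm_sixthRoot : ‖sixthRoot‖ = 1 := by simp [sixthRoot, norm_jRoot]

theorem taoMatrix_eq : taoMatrix = evalMatrix sixthRoot 1 1 taoMono := by
  have h4 : sixthRoot ^ 4 = jRoot ^ 2 := by
    rw [← sixthRoot_sq]; ring
  ext i j
  fin_cases i <;> fin_cases j <;>
    simp [taoMatrix, evalMatrix, taoMono, Mono.eval, sixthRoot_sq, h4]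

theorem haagerupMatrix_eq {q : ℂ} (hq : ‖q‖ = 1) :
    haagerupMatrix q = evalMatrix I q 1 haagerupMono := by
  have h3 := I_pow_three
  have hs : (starRingEnd ℂ) q = q⁻¹ := star_eq_inv_of_norm hq
  ext i j
  fin_cases i <;> fin_cases j <;>
    simp [haagerupMatrix, evalMatrix, haagerupMono, Mono.eval, h3, hs]

theorem fourierMatrix_two : fourierMatrix 2 = !![1, 1; 1, -1] := by
  have : exp (2 * Real.pi * I / (2 : ℕ)) = -1 := by
    rw [← Complex.exp_pi_mul_I]; congr 1; push_cast; ring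
  ext i j
  rw [fourierMatrix, Matrix.of_apply, this]
  fin_cases i <;> fin_cases j <;> simp

theorem fourierMatrix_three :
    fourierMatrix 3 = !![1, 1, 1; 1, jRoot, jRoot ^ 2; 1, jRoot ^ 2, jRoot] := by
  have : exp (2 * Real.pi * I / (3 : ℕ)) = jRoot := by simp [jRoot]
  ext i j
  rw [fourierMatrix, Matrix.of_apply, this]
  have h4 : jRoot ^ 4 = jRoot := by rw [jRoot_pow_mod, pow_one]
  fin_cases i <;> fin_cases j <;> simp [h4]

theorem ditaDeformation_apply {n m : ℕ} (h : Matrix (Fin n) (Fin n) ℂ) (l : Matrix (Fin m) (Fin n) ℂ)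
    (k : Matrix (Fin m) (Fin m) ℂ) (i j : Fin (n * m)) : ditaDeformation h l k i j =
      h i.divNat j.divNat * l i.modNat j.divNat * k i.modNat j.modNat := rfl

theorem ditaF23_eq (r s : ℂ) : ditaF23 r s = evalMatrix sixthRoot r s ditaMono23 := by
  have h4 : sixthRoot ^ 4 = jRoot ^ 2 := by
    rw [← sixthRoot_sq]; ring
  have h5 : sixthRoot ^ 5 = -jRoot := by
    rw [pow_succ, h4, sixthRoot]; linear_combination -jRoot * jRoot_pow_three
  have h3 := sixthRoot_pow_three
  have h2 := sixthRoot_sq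
  have h1 : sixthRoot = -jRoot ^ 2 := rfl
  have key : ∀ i j : Fin 6, ditaDeformation (fourierMatrix 2) !![1, 1; 1, r; 1, s]
      (fourierMatrix 3) i j = evalMatrix sixthRoot r s ditaMono23 i j := by
    intro i j
    rw [ditaDeformation_apply, fourierMatrix_two, fourierMatrix_three, evalMatrix,
      Matrix.of_apply]
    fin_cases i <;> fin_cases j <;>
      simp [Mono.eval, ditaMono23, h2, h3, h4, h5, Fin.divNat, Fin.modNat] <;> simp [h1, mul_comm]
  ext i j
  exact key i j

theorem ditaF32_eq (r s : ℂ) : ditaF32 r s = evalMatrix sixthRoot r s ditaMono32 := by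
  have h4 : sixthRoot ^ 4 = jRoot ^ 2 := by
    rw [← sixthRoot_sq]; ring
  have h5 : sixthRoot ^ 5 = -jRoot := by
    rw [pow_succ, h4, sixthRoot]; linear_combination -jRoot * jRoot_pow_three
  have h3 := sixthRoot_pow_three
  have h2 := sixthRoot_sq
  have h1 : sixthRoot = -jRoot ^ 2 := rfl
  have key : ∀ i j : Fin 6, ditaDeformation (fourierMatrix 3) !![1, 1, 1; 1, r, s]
      (fourierMatrix 2) i j = evalMatrix sixthRoot r s ditaMono32 i j := by
    intro i j
    rw [ditaDeformation_apply, fourierMatrix_two, fourierMatrix_three, evalMatrix,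
      Matrix.of_apply]
    fin_cases i <;> fin_cases j <;>
      simp [Mono.eval, ditaMono32, h2, h3, h4, h5, Fin.divNat, Fin.modNat] <;> simp [h1, mul_comm]
  ext i j
  exact key i j

theorem isRegularHadamard_evalMatrix_six {r s : ℂ} (hr : ‖r‖ = 1) (hs : ‖s‖ = 1)
    (A : Fin 6 → Fin 6 → Mono)
    (hA : ∀ i j, i ≠ j → twoTest 6 (A i) (A j) ∨ threeTest 6 (A i) (A j)) :
    IsRegularHadamard (evalMatrix sixthRoot r s A) :=
  isRegularHadamard_evalMatrix norm_sixthRoot hr hs sixthRoot_pow_six sixthRoot_pow_three A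
    fun i j hij => (hA i j hij).imp id fun h => ⟨h, sixthRoot_sq⟩

theorem isRegularHadamard_taoMatrix : IsRegularHadamard taoMatrix := by
  rw [taoMatrix_eq]
  exact isRegularHadamard_evalMatrix_six norm_one norm_one _ (by decide +kernel)

theorem isRegularHadamard_haagerupMatrix {q : ℂ} (hq : ‖q‖ = 1) :
    IsRegularHadamard (haagerupMatrix q) := by
  rw [haagerupMatrix_eq hq]
  have : ∀ i j, i ≠ j → twoTest 4 (haagerupMono i) (haagerupMono j) := by decide +kernel
  exact isRegularHadamard_evalMatrix norm_I hq norm_one I_pow_four I_sq _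
    fun i j hij => Or.inl (this i j hij)

theorem isRegularHadamard_ditaF23 {r s : ℂ} (hr : ‖r‖ = 1) (hs : ‖s‖ = 1) :
    IsRegularHadamard (ditaF23 r s) := by
  rw [ditaF23_eq]
  exact isRegularHadamard_evalMatrix_six hr hs _ (by decide +kernel)

theorem isRegularHadamard_ditaF32 {r s : ℂ} (hr : ‖r‖ = 1) (hs : ‖s‖ = 1) :
    IsRegularHadamard (ditaF32 r s) := by
  rw [ditaF32_eq]
  exact isRegularHadamard_evalMatrix_six hr hs _ (by decide +kernel)

/-! ### Three rows of pairwise three-type: a common splitting of the columns. -/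

/-- The side of a point in a partition of six points into two triples. -/
def tripleSide (t : Fin 10) (a : Fin 6) : Bool :=
  a = tripleSplit t 0 || a = tripleSplit t 1 || a = tripleSplit t 2

theorem exists_tripleSide : ∀ s : Fin 6 → Bool, (Finset.univ.filter fun a => s a).card = 3 →
    ∃ t, ∀ a b, tripleSide t a = tripleSide t b ↔ s a = s b := by
  decide +kernel

/-- No pair of points is separated by exactly one of the splittings. If two of them were different,
the third would be their symmetric difference, whose sides have even size and hence not size three.
-/
theorem tripleSide_of_not_one_differs : ∀ t t' t'' : Fin 10,
    (∀ a b, tripleSide t a = tripleSide t b → tripleSide t' a = tripleSide t' b →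
      tripleSide t'' a = tripleSide t'' b) →
    (∀ a b, tripleSide t a = tripleSide t b → tripleSide t'' a = tripleSide t'' b →
      tripleSide t' a = tripleSide t' b) →
    (∀ a b, tripleSide t' a = tripleSide t' b → tripleSide t'' a = tripleSide t'' b →
      tripleSide t a = tripleSide t b) → t = t' ∧ t' = t'' := by
  decide +kernel

theorem tripleSide_injective : ∀ t t' : Fin 10,
    (∀ a b, tripleSide t a = tripleSide t b → tripleSide t' a = tripleSide t' b) → t = t' := by
  decide +kernel

theorem exists_tripleSide_ne : ∀ t, ∃ a b, tripleSide t a ≠ tripleSide t b := by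
  decide +kernel

theorem exists_third_of_tripleSide : ∀ t a b, a ≠ b → tripleSide t a = tripleSide t b →
    ∃ c, c ≠ a ∧ c ≠ b ∧ tripleSide t a = tripleSide t c := by
  decide +kernel

/-- On each of the two triples, the values of `w` form a rotated triple of cubic roots of unity. -/
def IsCompleteOn (t : Fin 10) (w : Fin 6 → ℂ) : Prop :=
  ∀ a b, a ≠ b → tripleSide t a = tripleSide t b → w a ≠ w b ∧ w a ^ 3 = w b ^ 3

theorem IsCompleteOn.inv {t : Fin 10} {w : Fin 6 → ℂ} (h : IsCompleteOn t w) :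
    IsCompleteOn t fun a => (w a)⁻¹ := fun a b hab hs =>
  ⟨fun e => (h a b hab hs).1 (inv_injective e), by
    simp only [inv_pow, (h a b hab hs).2]⟩

theorem add_add_eq_zero_of_cubes {x y z : ℂ} (hxy : x ≠ y) (hyz : y ≠ z) (hxz : x ≠ z)
    (h : x ^ 3 = y ^ 3) (h' : y ^ 3 = z ^ 3) : x + y + z = 0 := by
  have h1 : x ^ 2 + x * y + y ^ 2 = 0 := by
    have : (x - y) * (x ^ 2 + x * y + y ^ 2) = 0 := by linear_combination h
    exact (mul_eq_zero.mp this).resolve_left (sub_ne_zero.mpr hxy)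
  have h2 : y ^ 2 + y * z + z ^ 2 = 0 := by
    have : (y - z) * (y ^ 2 + y * z + z ^ 2) = 0 := by linear_combination h'
    exact (mul_eq_zero.mp this).resolve_left (sub_ne_zero.mpr hyz)
  have : (x - z) * (x + y + z) = 0 := by linear_combination h1 - h2
  exact (mul_eq_zero.mp this).resolve_left (sub_ne_zero.mpr hxz)

theorem jRoot_pow_eq_iff : ∀ a b : Fin 3, jRoot ^ (a : ℕ) = jRoot ^ (b : ℕ) ↔ a = b := by
  intro a b
  exact ⟨fun h => Fin.ext (isPrimitiveRoot_jRoot.pow_inj a.2 b.2 h), fun h => by rw [h]⟩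

theorem jRoot_pow_add (a b : Fin 3) : jRoot ^ ((a + b : Fin 3) : ℕ) = jRoot ^ (a : ℕ) * jRoot ^ (b : ℕ) := by
  rw [← pow_add, Fin.val_add, ← jRoot_pow_mod]

theorem jRoot_pow_pow_three (n : ℕ) : (jRoot ^ n) ^ 3 = 1 := by
  rw [← pow_mul, mul_comm, pow_mul, jRoot_pow_three, one_pow]

theorem exists_jRoot_pow {z : ℂ} (h : z ^ 3 = 1) : ∃ k : Fin 3, z = jRoot ^ (k : ℕ) := by
  obtain ⟨i, hi, rfl⟩ := isPrimitiveRoot_jRoot.eq_pow_of_pow_eq_one h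
  exact ⟨⟨i, hi⟩, rfl⟩

/-- A map to `Fin 3` taking each value twice. -/
def IsTwoToOne (k : Fin 6 → Fin 3) : Prop := ∀ c, (Finset.univ.filter fun a => k a = c).card = 2

instance (k : Fin 6 → Fin 3) : Decidable (IsTwoToOne k) := by
  unfold IsTwoToOne; infer_instance

theorem IsTwoToOne.comp {k : Fin 6 → Fin 3} (h : IsTwoToOne k) (e : Equiv.Perm (Fin 6)) :
    IsTwoToOne fun a => k (e a) := fun c => by
  rw [← h c]
  exact Finset.card_equiv e (by simp)

/-- The dichotomy is whether the two rotation factors have the same cube. If so, both triples run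
through the same coset of the cube roots of unity. If not, the cube of `w` distinguishes the two
triples. -/
theorem IsThreeType.cases {w : Fin 6 → ℂ} (hw : ∀ a, w a ≠ 0) (h : IsThreeType w) :
    (∃ (γ : ℂ) (k : Fin 6 → Fin 3), γ ≠ 0 ∧ IsTwoToOne k ∧ ∀ a, w a = γ * jRoot ^ (k a : ℕ)) ∨
    (∃ t, IsCompleteOn t w ∧ ∀ a b, w a ^ 3 = w b ^ 3 ↔ tripleSide t a = tripleSide t b) := by
  obtain ⟨e, α, β, he⟩ := h
  have h0 : α ≠ 0 := by
    have := hw (e 0)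
    rw [he] at this
    exact left_ne_zero_of_mul this
  have h3 : β ≠ 0 := by
    have := hw (e 3)
    rw [he] at this
    exact left_ne_zero_of_mul this
  have he' : ∀ a, w a = (if e.symm a < 3 then α else β) * jRoot ^ (e.symm a : ℕ) := fun a => by
    rw [← he, Equiv.apply_symm_apply]
  by_cases hαβ : α ^ 3 = β ^ 3
  · left
    obtain ⟨t, ht⟩ := exists_jRoot_pow (z := β / α) (by rw [div_pow, hαβ, div_self (pow_ne_zero 3 h3)])
    have hβ : β = α * jRoot ^ (t : ℕ) := by rw [← ht]; field_simp
    have h2 : ∀ t : Fin 3, IsTwoToOne fun a => if a < 3 then Fin.ofNat 3 a else t + Fin.ofNat 3 a := by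
      decide +kernel
    refine ⟨α, _, h0, (h2 t).comp e.symm, fun a => ?_⟩
    rw [he']
    split_ifs with h
    · rw [jRoot_pow_mod]; rfl
    · rw [jRoot_pow_add, hβ, mul_assoc, jRoot_pow_mod (e.symm a)]; rfl
  · right
    obtain ⟨t, ht⟩ := exists_tripleSide (fun a => e.symm a < 3) (by
      have : (Finset.univ.filter fun a : Fin 6 => a < 3).card = 3 := by decide
      rw [← this]
      exact Finset.card_equiv e.symm (by simp))
    have hcube : ∀ a, w a ^ 3 = if e.symm a < 3 then α ^ 3 else β ^ 3 := fun a => by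
      rw [he', mul_pow, jRoot_pow_pow_three]
      split_ifs <;> ring
    have hiff : ∀ a b, w a ^ 3 = w b ^ 3 ↔ tripleSide t a = tripleSide t b := by
      intro a b
      rw [hcube, hcube, ht, decide_eq_decide]
      have := Ne.symm hαβ
      split_ifs with h1 h2 h2 <;> simp [h1, h2, hαβ, this]
    refine ⟨t, fun a b hab hs => ⟨fun hwab => hab ?_, (hiff a b).mpr hs⟩, hiff⟩
    rw [ht, decide_eq_decide] at hs
    rw [he' a, he' b] at hwab
    have hpow : jRoot ^ (e.symm a : ℕ) = jRoot ^ (e.symm b : ℕ) := by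
      by_cases h : e.symm b < 3
      · rw [if_pos h, if_pos (hs.mpr h)] at hwab
        exact mul_left_cancel₀ h0 hwab
      · rw [if_neg h, if_neg (fun h' => h (hs.mp h'))] at hwab
        exact mul_left_cancel₀ h3 hwab
    rw [jRoot_pow_mod, jRoot_pow_mod (e.symm b)] at hpow
    have hmod := isPrimitiveRoot_jRoot.pow_inj (Nat.mod_lt _ (by norm_num))
      (Nat.mod_lt _ (by norm_num)) hpow
    have : ∀ a b : Fin 6, (a < 3 ↔ b < 3) → (a : ℕ) % 3 = b % 3 → a = b := by decide
    exact e.symm.injective (this _ _ hs hmod)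

/-- On a triple, both `p` and `q⁻¹ = p * r` sum to zero. Two equal values of `r` on the triple then
force the third to coincide with them, but `r` takes each of its values only twice. -/
theorem isCompleteOn_of_mul_eq_one {t : Fin 10} {p q r : Fin 6 → ℂ}
    (hpqr : ∀ a, p a * q a * r a = 1) (hp : IsCompleteOn t p) (hq : IsCompleteOn t q)
    {γ : ℂ} {k : Fin 6 → Fin 3} (hγ : γ ≠ 0) (hk : IsTwoToOne k)
    (hr : ∀ a, r a = γ * jRoot ^ (k a : ℕ)) : IsCompleteOn t r := by
  intro a b hab hs
  refine ⟨fun hrab => ?_, by rw [hr, hr, mul_pow, mul_pow, jRoot_pow_pow_three,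
    jRoot_pow_pow_three]⟩
  obtain ⟨c, hca, hcb, hc⟩ := exists_third_of_tripleSide t a b hab hs
  have hbc : tripleSide t b = tripleSide t c := hs.symm.trans hc
  have hq' : ∀ a, (q a)⁻¹ = p a * r a := fun a =>
    inv_eq_of_mul_eq_one_right (by linear_combination hpqr a)
  have hsum := add_add_eq_zero_of_cubes (hp a b hab hs).1 (hp b c hcb.symm hbc).1
    (hp a c hca.symm hc).1 (hp a b hab hs).2 (hp b c hcb.symm hbc).2
  have hsum' := add_add_eq_zero_of_cubes (hq.inv a b hab hs).1 (hq.inv b c hcb.symm hbc).1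
    (hq.inv a c hca.symm hc).1 (hq.inv a b hab hs).2 (hq.inv b c hcb.symm hbc).2
  simp only [hq'] at hsum'
  have hpc : p c ≠ 0 := fun h => by simpa [h] using hpqr c
  have hrc : r c = r a := by
    apply mul_left_cancel₀ hpc
    linear_combination hsum' - r a * hsum + p b * hrab
  have heq : ∀ x, r x = r a → k x = k a := fun x hx => by
    rw [hr, hr] at hx
    exact (jRoot_pow_eq_iff _ _).mp (mul_left_cancel₀ hγ hx)
  have h3 : ({a, b, c} : Finset (Fin 6)).card = 3 := by
    rw [Finset.card_eq_three]
    exact ⟨a, b, c, hab, hca.symm, hcb.symm, rfl⟩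
  have hle := Finset.card_le_card (s := {a, b, c})
    (t := Finset.univ.filter fun x => k x = k a) (by
      intro x hx
      simp only [Finset.mem_insert, Finset.mem_singleton] at hx
      rw [Finset.mem_filter]
      refine ⟨Finset.mem_univ _, ?_⟩
      rcases hx with rfl | rfl | rfl
      exacts [rfl, heq _ hrab.symm, heq _ hrc])
  rw [h3, hk] at hle
  omega

theorem exists_split_of_isTwoToOne_aux : ∀ l0 l1 l2 l3 : Fin 3, ∀ l4 l5 : Fin 3,
    IsTwoToOne ![l0, l1, l2, l3, l4, l5] →
    IsTwoToOne (fun a => ![0, 0, 1, 1, 2, 2] a + ![l0, l1, l2, l3, l4, l5] a) →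
    ∃ t, ∀ a b, a ≠ b → tripleSide t a = tripleSide t b →
      (![0, 0, 1, 1, 2, 2] : Fin 6 → Fin 3) a ≠ ![0, 0, 1, 1, 2, 2] b ∧
      ![l0, l1, l2, l3, l4, l5] a ≠ ![l0, l1, l2, l3, l4, l5] b ∧
      ![0, 0, 1, 1, 2, 2] a + ![l0, l1, l2, l3, l4, l5] a ≠
        ![0, 0, 1, 1, 2, 2] b + ![l0, l1, l2, l3, l4, l5] b := by
  decide +kernel

theorem card_tripleSide : ∀ t, (Finset.univ.filter fun a => tripleSide t a).card = 3 := by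
  decide +kernel

/-- After a reordering of the points `k` is `0, 0, 1, 1, 2, 2`, which leaves a finite check over
`l`. -/
theorem exists_split_of_isTwoToOne {k l : Fin 6 → Fin 3} (hk : IsTwoToOne k) (hl : IsTwoToOne l)
    (hkl : IsTwoToOne fun a => k a + l a) : ∃ t, ∀ a b, a ≠ b → tripleSide t a = tripleSide t b →
      k a ≠ k b ∧ l a ≠ l b ∧ k a + l a ≠ k b + l b := by
  obtain ⟨e, he⟩ : ∃ e : Equiv.Perm (Fin 6), ∀ a, k (e a) = ![0, 0, 1, 1, 2, 2] a := by
    apply exists_perm_of_map_eq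
    ext c
    rw [Multiset.count_map, Multiset.count_map]
    have h2 : ∀ c : Fin 3, Multiset.card (Multiset.filter
        (fun a : Fin 6 => c = ![0, 0, 1, 1, 2, 2] a) Finset.univ.val) = 2 := by decide
    rw [h2, ← hk c]
    simp only [Finset.card_def, Finset.filter_val, eq_comm]
  obtain ⟨t, ht⟩ := exists_split_of_isTwoToOne_aux (l (e 0)) (l (e 1)) (l (e 2)) (l (e 3))
    (l (e 4)) (l (e 5)) (by
      convert hl.comp e using 1
      ext a; fin_cases a <;> rfl) (by
      convert hkl.comp e using 1
      ext a; rw [he]; fin_cases a <;> rfl)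
  have hl' : ![l (e 0), l (e 1), l (e 2), l (e 3), l (e 4), l (e 5)] = fun a => l (e a) := by
    ext a; fin_cases a <;> rfl
  rw [hl'] at ht
  simp only [← he] at ht
  obtain ⟨t', ht'⟩ := exists_tripleSide (fun a => tripleSide t (e.symm a)) (by
      rw [← card_tripleSide t]
      exact Finset.card_equiv e.symm (by simp))
  refine ⟨t', fun a b hab hs => ?_⟩
  rw [ht'] at hs
  simpa using ht (e.symm a) (e.symm b) (e.symm.injective.ne hab) hs

/-- The cubes also multiply to one, so two of them determine the third. Hence it is impossible that
exactly one cube is nonconstant, and if exactly two are, their splittings agree and the third vector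
is complete on the same triples. If all three are nonconstant the splittings coincide by
`tripleSide_of_not_one_differs`; if none is, the matter is one of exponents modulo three. -/
theorem exists_isCompleteOn {p q r : Fin 6 → ℂ} (hpqr : ∀ a, p a * q a * r a = 1)
    (hp : IsThreeType p) (hq : IsThreeType q) (hr : IsThreeType r) :
    ∃ t, IsCompleteOn t p ∧ IsCompleteOn t q ∧ IsCompleteOn t r := by
  have hp0 : ∀ a, p a ≠ 0 := fun a h => by simpa [h] using hpqr a
  have hq0 : ∀ a, q a ≠ 0 := fun a h => by simpa [h] using hpqr a
  have hr0 : ∀ a, r a ≠ 0 := fun a h => by simpa [h] using hpqr a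
  have hc : ∀ a, p a ^ 3 * q a ^ 3 * r a ^ 3 = 1 := fun a => by
    rw [← mul_pow, ← mul_pow, hpqr, one_pow]
  have key : ∀ {x y z : ℂ} {x' y' z' : ℂ}, x' ≠ 0 → y' ≠ 0 → x * y * z = 1 → x' * y' * z' = 1 →
      x = x' → y = y' → z = z' := by
    intro x y z x' y' z' h1 h2 h3 h4 h5 h6
    subst h5 h6
    exact mul_left_cancel₀ (mul_ne_zero h1 h2) (h3.trans h4.symm)
  have kr : ∀ a b, p a ^ 3 = p b ^ 3 → q a ^ 3 = q b ^ 3 → r a ^ 3 = r b ^ 3 := fun a b =>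
    key (pow_ne_zero 3 (hp0 b)) (pow_ne_zero 3 (hq0 b)) (hc a) (hc b)
  have kq : ∀ a b, p a ^ 3 = p b ^ 3 → r a ^ 3 = r b ^ 3 → q a ^ 3 = q b ^ 3 := fun a b =>
    key (pow_ne_zero 3 (hp0 b)) (pow_ne_zero 3 (hr0 b)) (by rw [mul_right_comm]; exact hc a)
      (by rw [mul_right_comm]; exact hc b)
  have kp : ∀ a b, q a ^ 3 = q b ^ 3 → r a ^ 3 = r b ^ 3 → p a ^ 3 = p b ^ 3 := fun a b =>
    key (pow_ne_zero 3 (hq0 b)) (pow_ne_zero 3 (hr0 b))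
      (by rw [mul_comm, ← mul_assoc]; exact hc a) (by rw [mul_comm, ← mul_assoc]; exact hc b)
  have cst : ∀ {w : Fin 6 → ℂ} {γ : ℂ} {k : Fin 6 → Fin 3}, (∀ a, w a = γ * jRoot ^ (k a : ℕ)) →
      ∀ a b, w a ^ 3 = w b ^ 3 := fun h a b => by
    rw [h, h, mul_pow, mul_pow, jRoot_pow_pow_three, jRoot_pow_pow_three]
  rcases hp.cases hp0 with ⟨γ, k, hγ, hk, hpk⟩ | ⟨t, hpt, htp⟩ <;>
  rcases hq.cases hq0 with ⟨δ, l, hδ, hl, hql⟩ | ⟨t', hqt, htq⟩ <;>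
  rcases hr.cases hr0 with ⟨ε, m, hε, hm, hrm⟩ | ⟨t'', hrt, htr⟩
  · have hsum : ∀ a, m a + (k a + l a) = m 0 + (k 0 + l 0) := by
      intro a
      apply (jRoot_pow_eq_iff _ _).mp
      rw [jRoot_pow_add, jRoot_pow_add, jRoot_pow_add, jRoot_pow_add]
      have h1 := hpqr a
      have h2 := hpqr 0
      rw [hpk, hql, hrm] at h1 h2
      apply mul_left_cancel₀ (mul_ne_zero (mul_ne_zero hγ hδ) hε)
      linear_combination h1 - h2
    have hm' : ∀ a, m a = (m 0 + (k 0 + l 0)) - (k a + l a) := fun a =>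
      eq_sub_of_add_eq (hsum a)
    obtain ⟨t, ht⟩ := exists_split_of_isTwoToOne hk hl (fun c => by
      rw [← hm (m 0 + (k 0 + l 0) - c)]
      congr 1
      ext a
      simp only [Finset.mem_filter, Finset.mem_univ, true_and]
      rw [hm' a]
      constructor
      · rintro rfl; rfl
      · intro h; exact sub_right_injective h)
    have ne : ∀ {w : Fin 6 → ℂ} {γ : ℂ} {k : Fin 6 → Fin 3}, γ ≠ 0 →
        (∀ a, w a = γ * jRoot ^ (k a : ℕ)) → ∀ a b, k a ≠ k b → w a ≠ w b := by
      intro w γ k hγ h a b hab hw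
      rw [h, h] at hw
      exact hab ((jRoot_pow_eq_iff _ _).mp (mul_left_cancel₀ hγ hw))
    refine ⟨t, fun a b hab hs => ⟨ne hγ hpk a b (ht a b hab hs).1, cst hpk a b⟩,
      fun a b hab hs => ⟨ne hδ hql a b (ht a b hab hs).2.1, cst hql a b⟩,
      fun a b hab hs => ⟨ne hε hrm a b fun h => (ht a b hab hs).2.2 ?_, cst hrm a b⟩⟩
    rw [hm' a, hm' b] at h
    exact sub_right_injective h
  · obtain ⟨a, b, hab⟩ := exists_tripleSide_ne t''
    exact absurd ((htr a b).mp (kr a b (cst hpk a b) (cst hql a b))) hab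
  · obtain ⟨a, b, hab⟩ := exists_tripleSide_ne t'
    exact absurd ((htq a b).mp (kq a b (cst hpk a b) (cst hrm a b))) hab
  · obtain rfl : t' = t'' := tripleSide_injective _ _ fun a b h =>
      (htr a b).mp (kr a b (cst hpk a b) ((htq a b).mpr h))
    exact ⟨t', isCompleteOn_of_mul_eq_one (fun a => by linear_combination hpqr a) hqt hrt hγ hk hpk,
      hqt, hrt⟩
  · obtain ⟨a, b, hab⟩ := exists_tripleSide_ne t
    exact absurd ((htp a b).mp (kp a b (cst hql a b) (cst hrm a b))) hab
  · obtain rfl : t = t'' := tripleSide_injective _ _ fun a b h =>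
      (htr a b).mp (kr a b ((htp a b).mpr h) (cst hql a b))
    exact ⟨t, hpt,
      isCompleteOn_of_mul_eq_one (fun a => by linear_combination hpqr a) hpt hrt hδ hl hql, hrt⟩
  · obtain rfl : t = t' := tripleSide_injective _ _ fun a b h =>
      (htq a b).mp (kq a b ((htp a b).mpr h) (cst hrm a b))
    exact ⟨t, hpt, hqt, isCompleteOn_of_mul_eq_one hpqr hpt hqt hε hm hrm⟩
  · obtain ⟨rfl, rfl⟩ := tripleSide_of_not_one_differs t t' t''
      (fun a b h h' => (htr a b).mp (kr a b ((htp a b).mpr h) ((htq a b).mpr h')))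
      (fun a b h h' => (htq a b).mp (kq a b ((htp a b).mpr h) ((htr a b).mpr h')))
      (fun a b h h' => (htp a b).mp (kp a b ((htq a b).mpr h) ((htr a b).mpr h')))
    exact ⟨t, hpt, hqt, hrt⟩

/-- The additive character `k ↦ j ^ k` of the integers modulo three. -/
noncomputable def jChar (k : Fin 3) : ℂ := jRoot ^ (k : ℕ)

theorem jChar_zero : jChar 0 = 1 := by simp [jChar]

theorem jChar_one : jChar 1 = jRoot := by simp [jChar]

theorem jChar_two : jChar 2 = jRoot ^ 2 := by simp [jChar]

theorem jChar_add (a b : Fin 3) : jChar (a + b) = jChar a * jChar b := jRoot_pow_add a b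

theorem jChar_ne_zero (a : Fin 3) : jChar a ≠ 0 := pow_ne_zero _ jRoot_ne_zero

theorem norm_jChar (a : Fin 3) : ‖jChar a‖ = 1 := by simp [jChar, norm_jRoot]

theorem jChar_neg (a : Fin 3) : jChar (-a) = (jChar a)⁻¹ := by
  refine eq_inv_of_mul_eq_one_left ?_
  rw [← jChar_add, neg_add_cancel, jChar_zero]

theorem jChar_sub (a b : Fin 3) : jChar (a - b) = jChar a * (jChar b)⁻¹ := by
  rw [sub_eq_add_neg, jChar_add, jChar_neg]

theorem jChar_injective : Function.Injective jChar := fun a b h => (jRoot_pow_eq_iff a b).mp h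

/-- Three numbers with the same cube, pairwise distinct, form a rotated triple of cubic roots. -/
theorem eq_jRoot_mul_of_cubes {x y z : ℂ} (hx : x ≠ 0) (hxy : x ≠ y) (hyz : y ≠ z) (hxz : x ≠ z)
    (h : x ^ 3 = y ^ 3) (h' : y ^ 3 = z ^ 3) :
    (y = jRoot * x ∧ z = jRoot ^ 2 * x) ∨ (y = jRoot ^ 2 * x ∧ z = jRoot * x) := by
  obtain ⟨k, hk⟩ := exists_jRoot_pow (z := y / x) (by
    rw [div_pow, ← h, div_self (pow_ne_zero 3 hx)])
  obtain ⟨l, hl⟩ := exists_jRoot_pow (z := z / x) (by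
    rw [div_pow, ← h', ← h, div_self (pow_ne_zero 3 hx)])
  rw [div_eq_iff hx] at hk hl
  fin_cases k <;> fin_cases l <;> simp_all

/-- Three numbers of modulus one with sum zero form a rotated triple of cubic roots. -/
theorem eq_jRoot_mul_of_add_eq_zero {x y z : ℂ} (hx : ‖x‖ = 1) (hy : ‖y‖ = 1) (hz : ‖z‖ = 1)
    (h : x + y + z = 0) :
    (y = jRoot * x ∧ z = jRoot ^ 2 * x) ∨ (y = jRoot ^ 2 * x ∧ z = jRoot * x) := by
  have hx0 := ne_zero_of_norm hx
  have hy0 := ne_zero_of_norm hy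
  have hz0 := ne_zero_of_norm hz
  -- Conjugating the relation kills the second elementary symmetric function too, so `x`, `y`, `z`
  -- are the roots of some `X³ = c`.
  have h2 : x⁻¹ + y⁻¹ + z⁻¹ = 0 := by
    rw [← star_eq_inv_of_norm hx, ← star_eq_inv_of_norm hy, ← star_eq_inv_of_norm hz, ← star_add,
      ← star_add, h, star_zero]
  have h3 : y * z + x * z + x * y = 0 := by
    field_simp at h2
    linear_combination h2
  have h4 : (y - jRoot * x) * (y - jRoot ^ 2 * x) = 0 := by
    linear_combination (y + x) * h - h3 - x * y * jRoot_sq + x ^ 2 * jRoot_pow_three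
  rcases mul_eq_zero.mp h4 with h5 | h5
  · left
    have h5 : y = jRoot * x := by linear_combination h5
    exact ⟨h5, by linear_combination h - h5 - x * jRoot_sq⟩
  · right
    have h5 : y = jRoot ^ 2 * x := by linear_combination h5
    exact ⟨h5, by linear_combination h - h5 - x * jRoot_sq⟩

theorem tripleSide_split : ∀ t, (∀ i < 3, tripleSide t (tripleSplit t i) = true) ∧
    ∀ i ≥ 3, tripleSide t (tripleSplit t i) = false := by decide +kernel

/-- The rows `1`, `x`, `y` restricted to three columns are proportional to those of `F_3`. -/
def IsFourierTriple (x y : Fin 6 → ℂ) (a b c : Fin 6) : Prop :=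
  (x b = jRoot * x a ∧ x c = jRoot ^ 2 * x a) ∧ y b = jRoot ^ 2 * y a ∧ y c = jRoot * y a

/-- On a triple `x` and `y` each run through the cube roots in one of two orientations. Equal
orientations would make `y / x` constant there, so they are opposite, as for the last two rows of
F_3. -/
theorem isFourierTriple_or {t : Fin 10} {x y : Fin 6 → ℂ} (hx0 : ∀ a, x a ≠ 0) (hy0 : ∀ a, y a ≠ 0)
    (hx : IsCompleteOn t x) (hy : IsCompleteOn t y) (hr : IsCompleteOn t fun a => y a / x a)
    {a b c : Fin 6} (hab : a ≠ b) (hbc : b ≠ c) (hac : a ≠ c)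
    (h1 : tripleSide t a = tripleSide t b) (h2 : tripleSide t b = tripleSide t c) :
    IsFourierTriple x y a b c ∨ IsFourierTriple x y a c b := by
  have h3 := h1.trans h2
  have hj := jRoot_ne_zero
  have hxa := hx0 a
  have X := eq_jRoot_mul_of_cubes (hx0 a) (hx a b hab h1).1 (hx b c hbc h2).1 (hx a c hac h3).1
    (hx a b hab h1).2 (hx b c hbc h2).2
  have Y := eq_jRoot_mul_of_cubes (hy0 a) (hy a b hab h1).1 (hy b c hbc h2).1 (hy a c hac h3).1
    (hy a b hab h1).2 (hy b c hbc h2).2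
  have R := (hr a b hab h1).1
  rcases X with ⟨X1, X2⟩ | ⟨X1, X2⟩ <;> rcases Y with ⟨Y1, Y2⟩ | ⟨Y1, Y2⟩
  · exact absurd (by simp only [X1, Y1]; field_simp) R
  · exact Or.inl ⟨⟨X1, X2⟩, Y1, Y2⟩
  · exact Or.inr ⟨⟨X2, X1⟩, Y2, Y1⟩
  · exact absurd (by simp only [X1, Y1]; field_simp) R

theorem exists_isFourierTriple {x y : Fin 6 → ℂ} (hx0 : ∀ a, x a ≠ 0) (hy0 : ∀ a, y a ≠ 0)
    (hx : IsThreeType x) (hy : IsThreeType y) (hr : IsThreeType fun a => y a / x a) :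
    ∃ e : Equiv.Perm (Fin 6), IsFourierTriple x y (e 0) (e 1) (e 2) ∧
      IsFourierTriple x y (e 3) (e 4) (e 5) := by
  obtain ⟨t, h1, h2, h3⟩ := exists_isCompleteOn (p := x) (q := fun a => (y a)⁻¹)
    (r := fun a => y a / x a) (fun a => by
      have := hx0 a
      have := hy0 a
      field_simp) hx hy.inv hr
  have h2' : IsCompleteOn t y := by simpa using h2.inv
  obtain ⟨ht, ht'⟩ := tripleSide_split t
  have hinj := tripleSplit_injective t
  let e := Equiv.ofBijective _ (Finite.injective_iff_bijective.mp hinj)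
  have step : ∀ f : Equiv.Perm (Fin 6), IsFourierTriple x y (f 0) (f 1) (f 2) →
      (IsFourierTriple x y (f 3) (f 4) (f 5) ∨ IsFourierTriple x y (f 3) (f 5) (f 4)) →
      ∃ e : Equiv.Perm (Fin 6), IsFourierTriple x y (e 0) (e 1) (e 2) ∧
        IsFourierTriple x y (e 3) (e 4) (e 5) := by
    intro f hf hf'
    rcases hf' with hf' | hf'
    · exact ⟨f, hf, hf'⟩
    · have s : ∀ i : Fin 6, i ≠ 4 → i ≠ 5 → (Equiv.swap 4 5) i = i :=
        fun i => Equiv.swap_apply_of_ne_of_ne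
      refine ⟨(Equiv.swap 4 5).trans f, ?_, ?_⟩
      · simpa [s 0 (by decide) (by decide), s 1 (by decide) (by decide),
          s 2 (by decide) (by decide)] using hf
      · simpa [s 3 (by decide) (by decide)] using hf'
  have hB := isFourierTriple_or hx0 hy0 h1 h2' h3 (hinj.ne (show (3 : Fin 6) ≠ 4 by decide))
    (hinj.ne (show (4 : Fin 6) ≠ 5 by decide)) (hinj.ne (show (3 : Fin 6) ≠ 5 by decide))
    (by rw [ht' 3 (by decide), ht' 4 (by decide)]) (by rw [ht' 4 (by decide), ht' 5 (by decide)])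
  rcases isFourierTriple_or hx0 hy0 h1 h2' h3 (hinj.ne (show (0 : Fin 6) ≠ 1 by decide))
    (hinj.ne (show (1 : Fin 6) ≠ 2 by decide)) (hinj.ne (show (0 : Fin 6) ≠ 2 by decide))
    (by rw [ht 0 (by decide), ht 1 (by decide)]) (by rw [ht 1 (by decide), ht 2 (by decide)])
    with hA | hA
  · exact step e hA hB
  · have s : ∀ i : Fin 6, i ≠ 1 → i ≠ 2 → (Equiv.swap 1 2) i = i :=
      fun i => Equiv.swap_apply_of_ne_of_ne
    refine step ((Equiv.swap 1 2).trans e) ?_ ?_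
    · simpa [s 0 (by decide) (by decide), e] using hA
    · simpa [s 3 (by decide) (by decide), s 4 (by decide) (by decide),
          s 5 (by decide) (by decide), e] using hB

/-! ### The block form forced by three rows of pairwise three-type. -/

/-- The conclusion of the classification. -/
def IsClassified (h : Matrix (Fin 6) (Fin 6) ℂ) : Prop :=
  HadamardEquiv h taoMatrix ∨
    (∃ q : ℂ, ‖q‖ = 1 ∧ HadamardEquiv h (haagerupMatrix q)) ∨
    (∃ r s : ℂ, ‖r‖ = 1 ∧ ‖s‖ = 1 ∧ HadamardEquiv h (ditaF23 r s)) ∨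
    (∃ r s : ℂ, ‖r‖ = 1 ∧ ‖s‖ = 1 ∧ HadamardEquiv h (ditaF32 r s))

theorem IsClassified.of_equiv {h k : Matrix (Fin 6) (Fin 6) ℂ} (H : HadamardEquiv h k)
    (hk : IsClassified k) : IsClassified h := by
  rcases hk with hk | ⟨q, hq, hk⟩ | ⟨r, s, hr, hs, hk⟩ | ⟨r, s, hr, hs, hk⟩
  · exact Or.inl (H.trans hk)
  · exact Or.inr (Or.inl ⟨q, hq, H.trans hk⟩)
  · exact Or.inr (Or.inr (Or.inl ⟨r, s, hr, hs, H.trans hk⟩))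
  · exact Or.inr (Or.inr (Or.inr ⟨r, s, hr, hs, H.trans hk⟩))

theorem Matrix.IsHadamard.of_equiv {h k : Matrix (Fin 6) (Fin 6) ℂ} (H : HadamardEquiv h k)
    (hk : k.IsHadamard) : h.IsHadamard := by
  obtain ⟨σ, τ, a, b, ha, hb, H⟩ := H
  refine isHadamard_of_row_orthogonal (fun i j => by simp [H, ha, hb, hk.norm_apply])
    fun i j hij => ?_
  rw [rowRatio_of_equiv hb H, ← Finset.mul_sum, Equiv.sum_comp τ (rowRatio k (σ i) (σ j))]
  have := hk.row_orthogonal (σ.injective.ne hij)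
  have h2 : ∑ x, rowRatio k (σ i) (σ j) x = 0 := by
    rw [← this]
    refine Finset.sum_congr rfl fun x _ => ?_
    rw [star_eq_inv_of_norm (hk.norm_apply _ _), rowRatio, div_eq_mul_inv]
  rw [h2, mul_zero]

/-- Reordering the rows and the columns, then making the first row and column equal to one. -/
noncomputable def dephase (h : Matrix (Fin 6) (Fin 6) ℂ) (σ τ : Equiv.Perm (Fin 6)) :
    Matrix (Fin 6) (Fin 6) ℂ :=
  Matrix.of fun i j => h (σ i) (τ j) * h (σ 0) (τ 0) / (h (σ i) (τ 0) * h (σ 0) (τ j))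

theorem hadamardEquiv_dephase {h : Matrix (Fin 6) (Fin 6) ℂ} (hu : ∀ i j, ‖h i j‖ = 1)
    (σ τ : Equiv.Perm (Fin 6)) : HadamardEquiv (dephase h σ τ) h := by
  refine ⟨σ, τ, fun i => (h (σ i) (τ 0))⁻¹ * h (σ 0) (τ 0), fun j => (h (σ 0) (τ j))⁻¹,
    fun i => by simp [hu], fun j => by simp [hu], fun i j => ?_⟩
  rw [dephase, Matrix.of_apply, div_eq_mul_inv, mul_inv]
  ring

theorem fourier_of_sums_eq_zero {x y z x' y' z' : ℂ} (hx : ‖x‖ = 1) (hy : ‖y‖ = 1) (hz : ‖z‖ = 1)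
    (hx' : ‖x'‖ = 1) (hy' : ‖y'‖ = 1) (hz' : ‖z'‖ = 1) (h : x + y + z = 0)
    (h' : x' + y' + z' = 0) (hr : x' / x + y' / y + z' / z = 0) :
    (y = jRoot * x ∧ z = jRoot ^ 2 * x ∧ y' = jRoot ^ 2 * x' ∧ z' = jRoot * x') ∨
    (y = jRoot ^ 2 * x ∧ z = jRoot * x ∧ y' = jRoot * x' ∧ z' = jRoot ^ 2 * x') := by
  have hx0 := ne_zero_of_norm hx
  have hx0' := ne_zero_of_norm hx'
  have hj := jRoot_ne_zero
  rcases eq_jRoot_mul_of_add_eq_zero hx hy hz h with ⟨h1, h2⟩ | ⟨h1, h2⟩ <;>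
  rcases eq_jRoot_mul_of_add_eq_zero hx' hy' hz' h' with ⟨h3, h4⟩ | ⟨h3, h4⟩
  · subst h1 h2 h3 h4
    rw [mul_div_mul_left _ _ hj, mul_div_mul_left _ _ (pow_ne_zero 2 hj)] at hr
    field_simp at hr
    norm_num at hr
    exact absurd hr hx0'
  · exact Or.inl ⟨h1, h2, h3, h4⟩
  · exact Or.inr ⟨h1, h2, h3, h4⟩
  · subst h1 h2 h3 h4
    rw [mul_div_mul_left _ _ hj, mul_div_mul_left _ _ (pow_ne_zero 2 hj)] at hr
    field_simp at hr
    norm_num at hr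
    exact absurd hr hx0'

/-- The residue modulo three of an index. -/
def residue (i : Fin 6) : Fin 3 := Fin.ofNat 3 i

/-- A matrix whose four blocks of size three are deformations of `F_3`. -/
noncomputable def blockMatrix (s : Fin 3) (d v w t : Fin 3 → ℂ) : Matrix (Fin 6) (Fin 6) ℂ :=
  Matrix.of fun i j =>
    if i < 3 then (if j < 3 then 1 else d (residue i)) * jChar (residue i * residue j)
    else if j < 3 then v (residue j) * jChar (residue i * residue j)
    else t (residue i) * w (residue j) * jChar (s * residue i * residue j)

theorem eq_blockMatrix {k : Matrix (Fin 6) (Fin 6) ℂ} {s : Fin 3} (hs : s = 1 ∨ s = 2)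
    (h33 : k 3 3 ≠ 0) (hrow : ∀ j, k 0 j = 1) (hcol : ∀ i, k i 0 = 1)
    (h11 : k 1 1 = jRoot) (h12 : k 1 2 = jRoot ^ 2) (h21 : k 2 1 = jRoot ^ 2) (h22 : k 2 2 = jRoot)
    (h14 : k 1 4 = jRoot * k 1 3) (h15 : k 1 5 = jRoot ^ 2 * k 1 3)
    (h24 : k 2 4 = jRoot ^ 2 * k 2 3) (h25 : k 2 5 = jRoot * k 2 3)
    (h41 : k 4 1 = jRoot * k 3 1) (h51 : k 5 1 = jRoot ^ 2 * k 3 1)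
    (h42 : k 4 2 = jRoot ^ 2 * k 3 2) (h52 : k 5 2 = jRoot * k 3 2)
    (h44 : k 4 4 * k 3 3 = jChar s * (k 3 4 * k 4 3))
    (h54 : k 5 4 * k 3 3 = jChar (2 * s) * (k 3 4 * k 5 3))
    (h45 : k 4 5 * k 3 3 = jChar (2 * s) * (k 3 5 * k 4 3))
    (h55 : k 5 5 * k 3 3 = jChar s * (k 3 5 * k 5 3)) :
    k = blockMatrix s ![1, k 1 3, k 2 3] ![1, k 3 1, k 3 2] ![1, k 3 4 / k 3 3, k 3 5 / k 3 3]
      ![k 3 3, k 4 3, k 5 3] := by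
  have h44' := eq_div_of_mul_eq h33 h44
  have h54' := eq_div_of_mul_eq h33 h54
  have h45' := eq_div_of_mul_eq h33 h45
  have h55' := eq_div_of_mul_eq h33 h55
  have e4 : residue 4 = 1 := rfl
  have e5 : residue 5 = 2 := rfl
  have e3 : residue 3 = 0 := rfl
  have e2 : residue 2 = 2 := rfl
  have e1 : residue 1 = 1 := rfl
  have e0 : residue 0 = 0 := rfl
  have m4 : (2 : Fin 3) * 2 = 1 := rfl
  have c0 := jChar_zero
  have c1 := jChar_one
  have c2 := jChar_two
  have l3 : (2 : Fin 6) < 3 := by decide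
  have l2 : ¬ (4 : Fin 6) < 3 := by decide
  have l1 : ¬ (5 : Fin 6) < 3 := by decide
  ext i j
  rcases hs with rfl | rfl <;> fin_cases i <;> fin_cases j <;>
    simp [blockMatrix, hrow, hcol, h11, h12, h21, h22, h14, h15, h24, h25, h41, h51, h42, h52,
      h44', h54', h45', h55', e0, e1, e2, e3, e4, e5, c0, c1, c2, l1, l2, l3, m4] <;>
    field_simp

/-- For two columns in the same half, the first three rows contribute 1 + j + j² = 0 to the scalar
product. The columns of each lower 3×3 block are therefore orthogonal, and `fourier_of_sums_eq_zero`
makes that block an F_3 up to phases and orientation. The parameter `s` is the relative orientation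
of the two lower blocks. -/
theorem exists_blockMatrix_of_rows {k : Matrix (Fin 6) (Fin 6) ℂ} (hk : k.IsHadamard)
    (hrow : ∀ j, k 0 j = 1) (hcol : ∀ i, k i 0 = 1)
    (h11 : k 1 1 = jRoot) (h12 : k 1 2 = jRoot ^ 2) (h21 : k 2 1 = jRoot ^ 2) (h22 : k 2 2 = jRoot)
    (h14 : k 1 4 = jRoot * k 1 3) (h15 : k 1 5 = jRoot ^ 2 * k 1 3)
    (h24 : k 2 4 = jRoot ^ 2 * k 2 3) (h25 : k 2 5 = jRoot * k 2 3) :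
    ∃ s d v w t, (s = 1 ∨ s = 2) ∧ d 0 = 1 ∧ v 0 = 1 ∧ w 0 = 1 ∧ (∀ a, ‖d a‖ = 1) ∧
      (∀ a, ‖v a‖ = 1) ∧ (∀ a, ‖w a‖ = 1) ∧ (∀ a, ‖t a‖ = 1) ∧
      HadamardEquiv k (blockMatrix s d v w t) := by
  have hn := hk.norm_apply
  have hz : ∀ i j, k i j ≠ 0 := fun i j => ne_zero_of_norm (hn i j)
  have hj := jRoot_ne_zero
  have hj2 := jRoot_sq
  have col : ∀ a b, a ≠ b → k 0 b / k 0 a + k 1 b / k 1 a + k 2 b / k 2 a + k 3 b / k 3 a +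
      k 4 b / k 4 a + k 5 b / k 5 a = 0 := by
    intro a b hab
    have := hk.col_orthogonal hab
    rw [Fin.sum_univ_six] at this
    simp only [star_eq_inv_of_norm (hn _ _)] at this
    simp only [div_eq_inv_mul]
    exact this
  have hjj : jRoot ^ 2 / jRoot = jRoot := by field_simp
  have hjj' : jRoot / jRoot ^ 2 = jRoot ^ 2 := by
    field_simp
    exact jRoot_pow_three.symm
  have c01 : k 3 1 + k 4 1 + k 5 1 = 0 := by
    have := col 0 1 (by decide)
    simp only [hrow, hcol, h11, h21, div_one] at this
    linear_combination this - hj2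
  have c02 : k 3 2 + k 4 2 + k 5 2 = 0 := by
    have := col 0 2 (by decide)
    simp only [hrow, hcol, h12, h22, div_one] at this
    linear_combination this - hj2
  have c12 : k 3 2 / k 3 1 + k 4 2 / k 4 1 + k 5 2 / k 5 1 = 0 := by
    have := col 1 2 (by decide)
    simp only [hrow, h11, h12, h22, h21, div_one, hjj, hjj'] at this
    linear_combination this - hj2
  have c34 : k 3 4 / k 3 3 + k 4 4 / k 4 3 + k 5 4 / k 5 3 = 0 := by
    have := col 3 4 (by decide)
    rw [hrow, hrow, h14, h24, mul_div_cancel_right₀ _ (hz 1 3), mul_div_cancel_right₀ _ (hz 2 3),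
      div_one] at this
    linear_combination this - hj2
  have c35 : k 3 5 / k 3 3 + k 4 5 / k 4 3 + k 5 5 / k 5 3 = 0 := by
    have := col 3 5 (by decide)
    rw [hrow, hrow, h15, h25, mul_div_cancel_right₀ _ (hz 1 3), mul_div_cancel_right₀ _ (hz 2 3),
      div_one] at this
    linear_combination this - hj2
  have c45 : (k 3 5 / k 3 3) / (k 3 4 / k 3 3) + (k 4 5 / k 4 3) / (k 4 4 / k 4 3) +
      (k 5 5 / k 5 3) / (k 5 4 / k 5 3) = 0 := by
    have := col 4 5 (by decide)
    rw [hrow, hrow, h14, h24, h15, h25, mul_div_mul_right _ _ (hz 1 3),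
      mul_div_mul_right _ _ (hz 2 3), div_one, hjj, hjj'] at this
    rw [div_div_div_cancel_right₀ (hz 3 3), div_div_div_cancel_right₀ (hz 4 3),
      div_div_div_cancel_right₀ (hz 5 3)]
    linear_combination this - hj2
  have hd : ∀ i j i' j', ‖k i j / k i' j'‖ = 1 := fun i j i' j' => by simp [hn]
  have clear : ∀ {x y z u c : ℂ}, y ≠ 0 → u ≠ 0 → x / y = c * (z / u) → x * u = c * (z * y) := by
    intro x y z u c hy hu h
    field_simp at h
    linear_combination h
  have mk : ∀ s, (s = 1 ∨ s = 2) → k = blockMatrix s ![1, k 1 3, k 2 3] ![1, k 3 1, k 3 2]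
      ![1, k 3 4 / k 3 3, k 3 5 / k 3 3] ![k 3 3, k 4 3, k 5 3] →
      ∃ s d v w t, (s = 1 ∨ s = 2) ∧ d 0 = 1 ∧ v 0 = 1 ∧ w 0 = 1 ∧ (∀ a, ‖d a‖ = 1) ∧
      (∀ a, ‖v a‖ = 1) ∧ (∀ a, ‖w a‖ = 1) ∧ (∀ a, ‖t a‖ = 1) ∧
      HadamardEquiv k (blockMatrix s d v w t) := by
    intro s hs e
    refine ⟨s, ![1, k 1 3, k 2 3], ![1, k 3 1, k 3 2], ![1, k 3 4 / k 3 3, k 3 5 / k 3 3],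
      ![k 3 3, k 4 3, k 5 3], hs, rfl, rfl, rfl, ?_, ?_, ?_, ?_, by
        rw [← e]; exact HadamardEquiv.refl k⟩ <;>
    · intro a
      fin_cases a <;> simp [hn]
  -- When the lower left block has the wrong orientation, exchanging the last two rows reverses both
  -- lower blocks and keeps their relative orientation.
  have swapped : ∀ s, (s = 1 ∨ s = 2) → ∀ k' : Matrix (Fin 6) (Fin 6) ℂ,
      k' = k.submatrix (Equiv.swap 4 5) id →
      k' = blockMatrix s ![1, k' 1 3, k' 2 3] ![1, k' 3 1, k' 3 2]
      ![1, k' 3 4 / k' 3 3, k' 3 5 / k' 3 3] ![k' 3 3, k' 4 3, k' 5 3] →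
      ∃ s d v w t, (s = 1 ∨ s = 2) ∧ d 0 = 1 ∧ v 0 = 1 ∧ w 0 = 1 ∧ (∀ a, ‖d a‖ = 1) ∧
      (∀ a, ‖v a‖ = 1) ∧ (∀ a, ‖w a‖ = 1) ∧ (∀ a, ‖t a‖ = 1) ∧
      HadamardEquiv k (blockMatrix s d v w t) := by
    intro s hs k' hk' e
    have hn' : ∀ i j, ‖k' i j‖ = 1 := fun i j => by rw [hk']; exact hn _ _
    refine ⟨s, ![1, k' 1 3, k' 2 3], ![1, k' 3 1, k' 3 2], ![1, k' 3 4 / k' 3 3, k' 3 5 / k' 3 3],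
      ![k' 3 3, k' 4 3, k' 5 3], hs, rfl, rfl, rfl, ?_, ?_, ?_, ?_, ?_⟩
    iterate 4
      intro a
      fin_cases a <;> simp [hn']
    rw [← e]
    exact ⟨Equiv.swap 4 5, 1, fun _ => 1, fun _ => 1, by simp, by simp, by simp [hk']⟩
  have cc2 : jChar (2 * 2) = jRoot := jChar_one
  rcases fourier_of_sums_eq_zero (hn _ _) (hn _ _) (hn _ _) (hn _ _) (hn _ _) (hn _ _) c01 c02 c12
    with ⟨h1, h2, h3, h4⟩ | ⟨h1, h2, h3, h4⟩ <;>
  rcases fourier_of_sums_eq_zero (hd _ _ _ _) (hd _ _ _ _) (hd _ _ _ _) (hd _ _ _ _) (hd _ _ _ _)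
    (hd _ _ _ _) c34 c35 c45 with ⟨g1, g2, g3, g4⟩ | ⟨g1, g2, g3, g4⟩ <;>
  replace g1 := clear (hz _ _) (hz _ _) g1 <;> replace g2 := clear (hz _ _) (hz _ _) g2 <;>
  replace g3 := clear (hz _ _) (hz _ _) g3 <;> replace g4 := clear (hz _ _) (hz _ _) g4
  · refine mk 1 (Or.inl rfl) (eq_blockMatrix (Or.inl rfl) (hz _ _) hrow hcol h11 h12 h21 h22 h14 h15
      h24 h25 h1 h2 h3 h4 ?_ ?_ ?_ ?_) <;> simpa [jChar_one, jChar_two]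
  · refine mk 2 (Or.inr rfl) (eq_blockMatrix (Or.inr rfl) (hz _ _) hrow hcol h11 h12 h21 h22 h14 h15
      h24 h25 h1 h2 h3 h4 ?_ ?_ ?_ ?_) <;> simpa only [cc2, jChar_two]
  · refine swapped 2 (Or.inr rfl) _ rfl (eq_blockMatrix (Or.inr rfl) (hz _ _) (fun j => hrow j)
      (fun i => hcol _) h11 h12 h21 h22 h14 h15 h24 h25 h2 h1 h4 h3 ?_ ?_ ?_ ?_) <;>
      simpa only [cc2, jChar_two]
  · refine swapped 1 (Or.inl rfl) _ rfl (eq_blockMatrix (Or.inl rfl) (hz _ _) (fun j => hrow j)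
      (fun i => hcol _) h11 h12 h21 h22 h14 h15 h24 h25 h2 h1 h4 h3 ?_ ?_ ?_ ?_) <;>
      simpa only [jChar_one, jChar_two, mul_one]

theorem exists_injective_extension : ∀ i j k : Fin 6, i ≠ j → j ≠ k → i ≠ k →
    ∃ a b c, Function.Injective ![i, j, k, a, b, c] := by
  decide +kernel

theorem exists_perm_three {i j k : Fin 6} (hij : i ≠ j) (hjk : j ≠ k) (hik : i ≠ k) :
    ∃ σ : Equiv.Perm (Fin 6), σ 0 = i ∧ σ 1 = j ∧ σ 2 = k := by
  obtain ⟨a, b, c, h⟩ := exists_injective_extension i j k hij hjk hik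
  exact ⟨Equiv.ofBijective _ (Finite.injective_iff_bijective.mp h), rfl, rfl, rfl⟩

theorem exists_blockMatrix {h : Matrix (Fin 6) (Fin 6) ℂ} (hh : h.IsHadamard) {i j k : Fin 6}
    (hij : i ≠ j) (hjk : j ≠ k) (hik : i ≠ k) (h1 : IsThreeType (rowRatio h j i))
    (h2 : IsThreeType (rowRatio h k i)) (h3 : IsThreeType (rowRatio h k j)) :
    ∃ s d v w t, (s = 1 ∨ s = 2) ∧ d 0 = 1 ∧ v 0 = 1 ∧ w 0 = 1 ∧ (∀ a, ‖d a‖ = 1) ∧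
      (∀ a, ‖v a‖ = 1) ∧ (∀ a, ‖w a‖ = 1) ∧ (∀ a, ‖t a‖ = 1) ∧
      HadamardEquiv h (blockMatrix s d v w t) := by
  have hn := hh.norm_apply
  have hz : ∀ i j, h i j ≠ 0 := fun i j => ne_zero_of_norm (hn i j)
  obtain ⟨σ, s0, s1, s2⟩ := exists_perm_three hij hjk hik
  have hq : ∀ i j a, rowRatio h i j a ≠ 0 := fun i j a => div_ne_zero (hz _ _) (hz _ _)
  obtain ⟨e, ⟨⟨a1, a2⟩, a3, a4⟩, ⟨b1, b2⟩, b3, b4⟩ := exists_isFourierTriple (hq j i) (hq k i) h1 h2 (by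
    convert h3 using 1
    funext a
    exact div_div_div_cancel_right₀ (hz i a) _ _)
  have E := hadamardEquiv_dephase hn σ e
  have entry : ∀ r b b' c, rowRatio h r i b = c * rowRatio h r i b' →
      h r b * h i b' = c * (h r b' * h i b) := by
    intro r b b' c H
    simp only [rowRatio] at H
    have := hz i b
    have := hz i b'
    field_simp at H
    linear_combination H
  have hd : ∀ r b b' c, h (σ r) (e b) * h i (e b') = c * (h (σ r) (e b') * h i (e b)) →
      dephase h σ e r b = c * dephase h σ e r b' := by
    intro r b b' c H
    rw [dephase, Matrix.of_apply, Matrix.of_apply, s0]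
    have := hz (σ r) (e 0)
    have := hz i (e b)
    have := hz i (e b')
    field_simp
    linear_combination h i (e 0) * H
  have hcol : ∀ i, dephase h σ e i 0 = 1 := fun i => by
    rw [dephase, Matrix.of_apply]
    exact div_self (mul_ne_zero (hz _ _) (hz _ _))
  have hrow : ∀ j, dephase h σ e 0 j = 1 := fun j => by
    rw [dephase, Matrix.of_apply, mul_comm]
    exact div_self (mul_ne_zero (hz _ _) (hz _ _))
  obtain ⟨s, d, v, w, t, g1, g2, g3, g4, g5, g6, g7, g8, g9⟩ := exists_blockMatrix_of_rows
    (hh.of_equiv E) hrow hcol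
    ((hd 1 1 0 _ (s1 ▸ entry _ _ _ _ a1)).trans (by rw [hcol, mul_one]))
    ((hd 1 2 0 _ (s1 ▸ entry _ _ _ _ a2)).trans (by rw [hcol, mul_one]))
    ((hd 2 1 0 _ (s2 ▸ entry _ _ _ _ a3)).trans (by rw [hcol, mul_one]))
    ((hd 2 2 0 _ (s2 ▸ entry _ _ _ _ a4)).trans (by rw [hcol, mul_one]))
    (hd 1 4 3 _ (s1 ▸ entry _ _ _ _ b1)) (hd 1 5 3 _ (s1 ▸ entry _ _ _ _ b2))
    (hd 2 4 3 _ (s2 ▸ entry _ _ _ _ b3)) (hd 2 5 3 _ (s2 ▸ entry _ _ _ _ b4))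
  exact ⟨s, d, v, w, t, g1, g2, g3, g4, g5, g6, g7, g8, E.symm.trans g9⟩

/-- The index `i` of the first three. -/
def loIndex (i : Fin 3) : Fin 6 := Fin.castLE (by norm_num) i

/-- The index `i + 3` of the last three. -/
def hiIndex (i : Fin 3) : Fin 6 := Fin.natAdd 3 i

theorem residue_loIndex : ∀ i, residue (loIndex i) = i := by decide

theorem residue_hiIndex : ∀ i, residue (hiIndex i) = i := by decide

theorem loIndex_lt : ∀ i, loIndex i < 3 := by decide

theorem not_hiIndex_lt : ∀ i, ¬ hiIndex i < 3 := by decide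

theorem index_cases (i : Fin 6) : (∃ a, i = loIndex a) ∨ ∃ a, i = hiIndex a := by
  revert i; decide

theorem sum_loIndex_add_sum_hiIndex (f : Fin 6 → ℂ) :
    ∑ x, f x = ∑ a, f (loIndex a) + ∑ a, f (hiIndex a) := by
  rw [Fin.sum_univ_six, Fin.sum_univ_three, Fin.sum_univ_three]
  change _ = f 0 + f 1 + f 2 + (f 3 + f 4 + f 5)
  ring

section blockMatrix

variable (s : Fin 3) (d v w t : Fin 3 → ℂ) (i r a : Fin 3)

theorem blockMatrix_lo_lo : blockMatrix s d v w t (loIndex i) (loIndex a) = jChar (i * a) := by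
  simp [blockMatrix, residue_loIndex, loIndex_lt]

theorem blockMatrix_lo_hi :
    blockMatrix s d v w t (loIndex i) (hiIndex a) = d i * jChar (i * a) := by
  simp only [blockMatrix, Matrix.of_apply, residue_loIndex, loIndex_lt, residue_hiIndex,
    not_hiIndex_lt, if_true, if_false]

theorem blockMatrix_hi_lo :
    blockMatrix s d v w t (hiIndex r) (loIndex a) = v a * jChar (r * a) := by
  simp only [blockMatrix, Matrix.of_apply, residue_loIndex, loIndex_lt, residue_hiIndex,
    not_hiIndex_lt, if_true, if_false]

theorem blockMatrix_hi_hi :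
    blockMatrix s d v w t (hiIndex r) (hiIndex a) = t r * w a * jChar (s * r * a) := by
  simp only [blockMatrix, Matrix.of_apply, residue_hiIndex,
    not_hiIndex_lt, if_false]

end blockMatrix

/-! ### Fourier analysis on Z/3, and the blocks of equal orientation. -/

/-- The Fourier transform on the integers modulo three of the inverse of `z`. -/
noncomputable def invFourier (z : Fin 3 → ℂ) (n : Fin 3) : ℂ := ∑ a, (z a)⁻¹ * jChar (n * a)

/-- This is the orthogonality of the upper row `i` and the lower row `r`, multiplied by `t r`. Each
half of the scalar product is a value of a Fourier transform. -/
theorem blockMatrix_row_orthogonal {s : Fin 3} {d v w t : Fin 3 → ℂ}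
    (hk : (blockMatrix s d v w t).IsHadamard) (ht : ∀ r, t r ≠ 0) (i r : Fin 3) :
    t r * invFourier v (i - r) + d i * invFourier w (i - s * r) = 0 := by
  have hne : loIndex i ≠ hiIndex r := fun h => not_hiIndex_lt r (h ▸ loIndex_lt i)
  have := hk.row_orthogonal hne
  simp only [star_eq_inv_of_norm (hk.norm_apply _ _)] at this
  rw [sum_loIndex_add_sum_hiIndex] at this
  simp only [blockMatrix_lo_lo, blockMatrix_lo_hi, blockMatrix_hi_lo, blockMatrix_hi_hi] at this
  have h1 : ∑ a, jChar (i * a) * (v a * jChar (r * a))⁻¹ = invFourier v (i - r) := by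
    refine Finset.sum_congr rfl fun a _ => ?_
    rw [sub_mul, jChar_sub, mul_inv]
    ring
  have h2 : ∑ a, d i * jChar (i * a) * (t r * w a * jChar (s * r * a))⁻¹ =
      d i * (t r)⁻¹ * invFourier w (i - s * r) := by
    rw [invFourier, Finset.mul_sum]
    refine Finset.sum_congr rfl fun a _ => ?_
    rw [sub_mul, jChar_sub, mul_inv, mul_inv]
    ring
  rw [h1, h2] at this
  have h := ht r
  field_simp at this
  linear_combination this

theorem invFourier_jChar (m n : Fin 3) :
    invFourier (fun a => jChar (m * a)) n = if n = m then 3 else 0 := by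
  have h : invFourier (fun a => jChar (m * a)) n = ∑ a, jChar ((n - m) * a) := by
    refine Finset.sum_congr rfl fun a _ => ?_
    rw [sub_mul, jChar_sub, mul_comm]
  have h' : ∀ p : Fin 3, ∑ a, jChar (p * a) = if p = 0 then 3 else 0 := by
    intro p
    have e : (2 : Fin 3) * 2 = 1 := rfl
    have hj := jRoot_sq
    fin_cases p
    · norm_num [Fin.sum_univ_three, jChar_zero]
    · simp [Fin.sum_univ_three, jChar_zero, jChar_one, jChar_two]
      linear_combination hj
    · simp [Fin.sum_univ_three, jChar_zero, jChar_one, jChar_two, e]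
      linear_combination hj
  rw [h, h']
  simp only [sub_eq_zero]

/-- Three unimodular terms with sum zero form a rotated triple of cube roots, and an orientation of
the triple is a character. -/
theorem eq_jChar_of_invFourier_eq_zero {z : Fin 3 → ℂ} (hz : ∀ a, ‖z a‖ = 1) (h0 : z 0 = 1)
    {n : Fin 3} (h : invFourier z n = 0) : ∃ m, ∀ a, z a = jChar (m * a) := by
  rw [invFourier, Fin.sum_univ_three] at h
  have hn : ∀ a, ‖(z a)⁻¹ * jChar (n * a)‖ = 1 := fun a => by simp [hz, norm_jChar]
  have inv : ∀ {a b : Fin 3} {c : ℂ}, (z a)⁻¹ * jChar b = c → z a = jChar b * c⁻¹ := by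
    intro a b c h
    rw [← h, mul_inv, inv_inv, mul_left_comm, mul_inv_cancel₀ (jChar_ne_zero b), mul_one]
  have one : (z 0)⁻¹ * jChar (n * 0) = 1 := by simp [h0, jChar_zero]
  have e : ∀ n : Fin 3, n * 2 - 1 = (n - 2) * 2 := by decide
  rcases eq_jRoot_mul_of_add_eq_zero (hn 0) (hn 1) (hn 2) h with ⟨h1, h2⟩ | ⟨h1, h2⟩ <;>
  rw [one, mul_one] at h1 h2
  · refine ⟨n - 1, fun a => ?_⟩
    rw [← jChar_one] at h1
    rw [← jChar_two] at h2
    fin_cases a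
    · simp [h0, jChar_zero]
    · simpa [jChar_sub] using inv h1
    · have := inv h2
      rw [← jChar_sub] at this
      rw [sub_mul]
      exact this
  · refine ⟨n - 2, fun a => ?_⟩
    rw [← jChar_one] at h2
    rw [← jChar_two] at h1
    fin_cases a
    · simp [h0, jChar_zero]
    · simpa [jChar_sub] using inv h1
    · have := inv h2
      rw [← jChar_sub, e] at this
      exact this

theorem eq_zero_of_fourier_eq_zero {z : Fin 3 → ℂ} (h : ∀ n, ∑ a, z a * jChar (n * a) = 0) :
    ∀ a, z a = 0 := by
  have h0 := h 0
  have h1 := h 1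
  have h2 := h 2
  have e : (2 : Fin 3) * 2 = 1 := rfl
  have hj := jRoot_sq
  have h3 := jRoot_pow_three
  simp only [Fin.sum_univ_three, mul_zero, zero_mul, mul_one, one_mul, e, jChar_zero, jChar_one,
    jChar_two] at h0 h1 h2
  intro a
  fin_cases a
  · show z 0 = 0
    linear_combination (h0 + h1 + h2 - (z 1 + z 2) * hj) / 3
  · show z 1 = 0
    linear_combination (h0 + jRoot ^ 2 * h1 + jRoot * h2 - z 0 * hj - 2 * z 1 * h3
      - z 2 * (hj + jRoot * h3)) / 3
  · show z 2 = 0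
    linear_combination (h0 + jRoot * h1 + jRoot ^ 2 * h2 - z 0 * hj - 2 * z 2 * h3
      - z 1 * (hj + jRoot * h3)) / 3

theorem ditaF23_eq_blockMatrix (r s : ℂ) : ditaF23 r s =
    blockMatrix 1 ![1, r, s] (fun _ => 1) (fun _ => 1) fun i => -![1, r, s] i := by
  have h4 : sixthRoot ^ 4 = jRoot ^ 2 := by
    rw [← sixthRoot_sq]; ring
  have h5 : sixthRoot ^ 5 = -jRoot := by
    rw [pow_succ, h4, sixthRoot]; linear_combination -jRoot * jRoot_pow_three
  have h3 := sixthRoot_pow_three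
  have h2 := sixthRoot_sq
  have h1 : sixthRoot = -jRoot ^ 2 := rfl
  have e : (2 : Fin 3) * 2 = 1 := rfl
  rw [ditaF23_eq]
  ext i j
  rcases index_cases i with ⟨i, rfl⟩ | ⟨i, rfl⟩ <;> rcases index_cases j with ⟨j, rfl⟩ | ⟨j, rfl⟩ <;>
    simp only [blockMatrix_lo_lo, blockMatrix_lo_hi, blockMatrix_hi_lo, blockMatrix_hi_hi] <;>
    fin_cases i <;> fin_cases j <;>
    simp [evalMatrix, Mono.eval, ditaMono23, loIndex, hiIndex, h2, h3, h4, h5, e, jChar_zero,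
      jChar_one, jChar_two] <;> simp [h1, mul_comm]

theorem hadamardEquiv_ditaF32 {v : Fin 3 → ℂ} (h0 : v 0 = 1) :
    HadamardEquiv (blockMatrix 1 (fun _ => 1) v v fun _ => -1) (ditaF32 (v 1) (v 2)) := by
  have h4 : sixthRoot ^ 4 = jRoot ^ 2 := by
    rw [← sixthRoot_sq]; ring
  have h5 : sixthRoot ^ 5 = -jRoot := by
    rw [pow_succ, h4, sixthRoot]; linear_combination -jRoot * jRoot_pow_three
  have h3 := sixthRoot_pow_three
  have h2 := sixthRoot_sq
  have h1 : sixthRoot = -jRoot ^ 2 := rfl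
  have e : (2 : Fin 3) * 2 = 1 := rfl
  -- The permutation passes from the lexicographic order on Z/3 × Z/2 to the order in which the Z/2
  -- coordinate comes first.
  have hinj : Function.Injective (![0, 2, 4, 1, 3, 5] : Fin 6 → Fin 6) := by decide
  let σ := Equiv.ofBijective _ (Finite.injective_iff_bijective.mp hinj)
  have hσ : ∀ i, σ i = ![0, 2, 4, 1, 3, 5] i := fun i => rfl
  rw [ditaF32_eq]
  refine ⟨σ, σ, fun _ => 1, fun _ => 1, by simp, by simp, fun i j => ?_⟩
  rw [hσ, hσ]
  rcases index_cases i with ⟨i, rfl⟩ | ⟨i, rfl⟩ <;> rcases index_cases j with ⟨j, rfl⟩ | ⟨j, rfl⟩ <;>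
    simp only [blockMatrix_lo_lo, blockMatrix_lo_hi, blockMatrix_hi_lo, blockMatrix_hi_hi] <;>
    fin_cases i <;> fin_cases j <;>
    simp [evalMatrix, Mono.eval, ditaMono32, loIndex, hiIndex, h0, h2, h3, h4, h5, e, jChar_zero,
      jChar_one, jChar_two] <;> simp [h1, mul_comm]

/-- Multiplying the columns of F_3 by a character is a cyclic shift of its rows, so shifting the
lower rows by `m` gives F_23. -/
theorem isClassified_blockMatrix_of_fourier {d : Fin 3 → ℂ} (hd : ∀ a, ‖d a‖ = 1) (h0 : d 0 = 1)
    (m : Fin 3) : IsClassified (blockMatrix 1 d (fun a => jChar (m * a)) (fun a => jChar (m * a))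
      fun r => -d (m + r)) := by
  refine Or.inr (Or.inr (Or.inl ⟨d 1, d 2, hd 1, hd 2, ?_⟩))
  have hinj : ∀ m : Fin 3, Function.Injective fun i : Fin 6 =>
      if i < 3 then i else hiIndex (m + residue i) := by decide +kernel
  let σ := Equiv.ofBijective _ (Finite.injective_iff_bijective.mp (hinj m))
  have hσ : ∀ i, σ i = if i < 3 then i else hiIndex (m + residue i) := fun i => rfl
  have hd' : ∀ i, ![1, d 1, d 2] i = d i := by
    intro i
    fin_cases i
    exacts [h0.symm, rfl, rfl]
  rw [ditaF23_eq_blockMatrix]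
  refine ⟨σ, 1, fun _ => 1, fun _ => 1, by simp, by simp, fun i j => ?_⟩
  rw [Equiv.Perm.one_apply, one_mul, one_mul]
  rcases index_cases i with ⟨i, rfl⟩ | ⟨i, rfl⟩ <;> rcases index_cases j with ⟨j, rfl⟩ | ⟨j, rfl⟩
  · rw [hσ, if_pos (loIndex_lt i), blockMatrix_lo_lo, blockMatrix_lo_lo]
  · rw [hσ, if_pos (loIndex_lt i), blockMatrix_lo_hi, blockMatrix_lo_hi, hd']
  · rw [hσ, if_neg (not_hiIndex_lt i), residue_hiIndex, blockMatrix_hi_lo, blockMatrix_hi_lo,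
      add_mul, jChar_add, one_mul]
  · rw [hσ, if_neg (not_hiIndex_lt i), residue_hiIndex, blockMatrix_hi_hi, blockMatrix_hi_hi,
      hd', one_mul, one_mul, add_mul, jChar_add]
    ring

/-- Here the character multiplies the rows of the upper right block, and is absorbed by shifting the
right-hand columns by `m`, which gives F_32. -/
theorem isClassified_blockMatrix_of_shift {v w t : Fin 3 → ℂ} (hv : ∀ a, ‖v a‖ = 1) (h0 : v 0 = 1)
    (m : Fin 3) (h : ∀ r a, t r * w a = -(jChar (m * r) * v (a + m))) :
    IsClassified (blockMatrix 1 (fun i => jChar (m * i)) v w t) := by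
  refine Or.inr (Or.inr (Or.inr ⟨v 1, v 2, hv 1, hv 2, ?_⟩))
  refine HadamardEquiv.trans ?_ (hadamardEquiv_ditaF32 h0)
  have hinj : ∀ m : Fin 3, Function.Injective fun i : Fin 6 =>
      if i < 3 then i else hiIndex (residue i + m) := by decide +kernel
  let τ := Equiv.ofBijective _ (Finite.injective_iff_bijective.mp (hinj m))
  have hτ : ∀ i, τ i = if i < 3 then i else hiIndex (residue i + m) := fun i => rfl
  refine ⟨1, τ, fun _ => 1, fun _ => 1, by simp, by simp, fun i j => ?_⟩
  rw [Equiv.Perm.one_apply, one_mul, one_mul]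
  rcases index_cases i with ⟨i, rfl⟩ | ⟨i, rfl⟩ <;> rcases index_cases j with ⟨j, rfl⟩ | ⟨j, rfl⟩
  · rw [hτ, if_pos (loIndex_lt j), blockMatrix_lo_lo, blockMatrix_lo_lo]
  · rw [hτ, if_neg (not_hiIndex_lt j), residue_hiIndex, blockMatrix_lo_hi, blockMatrix_lo_hi,
      mul_add, jChar_add, mul_comm i m]
    ring
  · rw [hτ, if_pos (loIndex_lt j), blockMatrix_hi_lo, blockMatrix_hi_lo]
  · rw [hτ, if_neg (not_hiIndex_lt j), residue_hiIndex, blockMatrix_hi_hi, blockMatrix_hi_hi,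
      h, one_mul, mul_add, jChar_add, mul_comm i m]
    ring

/-- Both transforms are evaluated at `i - r`. If that of `v` has a zero, so has that of `w`, both
are characters, and F_23 results. Otherwise `t r / d i` depends on `i - r` only, `d` is a character,
and Fourier inversion expresses `w` as a shift of `v` up to phase, which is F_32. -/
theorem isClassified_blockMatrix_one {d v w t : Fin 3 → ℂ} (d0 : d 0 = 1) (v0 : v 0 = 1)
    (w0 : w 0 = 1) (hd : ∀ a, ‖d a‖ = 1) (hv : ∀ a, ‖v a‖ = 1) (hw : ∀ a, ‖w a‖ = 1)
    (ht : ∀ a, ‖t a‖ = 1) (hk : (blockMatrix 1 d v w t).IsHadamard) :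
    IsClassified (blockMatrix 1 d v w t) := by
  have ht0 : ∀ a, t a ≠ 0 := fun a => ne_zero_of_norm (ht a)
  have hd0 : ∀ a, d a ≠ 0 := fun a => ne_zero_of_norm (hd a)
  have E : ∀ i r, t r * invFourier v (i - r) + d i * invFourier w (i - r) = 0 := fun i r => by
    simpa using blockMatrix_row_orthogonal hk ht0 i r
  by_cases hz : ∃ n, invFourier v n = 0
  · obtain ⟨n, hn⟩ := hz
    have hn' : invFourier w n = 0 := by
      have := E n 0
      rw [sub_zero, hn, mul_zero, zero_add] at this
      exact (mul_eq_zero.mp this).resolve_left (hd0 n)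
    obtain ⟨m, hm⟩ := eq_jChar_of_invFourier_eq_zero hv v0 hn
    obtain ⟨m', hm'⟩ := eq_jChar_of_invFourier_eq_zero hw w0 hn'
    obtain rfl : v = fun a => jChar (m * a) := funext hm
    obtain rfl : w = fun a => jChar (m' * a) := funext hm'
    simp only [invFourier_jChar] at E
    obtain rfl : m = m' := by
      by_contra hmm
      have := E m 0
      simp only [sub_zero, if_true, if_neg hmm, mul_zero, add_zero] at this
      exact ht0 0 (by linear_combination this / 3)
    obtain rfl : t = fun r => -d (m + r) := by
      funext r
      have := E (m + r) r
      simp only [add_sub_cancel_right, if_true] at this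
      linear_combination this / 3
    exact isClassified_blockMatrix_of_fourier hd d0 m
  · push Not at hz
    have q : ∀ {a b : ℂ} (n : Fin 3), a * invFourier v n = b * invFourier v n → a = b :=
      fun n h => mul_right_cancel₀ (hz n) h
    have e02 : (0 : Fin 3) - 2 = 1 := rfl
    have e12 : (1 : Fin 3) - 2 = 2 := rfl
    have e22 : (2 : Fin 3) - 2 = 0 := rfl
    have E00 := E 0 0
    have E10 := E 1 0
    have E20 := E 2 0
    have E02 := E 0 2
    have E12 := E 1 2
    have E22 := E 2 2
    simp only [sub_zero, e02, e12, e22, d0, one_mul] at E00 E10 E20 E02 E12 E22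
    -- Each of the next three equalities compares two pairs `(i, r)` with the same difference.
    have h1 : t 0 = d 1 * t 2 := q 1 (by linear_combination E10 - d 1 * E02)
    have h2 : t 2 = d 2 * t 0 := q 0 (by linear_combination E22 - d 2 * E00)
    have h3 : t 0 * d 1 = d 2 * t 2 := q 2 (by linear_combination d 1 * E20 - d 2 * E12)
    have h4 : d 1 * d 1 = d 2 := mul_right_cancel₀ (ht0 2) (by
      linear_combination h3 - d 1 * h1)
    have h5 : d 1 * d 2 = 1 := mul_right_cancel₀ (ht0 0) (by
      linear_combination - h1 - d 1 * h2)
    obtain ⟨m, hm⟩ := exists_jRoot_pow (z := d 1) (by linear_combination d 1 * h4 + h5)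
    change d 1 = jChar m at hm
    obtain rfl : d = fun i => jChar (m * i) := by
      funext i
      fin_cases i
      · simp [d0, jChar_zero]
      · simp [hm]
      · show d 2 = jChar (m * 2)
        rw [← h4, hm, ← jChar_add, show ∀ m : Fin 3, m + m = m * 2 by decide]
    refine isClassified_blockMatrix_of_shift hv v0 m fun r a => ?_
    -- A shift of `w⁻¹` by `m` multiplies its transform by a character, so the orthogonality
    -- relations say exactly that the transform of this combination vanishes.
    have key := eq_zero_of_fourier_eq_zero
      (z := fun b => t r * (v b)⁻¹ + jChar (m * r) * (w (b - m))⁻¹) (fun n => by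
        have h := E (n + r) r
        simp only [add_sub_cancel_right, mul_add, jChar_add] at h
        have hs : ∑ b, (w (b - m))⁻¹ * jChar (n * b) = jChar (m * n) * invFourier w n := by
          rw [← Equiv.sum_comp (Equiv.addRight m), invFourier, Finset.mul_sum]
          refine Finset.sum_congr rfl fun b _ => ?_
          simp only [Equiv.coe_addRight, add_sub_cancel_right, mul_add, jChar_add, mul_comm n m]
          ring
        rw [← h]
        simp only [add_mul, Finset.sum_add_distrib, mul_assoc, ← Finset.mul_sum]
        rw [hs, invFourier, invFourier]
        ring) (a + m)
    simp only [add_sub_cancel_right] at key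
    have := ne_zero_of_norm (hv (a + m))
    have := ne_zero_of_norm (hw a)
    field_simp at key
    linear_combination key

/-! ### Blocks of opposite orientation: the Tao matrix. -/

/-- A function on the integers modulo three supported at `2`. -/
def bump (ε a : Fin 3) : Fin 3 := if a = 2 then ε else 0

/-- The squared modulus of the transform at `n` is 3 + jⁿS + j²ⁿS', with autocorrelations S and S',
so constancy forces S = 0. The three terms of S are unimodular with product one and sum zero, hence
are the three cube roots of unity. So `z` has cube roots as values, and the exponent, vanishing at
0, is linear up to a nonzero correction at 2. -/
theorem eq_of_norm_invFourier_eq {z : Fin 3 → ℂ} (hz : ∀ a, ‖z a‖ = 1) (h0 : z 0 = 1)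
    (h : ∀ n, ‖invFourier z n‖ = ‖invFourier z 0‖) :
    ∃ m ε, ε ≠ 0 ∧ ∀ a, z a = jChar (m * a + bump ε a) := by
  have hz0 : ∀ a, z a ≠ 0 := fun a => ne_zero_of_norm (hz a)
  have hj := jRoot_sq
  have h3 := jRoot_pow_three
  have hj0 := jRoot_ne_zero
  have e : (2 : Fin 3) * 2 = 1 := rfl
  have hs : ∀ n, star (invFourier z n) = ∑ a, z a * jChar (-(n * a)) := by
    intro n
    rw [invFourier, star_sum]
    refine Finset.sum_congr rfl fun a _ => ?_
    rw [star_mul', star_inv₀, star_eq_inv_of_norm (hz a), inv_inv,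
      star_eq_inv_of_norm (norm_jChar _), jChar_neg]
  have hsq : ∀ n, invFourier z n * star (invFourier z n) =
      invFourier z 0 * star (invFourier z 0) := by
    intro n
    have : ∀ z : ℂ, z * star z = (‖z‖ : ℂ) ^ 2 := Complex.mul_conj'
    rw [this, this, h]
  have E1 := hsq 1
  have E2 := hsq 2
  rw [hs, hs] at E1 E2
  have e1 : -(1 : Fin 3) = 2 := rfl
  have e2 : -(2 : Fin 3) = 1 := rfl
  simp only [invFourier, Fin.sum_univ_three, mul_zero, zero_mul, mul_one, one_mul, e, e1, e2,
    jChar_zero, neg_zero, jChar_one, jChar_two, h0, inv_one] at E1 E2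
  set x := (z 1)⁻¹ with hx
  set y := (z 2)⁻¹ with hy
  have hx' : z 1 = x⁻¹ := by rw [hx, inv_inv]
  have hy' : z 2 = y⁻¹ := by rw [hy, inv_inv]
  have hxn : ‖x‖ = 1 := by simp [hx, hz]
  have hyn : ‖y‖ = 1 := by simp [hy, hz]
  have hx0 := ne_zero_of_norm hxn
  have hy0 := ne_zero_of_norm hyn
  rw [hx', hy'] at E1 E2
  have xx : x * x⁻¹ = 1 := mul_inv_cancel₀ hx0
  have yy : y * y⁻¹ = 1 := mul_inv_cancel₀ hy0
  obtain ⟨S, hS⟩ : ∃ S, S = x + y * x⁻¹ + y⁻¹ := ⟨_, rfl⟩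
  obtain ⟨S', hS'⟩ : ∃ S', S' = x⁻¹ + x * y⁻¹ + y := ⟨_, rfl⟩
  have F0 : (1 + x + y) * (1 + x⁻¹ + y⁻¹) = 3 + S + S' := by
    rw [hS, hS']; linear_combination xx + yy
  have F1 : (1 + x * jRoot + y * jRoot ^ 2) * (1 + x⁻¹ * jRoot ^ 2 + y⁻¹ * jRoot) =
      3 + jRoot * S + jRoot ^ 2 * S' := by
    rw [hS, hS']
    linear_combination jRoot ^ 3 * xx + jRoot ^ 3 * yy + 2 * h3 + y * x⁻¹ * jRoot * h3
  have F2 : (1 + x * jRoot ^ 2 + y * jRoot) * (1 + x⁻¹ * jRoot + y⁻¹ * jRoot ^ 2) =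
      3 + jRoot ^ 2 * S + jRoot * S' := by
    rw [hS, hS']
    linear_combination jRoot ^ 3 * xx + jRoot ^ 3 * yy + 2 * h3 + x * y⁻¹ * jRoot * h3
  rw [F0, F1] at E1
  rw [F0, F2] at E2
  have hS0 : S = 0 := by
    have h1 : (1 - jRoot) * (S - jRoot ^ 2 * S') = 0 := by
      linear_combination -E1 + S' * h3
    have h2 : (1 - jRoot) * (S' - jRoot ^ 2 * S) = 0 := by
      linear_combination -E2 + S * h3
    have hne : (1 : ℂ) - jRoot ≠ 0 := sub_ne_zero.mpr jRoot_ne_one.symm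
    have g1 := (mul_eq_zero.mp h1).resolve_left hne
    have g2 := (mul_eq_zero.mp h2).resolve_left hne
    apply (mul_eq_zero.mp (show (1 - jRoot) * S = 0 by
      linear_combination g1 + jRoot ^ 2 * g2 + jRoot * S * h3)).resolve_left hne
  rw [hS] at hS0
  have cube : ∀ c : Fin 3, y * x⁻¹ = jChar c * x → y⁻¹ = jChar (2 * c) * x →
      ∃ k : Fin 3, x = jChar k ∧ y⁻¹ = jChar (2 * c + k) := by
    intro c h1 h2
    obtain ⟨k, hk⟩ := exists_jRoot_pow (z := x) (by
      have h5 : jChar c * jChar (2 * c) = 1 := by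
        rw [← jChar_add, ← one_add_mul, show (1 : Fin 3) + 2 = 0 from rfl, zero_mul, jChar_zero]
      linear_combination -(x ^ 3) * h5 - y⁻¹ * x * h1 - jChar c * x ^ 2 * h2 + y * y⁻¹ * xx + yy)
    exact ⟨k, hk, by rw [h2, hk, jChar_add]; rfl⟩
  obtain ⟨c, hc, k, hk, hk'⟩ : ∃ c : Fin 3, c ≠ 0 ∧ ∃ k : Fin 3, x = jChar k ∧
      y⁻¹ = jChar (2 * c + k) := by
    rcases eq_jRoot_mul_of_add_eq_zero hxn (by simp [hxn, hyn]) (by simp [hyn]) hS0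
      with ⟨h1, h2⟩ | ⟨h1, h2⟩
    · exact ⟨1, by decide, cube 1 (by rw [h1, jChar_one]) (by rw [h2, mul_one, jChar_two])⟩
    · exact ⟨2, by decide, cube 2 (by rw [h1, jChar_two]) (by rw [h2, e, jChar_one])⟩
  have ar : ∀ c k : Fin 3, 2 * c + k = -k * 2 + 2 * c := by decide
  have ar' : ∀ c : Fin 3, c ≠ 0 → 2 * c ≠ 0 := by decide
  refine ⟨-k, 2 * c, ar' c hc, fun a => ?_⟩
  fin_cases a
  · simp [h0, bump, jChar_zero]
  · show z 1 = jChar (-k * 1 + bump (2 * c) 1)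
    rw [hx', hk, mul_one, show bump (2 * c) 1 = 0 from rfl, add_zero, jChar_neg]
  · show z 2 = jChar (-k * 2 + bump (2 * c) 2)
    rw [hy', hk', ar]
    rfl

/-- The modulus-carrying factor of the Fourier transform of `bump ε`. -/
noncomputable def bumpSum (ε : Fin 3) : ℂ := if ε = 1 then 2 + jRoot ^ 2 else 2 + jRoot

/-- The phase of the Fourier transform of `bump ε`. -/
def bumpPhase (ε n : Fin 3) : Fin 3 := if ε = 1 then (if n = 1 then 1 else 0) else bump 2 n

/-- Exactly two of the three exponents in the sum coincide. Their common value is the phase, and the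
third exceeds it by `-ε`, which gives the factor `bumpSum ε`. -/
theorem invFourier_bump {ε : Fin 3} (hε : ε ≠ 0) (m n : Fin 3) :
    invFourier (fun a => jChar (m * a + bump ε a)) n =
      bumpSum ε * jChar (bumpPhase ε (n - m)) := by
  have h : invFourier (fun a => jChar (m * a + bump ε a)) n =
      ∑ a, jChar ((n - m) * a - bump ε a) := by
    refine Finset.sum_congr rfl fun a _ => ?_
    simp only [sub_mul, jChar_sub, jChar_add, mul_inv]
    ring
  have hj := jRoot_sq
  have h3 := jRoot_pow_three
  have h' : ∀ ε : Fin 3, ε ≠ 0 → ∀ p : Fin 3, ∑ a, jChar (p * a - bump ε a) =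
      bumpSum ε * jChar (bumpPhase ε p) := by
    intro ε hε p
    have e : (2 : Fin 3) * 2 = 1 := rfl
    have e1 : -(1 : Fin 3) = 2 := rfl
    have e2 : -(2 : Fin 3) = 1 := rfl
    have e3 : (1 : Fin 3) - 2 = 2 := rfl
    fin_cases ε <;> fin_cases p <;>
      simp [Fin.sum_univ_three, jChar_zero, jChar_one, jChar_two, bumpSum, bumpPhase, bump, e,
        e1, e2, e3] at hε ⊢
    · ring
    · linear_combination -h3
    · ring
    · ring
    · ring
    · linear_combination -h3
  rw [h, h' ε hε]

theorem bumpSum_two : bumpSum 2 = -jRoot ^ 2 * bumpSum 1 := by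
  have hj := jRoot_sq
  have h3 := jRoot_pow_three
  simp [bumpSum]
  linear_combination 2 * hj + jRoot * h3

theorem bumpSum_ne_zero (ε : Fin 3) : bumpSum ε ≠ 0 := by
  have hj := jRoot_sq
  have h3 := jRoot_pow_three
  intro h
  unfold bumpSum at h
  split_ifs at h
  · have h1 : (3 : ℂ) = 0 := by
      linear_combination (2 + jRoot) * h - 2 * hj - h3
    norm_num at h1
  · have h1 : (3 : ℂ) = 0 := by
      linear_combination (2 + jRoot ^ 2) * h - 2 * hj - h3
    norm_num at h1

/-- The phase by which `d i` and `t r` are related in a block matrix of the second kind. -/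
def taoPhase (ε m n i r : Fin 3) : Fin 3 := bumpPhase (-ε) (i + r - n) - bumpPhase ε (i - r - m)

/-- Excludes equal corrections for `v` and `w`: the value of `d i` read off from the lower row `r`
would depend on `r`. -/
theorem bumpPhase_inconsistent : ∀ ε m n : Fin 3, ε ≠ 0 →
    ∃ i r : Fin 3,
      (bumpPhase ε (0 + 0 - n) - bumpPhase ε (0 - 0 - m)) -
        (bumpPhase ε (i + 0 - n) - bumpPhase ε (i - 0 - m)) ≠
      (bumpPhase ε (0 + r - n) - bumpPhase ε (0 - r - m)) -
        (bumpPhase ε (i + r - n) - bumpPhase ε (i - r - m)) := by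
  decide +kernel

/-- The exponents of a cubic block matrix of the second kind. -/
def taoBlock (ε m n : Fin 3) : Fin 6 → Fin 6 → Mono := fun i j =>
  (2 * (if i < 3 then
      (if j < 3 then 0 else taoPhase ε m n 0 0 - taoPhase ε m n (residue i) 0) +
        residue i * residue j
    else if j < 3 then m * residue j + bump ε (residue j) + residue i * residue j
    else taoPhase ε m n 0 (residue i) + 2 * ε + (n * residue j + bump (-ε) (residue j)) +
      2 * residue i * residue j : Fin 3).val, 0, 0)

/-- The row permutation from `taoBlock` to the Tao matrix. -/
def taoRowPerm (ε m : Fin 3) (i : Fin 6) : Fin 6 :=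
  if ε = 1 then (if i < 3 then ![0, 3, 5] (residue i) else ![1, 2, 4] (residue i + m))
  else (if i < 3 then ![0, 2, 5] (residue i) else ![1, 3, 4] (residue i + m))

/-- The column permutation from `taoBlock` to the Tao matrix. -/
def taoColPerm (ε m : Fin 3) (i : Fin 6) : Fin 6 :=
  if ε = 1 then (if i < 3 then ![0, 1, 2] (residue i) else ![4, 5, 3] (residue i - m))
  else (if i < 3 then ![0, 1, 4] (residue i) else ![3, 2, 5] (residue i + m))

/-- Of the characters in `v` and `w`, only `m` and `m + n` matter: they shift the lower rows and the
right-hand columns cyclically. -/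
theorem taoBlock_equivTest : ∀ ε m n : Fin 3, ε ≠ 0 →
    Function.Injective (taoRowPerm ε m) ∧ Function.Injective (taoColPerm ε (m + n)) ∧
      equivTest 6 (taoBlock ε m n) taoMono (taoRowPerm ε m) (taoColPerm ε (m + n)) := by
  decide +kernel

theorem hadamardEquiv_taoBlock {ε : Fin 3} (hε : ε ≠ 0) (m n : Fin 3) :
    HadamardEquiv (evalMatrix sixthRoot 1 1 (taoBlock ε m n)) taoMatrix := by
  obtain ⟨h1, h2, h3⟩ := taoBlock_equivTest ε m n hε
  rw [taoMatrix_eq]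
  exact hadamardEquiv_of_equivTest norm_sixthRoot norm_one norm_one sixthRoot_pow_six h1 h2 h3

theorem eval_two_mul_val (k : Fin 3) :
    Mono.eval sixthRoot 1 1 (2 * k.val, 0, 0) = jChar k := by
  simp [Mono.eval, pow_mul, sixthRoot_sq, jChar]

theorem blockMatrix_eq_taoBlock {ε m n : Fin 3} {d v w t : Fin 3 → ℂ}
    (hv : ∀ a, v a = jChar (m * a + bump ε a)) (hw : ∀ a, w a = jChar (n * a + bump (-ε) a))
    (hd : ∀ i, d i = jChar (taoPhase ε m n 0 0 - taoPhase ε m n i 0))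
    (ht : ∀ r, t r = jChar (taoPhase ε m n 0 r + 2 * ε)) :
    blockMatrix 2 d v w t = evalMatrix sixthRoot 1 1 (taoBlock ε m n) := by
  ext i j
  simp only [evalMatrix, taoBlock, Matrix.of_apply, eval_two_mul_val]
  rcases index_cases i with ⟨i, rfl⟩ | ⟨i, rfl⟩ <;> rcases index_cases j with ⟨j, rfl⟩ | ⟨j, rfl⟩ <;>
    simp only [blockMatrix_lo_lo, blockMatrix_lo_hi, blockMatrix_hi_lo, blockMatrix_hi_hi,
      loIndex_lt, not_hiIndex_lt, if_true, if_false, residue_loIndex, residue_hiIndex, hv, hw, hd,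
      ht, zero_add, jChar_add]

/-- The transforms are now evaluated at `i - r` and `i + r`, which vary independently because 2 is
invertible modulo three; so both have constant modulus. The phases then force opposite corrections
for `v` and `w` and determine `d` and `t`, which leaves finitely many matrices. -/
theorem isClassified_blockMatrix_two {d v w t : Fin 3 → ℂ} (d0 : d 0 = 1) (v0 : v 0 = 1)
    (w0 : w 0 = 1) (hd : ∀ a, ‖d a‖ = 1) (hv : ∀ a, ‖v a‖ = 1) (hw : ∀ a, ‖w a‖ = 1)
    (ht : ∀ a, ‖t a‖ = 1) (hk : (blockMatrix 2 d v w t).IsHadamard) :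
    IsClassified (blockMatrix 2 d v w t) := by
  have ht0 : ∀ a, t a ≠ 0 := fun a => ne_zero_of_norm (ht a)
  have E : ∀ i r, t r * invFourier v (i - r) + d i * invFourier w (i + r) = 0 := fun i r => by
    have e : ∀ i r : Fin 3, i - 2 * r = i + r := by decide
    have := blockMatrix_row_orthogonal hk ht0 i r
    rwa [e] at this
  have N : ∀ i r, ‖invFourier v (i - r)‖ = ‖invFourier w (i + r)‖ := fun i r => by
    have := congrArg norm (eq_neg_of_add_eq_zero_left (E i r))
    rwa [norm_neg, norm_mul, norm_mul, ht, hd, one_mul, one_mul] at this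
  have N00 := N 0 0
  have N11 := N 1 1
  have N22 := N 2 2
  have N20 := N 2 0
  have N10 := N 1 0
  have e1 : (1 : Fin 3) + 1 = 2 := rfl
  have e2 : (2 : Fin 3) + 2 = 1 := rfl
  simp only [sub_self, sub_zero, add_zero, e1, e2] at N00 N11 N22 N20 N10
  obtain ⟨m, ε, hε, hv'⟩ := eq_of_norm_invFourier_eq hv v0 (fun n => by
    fin_cases n
    · rfl
    · exact N10.trans N22.symm
    · exact N20.trans N11.symm)
  obtain ⟨n, ε', hε', hw'⟩ := eq_of_norm_invFourier_eq hw w0 (fun n => by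
    fin_cases n
    · rfl
    · exact N22.symm.trans N00
    · exact N11.symm.trans N00)
  obtain rfl : v = fun a => jChar (m * a + bump ε a) := funext hv'
  obtain rfl : w = fun a => jChar (n * a + bump ε' a) := funext hw'
  simp only [invFourier_bump hε, invFourier_bump hε'] at E
  have hc := bumpSum_ne_zero ε
  have F : ∀ i r, t r * bumpSum ε =
      -(d i * bumpSum ε') * jChar (bumpPhase ε' (i + r - n) - bumpPhase ε (i - r - m)) := by
    intro i r
    have h0 := jChar_ne_zero (bumpPhase ε (i - r - m))
    rw [jChar_sub]
    field_simp
    linear_combination E i r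
  have hc' := bumpSum_ne_zero ε'
  have G : ∀ i r, d i = jChar ((bumpPhase ε' (0 + r - n) - bumpPhase ε (0 - r - m)) -
      (bumpPhase ε' (i + r - n) - bumpPhase ε (i - r - m))) := by
    intro i r
    have h1 := F i r
    have h2 := F 0 r
    rw [d0] at h2
    have h0 := jChar_ne_zero (bumpPhase ε' (i + r - n) - bumpPhase ε (i - r - m))
    rw [jChar_sub]
    field_simp
    apply mul_left_cancel₀ hc'
    linear_combination h1 - h2
  by_cases hεε : ε' = ε
  · subst hεε
    obtain ⟨i, r, hir⟩ := bumpPhase_inconsistent ε' m n hε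
    exact absurd (jChar_injective ((G i 0).symm.trans (G i r))) hir
  · have neg_of_ne : ∀ a b : Fin 3, a ≠ 0 → b ≠ 0 → b ≠ a → b = -a := by decide
    have one_or_two : ∀ a : Fin 3, a ≠ 0 → a = 1 ∨ a = 2 := by decide
    obtain rfl := neg_of_ne ε ε' hε hε' hεε
    have hsum : -bumpSum (-ε) = jChar (2 * ε) * bumpSum ε := by
      have h2 := bumpSum_two
      have e : (2 : Fin 3) * 2 = 1 := rfl
      have h3 := jRoot_pow_three
      have m1 : -(1 : Fin 3) = 2 := rfl
      have m2 : -(2 : Fin 3) = 1 := rfl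
      rcases one_or_two ε hε with rfl | rfl
      · rw [m1, mul_one, jChar_two, h2]; ring
      · rw [m2, e, jChar_one, h2]
        linear_combination bumpSum 1 * h3
    refine Or.inl ?_
    rw [blockMatrix_eq_taoBlock (ε := ε) (m := m) (n := n) (fun _ => rfl) (fun _ => rfl)
      (fun i => G i 0) (fun r => ?_)]
    · exact hadamardEquiv_taoBlock hε m n
    · have := F 0 r
      rw [d0] at this
      apply mul_right_cancel₀ hc
      rw [jChar_add, this, taoPhase]
      linear_combination jChar (bumpPhase (-ε) (0 + r - n) - bumpPhase ε (0 - r - m)) * hsum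

/-- A complex Hadamard matrix with three rows of pairwise three-type is classified. -/
theorem isClassified_of_three_rows {h : Matrix (Fin 6) (Fin 6) ℂ} (hh : h.IsHadamard)
    {i j k : Fin 6} (hij : i ≠ j) (hjk : j ≠ k) (hik : i ≠ k) (h1 : IsThreeType (rowRatio h j i))
    (h2 : IsThreeType (rowRatio h k i)) (h3 : IsThreeType (rowRatio h k j)) : IsClassified h := by
  obtain ⟨s, d, v, w, t, hs, d0, v0, w0, hd, hv, hw, ht, H⟩ :=
    exists_blockMatrix hh hij hjk hik h1 h2 h3
  have hk := hh.of_equiv H.symm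
  refine IsClassified.of_equiv H ?_
  rcases hs with rfl | rfl
  · exact isClassified_blockMatrix_one d0 v0 w0 hd hv hw ht hk
  · exact isClassified_blockMatrix_two d0 v0 w0 hd hv hw ht hk

/-! ### Three rows of pairwise two-type: the pattern 1, -1, i, -i, q, -q. -/

/-- The relative positions of three fixed-point-free involutions, seen from two points. -/
def MatchingPosition (μ ν ρ : Fin 6 → Fin 6) (a x : Fin 6) : Prop :=
  (μ a = ν a ∧ ρ a = ν a) ∨
  (μ = ν ∧ ρ (μ (ρ (μ (ρ (μ a))))) = a) ∨
  (ν (μ (ν (μ a))) = a ∧ μ x = ν x ∧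
    (ρ (ν (μ a)) = μ (ν (μ a)) ∧ ρ x = a ∧ ρ (μ x) = μ a ∨
     ρ a = ν a ∧ ρ x = μ a ∧ ρ (μ x) = μ (ν a) ∨
     ρ (μ a) = ν a ∧ ρ x = a ∧ ρ (μ x) = μ (ν a))) ∨
  (ν (μ (ν (μ (ν (μ a))))) = a ∧
    ([ρ a, ρ (ν (μ a)), ρ (μ (ν a))].Perm [μ a, μ (ν (μ a)), ν a] ∨
     ρ a = ν (μ a) ∧ ((ρ (μ a) = ν a ∧ ρ (μ (ν a)) = μ (ν (μ a)) ∨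
        ρ (μ a) = μ (ν (μ a)) ∧ ρ (μ (ν a)) = ν a) ∨
        ρ (μ (ν (μ a))) = ν a ∧ ρ (μ (ν a)) = μ a)))

instance (μ ν ρ : Fin 6 → Fin 6) (a x : Fin 6) : Decidable (MatchingPosition μ ν ρ a x) := by
  unfold MatchingPosition; infer_instance

theorem exists_matchingPosition : ∀ m₁ m₂ m₃ : Fin 15, ∃ a x,
    MatchingPosition (matching m₁) (matching m₂) (matching m₃) a x := by
  decide +kernel

section walk

variable {u v : Fin 6 → ℂ} {μ ν : Fin 6 → Fin 6}

theorem div_eq_of_walk_two (hu : ∀ a, u (μ a) = -u a) (hv : ∀ a, v (ν a) = -v a) {a b : Fin 6}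
    (h1 : μ a = b) (h2 : ν a = b) : u b / v b = u a / v a := by
  rw [← h1, hu, h1, ← h2, hv, neg_div_neg_eq]

theorem div_eq_of_walk_four (hu : ∀ a, u (μ a) = -u a) (hv : ∀ a, v (ν a) = -v a)
    {a b c d : Fin 6} (h1 : μ a = b) (h2 : ν b = c) (h3 : μ c = d) (h4 : ν d = a) :
    u a / v a * (u c / v c) = u b / v b * (u d / v d) := by
  have e1 := hu a
  have e2 := hv b
  have e3 := hu c
  have e4 := hv d
  rw [h1] at e1
  rw [h2] at e2
  rw [h3] at e3
  rw [h4] at e4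
  rw [e1, e2, e3, e4, div_mul_div_comm, div_mul_div_comm, neg_mul_neg, neg_mul_neg, mul_comm (v d)]

theorem div_eq_of_walk_six (hu : ∀ a, u (μ a) = -u a) (hv : ∀ a, v (ν a) = -v a)
    {a b c d e f : Fin 6} (h1 : μ a = b) (h2 : ν b = c) (h3 : μ c = d) (h4 : ν d = e)
    (h5 : μ e = f) (h6 : ν f = a) :
    u a / v a * (u c / v c) * (u e / v e) = u b / v b * (u d / v d) * (u f / v f) := by
  have e1 := hu a
  have e2 := hv b
  have e3 := hu c
  have e4 := hv d
  have e5 := hu e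
  have e6 := hv f
  rw [h1] at e1
  rw [h2] at e2
  rw [h3] at e3
  rw [h4] at e4
  rw [h5] at e5
  rw [h6] at e6
  rw [e1, e2, e3, e4, e5, e6]
  simp only [neg_div, div_neg]
  ring

end walk

/-- Along a closed walk alternating between the matchings of `u` and `v`, the product of `w` over
the even points equals that over the odd points. The matching of `w` contributes sign changes to
this relation. Each alternative of `MatchingPosition` either makes a nonzero number its own opposite
or yields the required pair. -/
theorem exists_sq_eq_neg_sq {u v w : Fin 6 → ℂ} (hw0 : ∀ a, w a ≠ 0) (hw : ∀ a, w a = u a / v a)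
    (h1 : IsTwoType u) (h2 : IsTwoType v) (h3 : IsTwoType w) : ∃ a b, w a ^ 2 = -w b ^ 2 := by
  obtain ⟨m₁, h1⟩ := h1
  obtain ⟨m₂, h2⟩ := h2
  obtain ⟨m₃, h3⟩ := h3
  obtain ⟨a, x, H⟩ := exists_matchingPosition m₁ m₂ m₃
  have i1 := matching_matching m₁
  have i2 := matching_matching m₂
  generalize matching m₁ = μ at *
  generalize matching m₂ = ν at *
  generalize matching m₃ = ρ at *
  have absurd_neg : ∀ {z : ℂ}, z ≠ 0 → z ≠ -z := fun h h' => h (self_eq_neg.mp h')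
  have h3' : ∀ {a b}, ρ a = b → w b = -w a := fun h => by rw [← h, h3]
  have two : ∀ {a b}, μ a = b → ν a = b → w b = w a := fun h h' => by
    rw [hw, hw]; exact div_eq_of_walk_two h1 h2 h h'
  rcases H with ⟨e, e'⟩ | ⟨rfl, e⟩ | ⟨e, ex, H⟩ | ⟨e, H⟩
  · exact absurd (two e rfl) (by rw [h3' e']; exact (absurd_neg (hw0 a)).symm)
  · have := congrArg w e
    simp only [h3, two rfl rfl] at this
    exact absurd this (by simpa using (absurd_neg (hw0 a)).symm)
  · have R : w a * w (ν (μ a)) = w (μ a) * w (μ (ν (μ a))) := by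
      simp only [hw]; exact div_eq_of_walk_four h1 h2 rfl rfl rfl e
    have ea : μ (ν (μ a)) = ν a := by rw [← i2 (μ (ν (μ a))), e]
    have ec : ν (μ a) = μ (ν a) := by rw [← ea, i1]
    have X := two rfl ex.symm
    rw [ea] at R
    have n1 := hw0 a
    have n2 := hw0 (ν (μ a))
    rcases H with ⟨f1, f2, f3⟩ | ⟨f1, f2, f3⟩ | ⟨f1, f2, f3⟩
    · rw [ea] at f1
      rw [h3' f1, h3' f2, h3' f3, X] at R
      exact absurd (mul_left_cancel₀ (neg_ne_zero.mpr (hw0 x)) R) (absurd_neg n2)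
    · rw [← ec] at f3
      rw [h3' f1, h3' f2, h3' f3, X] at R
      exact absurd (mul_right_cancel₀ (neg_ne_zero.mpr (hw0 x)) (R.trans (mul_comm _ _)))
        (absurd_neg n1)
    · rw [← ec] at f3
      refine ⟨a, μ a, ?_⟩
      rw [h3' f1, h3' f2, h3' f3, X] at R
      rw [h3' f2]
      linear_combination R
  · have e5 : μ (ν (μ (ν (μ a)))) = ν a := by rw [← i2 (μ (ν (μ (ν (μ a))))), e]
    have e4 : ν (μ (ν (μ a))) = μ (ν a) := by rw [← e5, i1]
    have R : w a * w (ν (μ a)) * w (μ (ν a)) = w (μ a) * w (μ (ν (μ a))) * w (ν a) := by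
      simp only [hw]
      exact div_eq_of_walk_six h1 h2 rfl rfl rfl e4 (i1 _) (i2 _)
    generalize hb : μ a = b at *
    generalize hc : ν b = c at *
    generalize hd : μ c = d at *
    generalize hf : ν a = f at *
    generalize he : μ f = g at *
    have n1 := hw0 a
    have n2 := hw0 b
    have n3 := hw0 c
    have n4 := hw0 d
    have n5 := hw0 g
    have n6 := hw0 f
    rcases H with H | ⟨f1, (⟨f2, f3⟩ | ⟨f2, f3⟩) | ⟨f2, f3⟩⟩
    -- The matching of `w` pairs even points of the hexagon with odd ones, so the two products
    -- differ by (-1)³.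
    · have P := (H.map w).prod_eq
      simp only [List.map_cons, List.map_nil, List.prod_cons, List.prod_nil, h3] at P
      have Z : w a * w c * w g = -(w a * w c * w g) := by
        linear_combination R - P
      exact absurd Z (absurd_neg (mul_ne_zero (mul_ne_zero n1 n3) n5))
    · refine ⟨a, b, mul_right_cancel₀ n5 ?_⟩
      rw [h3' f1, h3' f2, h3' f3] at R
      linear_combination -R
    · refine ⟨a, b, mul_right_cancel₀ n5 ?_⟩
      rw [h3' f1, h3' f2, h3' f3] at R
      linear_combination -R
    · refine ⟨a, d, mul_right_cancel₀ n5 ?_⟩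
      rw [h3' f1, h3' f2, h3' f3] at R
      linear_combination -R

theorem exists_matching_complement : ∀ m a b, b ≠ a → b ≠ matching m a →
    ∃ e : Fin 6 → Fin 6, e.Injective ∧ e 0 = a ∧ e 2 = b ∧ ∀ x, matching m (e x) = e (matching 0 x) := by
  have key : ∀ m a b, b ≠ a → b ≠ matching m a → ∃ c,
      Function.Injective ![a, matching m a, b, matching m b, c, matching m c] := by
    decide +kernel
  intro m a b h1 h2
  obtain ⟨c, hc⟩ := key m a b h1 h2
  refine ⟨_, hc, rfl, rfl, fun x => ?_⟩
  fin_cases x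
  exacts [rfl, matching_matching m a, rfl, matching_matching m b, rfl, matching_matching m c]

/-- The values of `w` are, up to a common factor and the order, `1, -1, i, -i, q, -q`. -/
theorem exists_perm_of_sq_eq_neg_sq {w : Fin 6 → ℂ} (hw0 : ∀ a, w a ≠ 0) (h : IsTwoType w)
    (hs : ∃ a b, w a ^ 2 = -w b ^ 2) : ∃ (e : Equiv.Perm (Fin 6)) (c q : ℂ),
      ∀ a, w (e a) = c * ![1, -1, I, -I, q, -q] a := by
  obtain ⟨m, hm⟩ := h
  obtain ⟨a, b, hab⟩ := hs
  have hne : b ≠ a ∧ b ≠ matching m a := by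
    have h0 := pow_ne_zero 2 (hw0 a)
    constructor
    · rintro rfl
      exact h0 (self_eq_neg.mp hab)
    · rintro rfl
      rw [hm, neg_sq] at hab
      exact h0 (self_eq_neg.mp hab)
  have main : ∀ a b, b ≠ a → b ≠ matching m a → w b = I * w a →
      ∃ (e : Equiv.Perm (Fin 6)) (c q : ℂ), ∀ a, w (e a) = c * ![1, -1, I, -I, q, -q] a := by
    intro a b h1 h2 hab
    obtain ⟨e, he, e0, e2, hme⟩ := exists_matching_complement m a b h1 h2
    refine ⟨Equiv.ofBijective e (Finite.injective_iff_bijective.mp he), w a, w (e 4) / w a,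
      fun x => ?_⟩
    have h0 := hw0 a
    have g : ∀ x y, matching 0 x = y → w (e y) = -w (e x) := fun x y h => by
      rw [← h, ← hme, hm]
    rw [Equiv.ofBijective_apply]
    fin_cases x
    · simp [e0]
    · simp [g 0 1 rfl, e0]
    · simp [e2, hab, mul_comm]
    · simp [g 2 3 rfl, e2, hab, mul_comm]
    · simp; field_simp
    · simp [g 4 5 rfl]; field_simp
  -- The sign of `w b = ±i * w a` is corrected by replacing `a` with its partner.
  have hf : (w b - I * w a) * (w b + I * w a) = 0 := by
    linear_combination hab - w a ^ 2 * I_sq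
  rcases mul_eq_zero.mp hf with hf | hf
  · exact main a b hne.1 hne.2 (by linear_combination hf)
  · refine main (matching m a) b hne.2 (by rw [matching_matching]; exact hne.1) ?_
    rw [hm]; linear_combination hf

/-- Two splittings cut the six points into four classes, here each met once by the first four
points; the sizes are then 1, 2, 2, 1, and the classes of size two are opposite. Either 0 and 1 lie
in opposite classes, or the points 4 and 5 join one of 0, 1 and one of 2, 3. -/
theorem tripleSide_four_positions : ∀ t t' : Fin 10,
    (∀ x y : Fin 6, x < 4 → y < 4 → x ≠ y →
      ¬ (tripleSide t x = tripleSide t y ∧ tripleSide t' x = tripleSide t' y)) →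
    (tripleSide t 0 ≠ tripleSide t 1 ∧ tripleSide t 2 ≠ tripleSide t 3 ∧
      tripleSide t' 0 ≠ tripleSide t' 1 ∧ tripleSide t' 2 ≠ tripleSide t' 3) ∨
    ∃ x y : Fin 6, x < 2 ∧ 2 ≤ y ∧ y < 4 ∧
      (tripleSide t 4 = tripleSide t x ∧ tripleSide t' 4 = tripleSide t' x ∧
       tripleSide t 5 = tripleSide t y ∧ tripleSide t' 5 = tripleSide t' y ∨
       tripleSide t 5 = tripleSide t x ∧ tripleSide t' 5 = tripleSide t' x ∧
       tripleSide t 4 = tripleSide t y ∧ tripleSide t' 4 = tripleSide t' y) := by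
  decide +kernel

theorem exists_tripleSide_eq_below_four : ∀ t : Fin 10, ∃ x y : Fin 6, x < 4 ∧ y < 4 ∧ x ≠ y ∧
    tripleSide t x = tripleSide t y := by
  decide +kernel

/-- A row of three-type with respect to two rows `u` and `v` forces `u / v` not to have the values
`1, -1, i, -i, q, -q`. -/
theorem not_isThreeType_of_pattern {p p' g : Fin 6 → ℂ} {q c : ℂ} (hp0 : ∀ a, p a ≠ 0)
    (hp0' : ∀ a, p' a ≠ 0) (hc : c ≠ 0) (hg : ∀ a, p a = g a * p' a)
    (he : ∀ a, g a = c * ![1, -1, I, -I, q, -q] a) (hp : IsThreeType p) : ¬ IsThreeType p' := by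
  intro hp'
  have h0 : c ^ 3 ≠ 0 := pow_ne_zero 3 hc
  have cube : ∀ a, p a ^ 3 = c ^ 3 * ![1, -1, -I, I, q ^ 3, -q ^ 3] a * p' a ^ 3 := fun a => by
    rw [hg, he]
    fin_cases a <;> simp <;> ring_nf <;> simp [I_pow_three]
  have quot : ∀ x y, p x ^ 3 = p y ^ 3 → p' x ^ 3 = p' y ^ 3 →
      ![1, -1, -I, I, q ^ 3, -q ^ 3] x = ![1, -1, -I, I, q ^ 3, -q ^ 3] y := by
    intro x y h1 h2
    rw [cube, cube, h2] at h1
    exact mul_left_cancel₀ h0 (mul_right_cancel₀ (pow_ne_zero 3 (hp0' y)) h1)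
  -- The cubes of 1, -1, i, -i are distinct, so the cubes of `p` and `p'` together separate the
  -- first four columns.
  have inj : ∀ x y : Fin 6, x < 4 → y < 4 → x ≠ y →
      ¬ (p x ^ 3 = p y ^ 3 ∧ p' x ^ 3 = p' y ^ 3) := by
    rintro x y hx hy hxy ⟨h1, h2⟩
    have h3 := quot x y h1 h2
    have h4 := congrArg re h3
    have h5 := congrArg im h3
    fin_cases x <;> fin_cases y <;> first
      | exact absurd hx (by decide)
      | exact absurd hy (by decide)
      | exact absurd rfl hxy
      | (norm_num at h4; done)
      | (norm_num at h5; done)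
  rcases hp.cases hp0 with ⟨γ, k, -, -, hk⟩ | ⟨t, -, ht⟩
  · have hconst : ∀ x y, p x ^ 3 = p y ^ 3 := fun x y => by
      rw [hk, hk, mul_pow, mul_pow, jRoot_pow_pow_three, jRoot_pow_pow_three]
    rcases hp'.cases hp0' with ⟨γ, k, -, -, hk⟩ | ⟨t, -, ht⟩
    · refine inj 0 1 (by decide) (by decide) (by decide) ⟨hconst _ _, ?_⟩
      rw [hk, hk, mul_pow, mul_pow, jRoot_pow_pow_three, jRoot_pow_pow_three]
    · obtain ⟨x, y, hx, hy, hxy, hs⟩ := exists_tripleSide_eq_below_four t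
      exact inj x y hx hy hxy ⟨hconst _ _, (ht x y).mpr hs⟩
  rcases hp'.cases hp0' with ⟨γ, k, -, -, hk⟩ | ⟨t', -, ht'⟩
  · obtain ⟨x, y, hx, hy, hxy, hs⟩ := exists_tripleSide_eq_below_four t
    refine inj x y hx hy hxy ⟨(ht x y).mpr hs, ?_⟩
    rw [hk, hk, mul_pow, mul_pow, jRoot_pow_pow_three, jRoot_pow_pow_three]
  have cross : ∀ (w : Fin 6 → ℂ) (t : Fin 10),
      (∀ a b, w a ^ 3 = w b ^ 3 ↔ tripleSide t a = tripleSide t b) →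
      tripleSide t 0 ≠ tripleSide t 1 → tripleSide t 2 ≠ tripleSide t 3 →
      w 0 ^ 3 * w 1 ^ 3 = w 2 ^ 3 * w 3 ^ 3 := by
    intro w t hw h1 h2
    by_cases h3 : tripleSide t 0 = tripleSide t 2
    · rw [(hw 0 2).mpr h3, (hw 1 3).mpr (by
        revert h1 h2 h3; generalize tripleSide t 0 = a; generalize tripleSide t 1 = b
        generalize tripleSide t 2 = c; generalize tripleSide t 3 = d; revert a b c d; decide)]
    · rw [(hw 0 3).mpr (by
        revert h1 h2 h3; generalize tripleSide t 0 = a; generalize tripleSide t 1 = b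
        generalize tripleSide t 2 = c; generalize tripleSide t 3 = d; revert a b c d; decide),
        (hw 1 2).mpr (by
        revert h1 h2 h3; generalize tripleSide t 0 = a; generalize tripleSide t 1 = b
        generalize tripleSide t 2 = c; generalize tripleSide t 3 = d; revert a b c d; decide)]
      ring
  rcases tripleSide_four_positions t t' (fun x y hx hy hxy h => inj x y hx hy hxy
    ⟨(ht x y).mpr h.1, (ht' x y).mpr h.2⟩) with ⟨s1, s2, s3, s4⟩ | ⟨x, y, hx, hy, hy', H⟩
  -- The products of the cubes over columns 0, 1 and over columns 2, 3 agree for `p` and for `p'`,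
  -- while for the quotient they are opposite.
  · have e1 := cross p t ht s1 s2
    have e2 := cross p' t' ht' s3 s4
    simp only [cube] at e1
    simp at e1
    have n1 := pow_ne_zero 3 (hp0' 0)
    have n2 := pow_ne_zero 3 (hp0' 1)
    have : c ^ 3 * c ^ 3 * (p' 0 ^ 3 * p' 1 ^ 3) = 0 := by
      linear_combination e1 / 2 + c ^ 3 * c ^ 3 / 2 * e2 +
        c ^ 3 * c ^ 3 * (p' 2 ^ 3 * p' 3 ^ 3) / 2 * I_sq
    exact mul_ne_zero (mul_ne_zero h0 h0) (mul_ne_zero n1 n2) this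
  -- The opposite values `q³` and `-q³` would be one of `±1` and one of `±i`.
  · have opp : ![1, -1, -I, I, q ^ 3, -q ^ 3] x = -![1, -1, -I, I, q ^ 3, -q ^ 3] y := by
      rcases H with ⟨s1, s2, s3, s4⟩ | ⟨s1, s2, s3, s4⟩
      · rw [← quot 4 x ((ht _ _).mpr s1) ((ht' _ _).mpr s2),
          ← quot 5 y ((ht _ _).mpr s3) ((ht' _ _).mpr s4)]
        simp
      · rw [← quot 5 x ((ht _ _).mpr s1) ((ht' _ _).mpr s2),
          ← quot 4 y ((ht _ _).mpr s3) ((ht' _ _).mpr s4)]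
        simp
    have h4 := congrArg re opp
    fin_cases x <;> fin_cases y <;> first
      | exact absurd hx (by decide)
      | exact absurd hy (by decide)
      | exact absurd hy' (by decide)
      | (norm_num at h4; done)

/-! ### Excluding three-type relations beside a two-type triangle. -/

/-- The first points of an alternating walk. -/
def walk (μ ν : Fin 6 → Fin 6) (a : Fin 6) : Fin 6 → Fin 6 :=
  ![a, μ a, ν (μ a), μ (ν (μ a)), ν (μ (ν (μ a))), μ (ν (μ (ν (μ a))))]

/-- The union of two matchings consists of cycles of even length: 2+2+2, 4+2 or 6. -/
theorem exists_walk : ∀ m₁ m₂ : Fin 15, m₁ = m₂ ∨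
    (∃ a x, Function.Injective ![a, matching m₁ a, matching m₂ (matching m₁ a),
        matching m₁ (matching m₂ (matching m₁ a)), x, matching m₁ x] ∧
      matching m₂ (matching m₁ (matching m₂ (matching m₁ a))) = a ∧
      matching m₂ x = matching m₁ x) ∨
    ∃ a, Function.Injective (walk (matching m₁) (matching m₂) a) ∧
      matching m₂ (walk (matching m₁) (matching m₂) a 5) = a := by
  decide +kernel

theorem eq_or_eq_of_isTwoToOne : ∀ κ : Fin 6 → Fin 3, IsTwoToOne κ → κ 5 = κ 4 →
    κ 0 + κ 2 = κ 1 + κ 3 → (κ 1 = κ 0 ∧ κ 3 = κ 2) ∨ (κ 2 = κ 1 ∧ κ 0 = κ 3) := by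
  decide +kernel

theorem IsTwoToOne.matching_eq {k : Fin 6 → Fin 3} (hk : IsTwoToOne k) {m m' : Fin 15}
    (h : ∀ a, k (matching m a) = k a) (h' : ∀ a, k (matching m' a) = k a) (a : Fin 6) :
    matching m a = matching m' a := by
  by_contra hne
  have hsub : ({a, matching m a, matching m' a} : Finset (Fin 6)) ⊆
      Finset.univ.filter fun b => k b = k a := by
    intro b hb
    simp only [Finset.mem_insert, Finset.mem_singleton] at hb
    rcases hb with rfl | rfl | rfl <;> simp [h, h']
  have := Finset.card_le_card hsub
  rw [hk, Finset.card_insert_of_notMem (by simp [(matching_ne _ _).symm]),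
    Finset.card_pair hne] at this
  omega

/-- One matching preserves the values and the other negates them, so a common edge, or a closed
hexagon with three negations, gives a value equal to its opposite. -/
theorem not_isTwoType_of_matching {w : Fin 6 → ℂ} (hw0 : ∀ a, w a ≠ 0) {m : Fin 15}
    (h : ∀ a, w (matching m a) = w a) : ¬ IsTwoType w := by
  rintro ⟨m', h'⟩
  have key : ∀ m m' : Fin 15, (∃ a, matching m a = matching m' a) ∨ ∃ a, matching m (matching m'
      (matching m (matching m' (matching m (matching m' a))))) = a := by
    decide +kernel
  rcases key m m' with ⟨a, e⟩ | ⟨a, e⟩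
  · have := congrArg w e
    rw [h, h'] at this
    exact hw0 a (self_eq_neg.mp this)
  · have := congrArg w e
    simp only [h, h', neg_neg] at this
    exact hw0 a (neg_eq_self.mp this)

theorem mul_mul_eq_cube {x y z : ℂ} (hxy : x ≠ y) (hyz : y ≠ z) (hxz : x ≠ z)
    (h : x ^ 3 = y ^ 3) (h' : y ^ 3 = z ^ 3) : x * y * z = x ^ 3 := by
  have h1 := add_add_eq_zero_of_cubes hxy hyz hxz h h'
  have h2 : x ^ 2 + x * y + y ^ 2 = 0 := by
    have : (x - y) * (x ^ 2 + x * y + y ^ 2) = 0 := by linear_combination h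
    exact (mul_eq_zero.mp this).resolve_left (sub_ne_zero.mpr hxy)
  linear_combination x * y * h1 - x * h2

/-- The alternating products of two rotated triples differ. -/
theorem IsCompleteOn.mul_mul_ne {t : Fin 10} {p : Fin 6 → ℂ} (hp0 : ∀ a, p a ≠ 0)
    (hc : IsCompleteOn t p) (ht : ∀ a b, p a ^ 3 = p b ^ 3 ↔ tripleSide t a = tripleSide t b)
    (e : Equiv.Perm (Fin 6)) : p (e 0) * p (e 2) * p (e 4) ≠ p (e 1) * p (e 3) * p (e 5) := by
  intro R
  obtain ⟨t', ht'⟩ := exists_tripleSide (fun i => tripleSide t (e i)) (by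
    rw [← card_tripleSide t]
    exact Finset.card_equiv e (by simp))
  have hQ : ∀ i j, p (e i) ^ 3 = p (e j) ^ 3 ↔ tripleSide t' i = tripleSide t' j := fun i j => by
    rw [ht, ht']
  have key : ∀ t' : Fin 10,
      (tripleSide t' 0 = tripleSide t' 2 ∧ tripleSide t' 2 = tripleSide t' 4 ∧
        tripleSide t' 1 = tripleSide t' 3 ∧ tripleSide t' 3 = tripleSide t' 5 ∧
        tripleSide t' 0 ≠ tripleSide t' 1) ∨
      ∃ x x' y : Fin 6, [x, x', y].Perm [0, 2, 4] ∧ tripleSide t' x = tripleSide t' x' ∧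
        ∃ z z' w : Fin 6, [z, z', w].Perm [1, 3, 5] ∧ tripleSide t' z = tripleSide t' z' ∧
        tripleSide t' x = tripleSide t' w ∧ tripleSide t' y = tripleSide t' z ∧
        tripleSide t' x ≠ tripleSide t' y := by
    decide +kernel
  have hne : ∀ {i j}, i ≠ j → tripleSide t' i = tripleSide t' j → p (e i) ≠ p (e j) :=
    fun hij h => (hc _ _ (e.injective.ne hij) ((ht' _ _).mp h)).1
  -- If the alternating triples are those of the splitting, the two products are the two distinct
  -- cubes X and Y. Otherwise cubing the relation gives X²Y = XY².
  rcases key t' with ⟨h1, h2, h3, h4, h5⟩ | ⟨x, x', y, hP, h1, z, z', w, hP', h2, h3, h4, h5⟩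
  · rw [mul_mul_eq_cube (hne (by decide) h1) (hne (by decide) h2) (hne (by decide) (h1.trans h2))
      ((hQ _ _).mpr h1) ((hQ _ _).mpr h2), mul_mul_eq_cube (hne (by decide) h3)
      (hne (by decide) h4) (hne (by decide) (h3.trans h4)) ((hQ _ _).mpr h3) ((hQ _ _).mpr h4)] at R
    exact h5 ((hQ _ _).mp R)
  · have P := (hP.map fun i => p (e i) ^ 3).prod_eq
    have P' := (hP'.map fun i => p (e i) ^ 3).prod_eq
    simp only [List.map_cons, List.map_nil, List.prod_cons, List.prod_nil, ← (hQ _ _).mpr h1,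
      ← (hQ _ _).mpr h2, ← (hQ _ _).mpr h3, ← (hQ _ _).mpr h4] at P P'
    apply h5
    rw [← hQ]
    apply mul_left_cancel₀ (mul_ne_zero (pow_ne_zero 3 (hp0 (e x))) (pow_ne_zero 3 (hp0 (e y))))
    linear_combination P - P' + congrArg (· ^ 3) R

/-- If the cube of `p` is not constant, `p` is injective; a common edge of the matchings of `y` and
`g` contradicts this, and a hexagon contradicts `IsCompleteOn.mul_mul_ne`. If it is constant, the
hexagon is excluded by `hs`, and in the other cases the fibres of `p` are the edges of one of the
two matchings. -/
theorem exists_matching_of_isThreeType {p g y : Fin 6 → ℂ} (hp0 : ∀ a, p a ≠ 0)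
    (hg0 : ∀ a, g a ≠ 0) (hp : IsThreeType p) (hpgy : ∀ a, p a = y a / g a) (hg : IsTwoType g)
    (hy : IsTwoType y) (hs : ∃ a b, g a ^ 2 = -g b ^ 2) :
    ∃ (γ : ℂ) (k : Fin 6 → Fin 3) (m : Fin 15), γ ≠ 0 ∧ IsTwoToOne k ∧
      (∀ a, p a = γ * jRoot ^ (k a : ℕ)) ∧ (∀ a, k (matching m a) = k a) ∧
      ∀ a, g (matching m a) = -g a := by
  obtain ⟨m₁, h1⟩ := hy
  obtain ⟨m₂, h2⟩ := hg
  have i1 := matching_matching m₁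
  have i2 := matching_matching m₂
  have two : ∀ a, matching m₁ a = matching m₂ a → p (matching m₁ a) = p a := fun a h => by
    rw [hpgy, hpgy]; exact div_eq_of_walk_two h1 h2 rfl h.symm
  rcases hp.cases hp0 with ⟨γ, k, hγ, hk, hpk⟩ | ⟨t, hc, ht⟩
  · refine ⟨γ, k, ?_⟩
    have kinj : ∀ a b, p a = p b → k a = k b := fun a b h => by
      rw [hpk, hpk] at h
      exact (jRoot_pow_eq_iff _ _).mp (mul_left_cancel₀ hγ h)
    have of_first : (∀ a, k (matching m₁ a) = k a) → ∀ a, g (matching m₁ a) = -g a := by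
      intro h a
      have : p (matching m₁ a) = p a := by rw [hpk, hpk, h]
      rw [hpgy, hpgy, h1, neg_div, ← div_neg] at this
      have hya : y a ≠ 0 := fun h => hp0 a (by rw [hpgy, h, zero_div])
      have h0 := hg0 (matching m₁ a)
      have h0' := hg0 a
      field_simp at this
      linear_combination -this
    rcases exists_walk m₁ m₂ with rfl | ⟨a, x, hinj, e, ex⟩ | ⟨a, hinj, e⟩
    · exact ⟨m₁, hγ, hk, hpk, fun a => kinj _ _ (two a rfl), h2⟩
    · have hbij := Finite.injective_iff_bijective.mp hinj
      have R : p a * p (matching m₂ (matching m₁ a)) =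
          p (matching m₁ a) * p (matching m₁ (matching m₂ (matching m₁ a))) := by
        simp only [hpgy]
        exact div_eq_of_walk_four h1 h2 rfl rfl rfl e
      have K : k a + k (matching m₂ (matching m₁ a)) =
          k (matching m₁ a) + k (matching m₁ (matching m₂ (matching m₁ a))) := by
        rw [← jRoot_pow_eq_iff, jRoot_pow_add, jRoot_pow_add]
        apply mul_left_cancel₀ (mul_ne_zero hγ hγ)
        simp only [hpk] at R
        linear_combination R
      have X := kinj _ _ (two x ex.symm)
      rcases eq_or_eq_of_isTwoToOne _ (hk.comp (Equiv.ofBijective _ hbij)) X K with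
        ⟨H, H'⟩ | ⟨H, H'⟩ <;> simp [Equiv.ofBijective_apply] at H H'
      · have hm : ∀ z, k (matching m₁ z) = k z := by
          intro z
          obtain ⟨i, rfl⟩ := hbij.surjective z
          fin_cases i <;> simp [i1, H, H', X]
        exact ⟨m₁, hγ, hk, hpk, hm, of_first hm⟩
      · refine ⟨m₂, hγ, hk, hpk, ?_, h2⟩
        intro z
        obtain ⟨i, rfl⟩ := hbij.surjective z
        have e' : matching m₂ a = matching m₁ (matching m₂ (matching m₁ a)) := by
          conv_lhs => rw [← e, i2]
        have ex' : matching m₂ (matching m₁ x) = x := by rw [← ex, i2]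
        fin_cases i <;> simp [i2, H, H', X, e, e', ex, ex']
    -- Since `y³` is a multiple of `g³`, the sixth power of `g` is invariant under both matchings,
    -- hence constant on the hexagon, whereas `hs` gives two opposite sixth powers.
    · have g1 : ∀ z, g (matching m₁ z) ^ 6 = g z ^ 6 := by
        intro z
        have c : ∀ z, y z ^ 3 = γ ^ 3 * g z ^ 3 := fun z => by
          have := hpgy z
          have h0 := hg0 z
          rw [hpk] at this
          field_simp at this
          rw [← this, mul_pow, mul_pow, jRoot_pow_pow_three]
          ring
        have c1 := c (matching m₁ z)
        rw [h1, neg_pow, c] at c1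
        have c2 : g (matching m₁ z) ^ 3 = - g z ^ 3 := by
          apply mul_left_cancel₀ (pow_ne_zero 3 hγ)
          linear_combination -c1
        linear_combination (g (matching m₁ z) ^ 3 - g z ^ 3) * c2
      have g2 : ∀ z, g (matching m₂ z) ^ 6 = g z ^ 6 := fun z => by
        rw [h2]; ring
      have g3 : ∀ z, g z ^ 6 = g a ^ 6 := by
        intro z
        obtain ⟨i, rfl⟩ := (Finite.injective_iff_bijective.mp hinj).surjective z
        fin_cases i <;> simp [walk, g1, g2]
      obtain ⟨b, c, hbc⟩ := hs
      have h6 : g b ^ 6 = -g c ^ 6 := by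
        linear_combination (g b ^ 4 - g b ^ 2 * g c ^ 2 + g c ^ 4) * hbc
      rw [g3 b, g3 c] at h6
      exact absurd (self_eq_neg.mp h6) (pow_ne_zero 6 (hg0 a))
  · exfalso
    have pinj : ∀ a b, p a = p b → a = b := fun a b h => by
      by_contra hab
      exact (hc a b hab ((ht a b).mp (by rw [h]))).1 h
    rcases exists_walk m₁ m₂ with rfl | ⟨a, x, hinj, e, ex⟩ | ⟨a, hinj, e⟩
    · exact matching_ne m₁ 0 (pinj _ _ (two 0 rfl))
    · exact matching_ne m₁ x (pinj _ _ (two x ex.symm))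
    · refine hc.mul_mul_ne hp0 ht
        (Equiv.ofBijective _ (Finite.injective_iff_bijective.mp hinj)) ?_
      simp only [Equiv.ofBijective_apply, hpgy]
      exact div_eq_of_walk_six h1 h2 rfl rfl rfl rfl rfl e

/-! ### The Ramsey argument, and the spread of two-type from a triangle to all rows. -/

/-- Three of the five edges at the point 0 have the same colour; either one of the edges between
their other ends has that colour too, or these form a triangle of the other colour. -/
theorem exists_monochromatic_triple (α : Fin 6 → Fin 6 → Prop) :
    (∃ i j k, i ≠ j ∧ j ≠ k ∧ i ≠ k ∧ α j i ∧ α k i ∧ α k j) ∨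
    ∃ i j k, i ≠ j ∧ j ≠ k ∧ i ≠ k ∧ ¬ α j i ∧ ¬ α k i ∧ ¬ α k j := by
  classical
  have key : ∀ f : Fin 6 → Bool, ∃ x y z : Fin 6, x ≠ 0 ∧ y ≠ 0 ∧ z ≠ 0 ∧ x ≠ y ∧ y ≠ z ∧ x ≠ z ∧
      f x = f y ∧ f y = f z := by
    decide +kernel
  obtain ⟨x, y, z, hx, hy, hz, hxy, hyz, hxz, e1, e2⟩ := key fun i => decide (α i 0)
  simp only [decide_eq_decide] at e1 e2
  by_cases h : α x 0
  · have hy' := e1.mp h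
    have hz' := e2.mp hy'
    by_cases h1 : α y x
    · exact Or.inl ⟨0, x, y, hx.symm, hxy, hy.symm, h, hy', h1⟩
    by_cases h2 : α z y
    · exact Or.inl ⟨0, y, z, hy.symm, hyz, hz.symm, hy', hz', h2⟩
    by_cases h3 : α z x
    · exact Or.inl ⟨0, x, z, hx.symm, hxz, hz.symm, h, hz', h3⟩
    exact Or.inr ⟨x, y, z, hxy, hyz, hxz, h1, h3, h2⟩
  · have hy' := mt e1.mpr h
    have hz' := mt e2.mpr hy'
    by_cases h1 : α y x
    · by_cases h2 : α z y
      · by_cases h3 : α z x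
        · exact Or.inl ⟨x, y, z, hxy, hyz, hxz, h1, h3, h2⟩
        · exact Or.inr ⟨0, x, z, hx.symm, hxz, hz.symm, h, hz', h3⟩
      · exact Or.inr ⟨0, y, z, hy.symm, hyz, hz.symm, hy', hz', h2⟩
    · exact Or.inr ⟨0, x, y, hx.symm, hxy, hy.symm, h, hy', h1⟩

section rows

variable {h : Matrix (Fin 6) (Fin 6) ℂ}

theorem rowRatio_mul (hu : ∀ i j, ‖h i j‖ = 1) (i j k a : Fin 6) :
    rowRatio h i k a = rowRatio h i j a * rowRatio h j k a := by
  have := ne_zero_of_norm (hu j a)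
  simp only [rowRatio]
  field_simp

theorem rowRatio_div (hu : ∀ i j, ‖h i j‖ = 1) (i j k a : Fin 6) :
    rowRatio h i j a = rowRatio h i k a / rowRatio h j k a := by
  rw [rowRatio_mul hu i j k, mul_div_cancel_right₀]
  exact ne_zero_of_norm (norm_rowRatio hu _ _ _)

/-- The quotient of two rows among three rows of pairwise two-type. -/
theorem exists_sq_rowRatio_eq_neg_sq (hu : ∀ i j, ‖h i j‖ = 1) {i j k : Fin 6}
    (h1 : IsTwoType (rowRatio h i k)) (h2 : IsTwoType (rowRatio h j k))
    (h3 : IsTwoType (rowRatio h i j)) :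
    ∃ a b, rowRatio h i j a ^ 2 = -rowRatio h i j b ^ 2 :=
  exists_sq_eq_neg_sq (fun _ => ne_zero_of_norm (norm_rowRatio hu _ _ _))
    (rowRatio_div hu i j k) h1 h2 h3

theorem not_isThreeType_and_isThreeType (hu : ∀ i j, ‖h i j‖ = 1) {i j k x : Fin 6}
    (h1 : IsTwoType (rowRatio h i k)) (h2 : IsTwoType (rowRatio h j k))
    (h3 : IsTwoType (rowRatio h i j)) (h4 : IsThreeType (rowRatio h x i)) :
    ¬ IsThreeType (rowRatio h x j) := by
  intro h5
  have hn : ∀ i j a, rowRatio h i j a ≠ 0 := fun i j a => ne_zero_of_norm (norm_rowRatio hu i j a)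
  obtain ⟨e, c, q, he⟩ := exists_perm_of_sq_eq_neg_sq (hn i j) h3
    (exists_sq_rowRatio_eq_neg_sq hu h1 h2 h3)
  have hc : c ≠ 0 := by
    have := hn i j (e 0)
    rw [he] at this
    exact left_ne_zero_of_mul this
  have h4' := h4.const_mul_comp e 1
  have h5' := h5.const_mul_comp e 1
  simp only [one_mul] at h4' h5'
  refine not_isThreeType_of_pattern (g := fun a => rowRatio h i j (e a)) (fun a => hn x j (e a))
    (fun a => hn x i (e a)) hc (fun a => ?_) he h5' h4'
  rw [rowRatio_mul hu x i j, mul_comm]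

/-- The row `x` would be of two-type with `j` and `k`. The fibres of `x / i` are then the edges of a
matching that negates both `i / j` and `i / k`. Hence `j / k` is invariant under a matching, so not
of two-type. -/
theorem not_isThreeType_of_two_triangle (hu : ∀ i j, ‖h i j‖ = 1)
    (hr : ∀ i j, i ≠ j → IsTwoType (rowRatio h i j) ∨ IsThreeType (rowRatio h i j))
    {i j k x : Fin 6} (h1 : IsTwoType (rowRatio h i k)) (h2 : IsTwoType (rowRatio h j k))
    (h3 : IsTwoType (rowRatio h i j)) (hj : x ≠ j) (hk : x ≠ k) :
    ¬ IsThreeType (rowRatio h x i) := by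
  intro h4
  have h5 := (hr x j hj).resolve_right (not_isThreeType_and_isThreeType hu h1 h2 h3 h4)
  have h6 := (hr x k hk).resolve_right (not_isThreeType_and_isThreeType hu h3
    (isTwoType_rowRatio_comm.mp h2) h1 h4)
  have hn : ∀ i j a, rowRatio h i j a ≠ 0 := fun i j a => ne_zero_of_norm (norm_rowRatio hu i j a)
  obtain ⟨γ, κ, m, hγ, hκ, hp, hm, hg⟩ := exists_matching_of_isThreeType (hn x i) (hn i j) h4
    (fun a => by rw [rowRatio_mul hu x i j, mul_div_cancel_right₀ _ (hn i j a)]) h3 h5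
    (exists_sq_rowRatio_eq_neg_sq hu h1 h2 h3)
  obtain ⟨γ', κ', m', hγ', hκ', hp', hm', hg'⟩ := exists_matching_of_isThreeType (hn x i) (hn i k)
    h4 (fun a => by rw [rowRatio_mul hu x i k, mul_div_cancel_right₀ _ (hn i k a)]) h1 h6
    (exists_sq_rowRatio_eq_neg_sq hu h3 (isTwoType_rowRatio_comm.mp h2) h1)
  have hm'' : ∀ a, κ (matching m' a) = κ a := fun a => by
    rw [← jRoot_pow_eq_iff]
    apply mul_left_cancel₀ hγ
    rw [← hp, ← hp, hp', hp', hm']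
  refine not_isTwoType_of_matching (hn j k) (m := m) (fun a => ?_) h2
  have e1 := hg a
  have e2 := hg' a
  rw [← hκ.matching_eq hm hm''] at e2
  rw [rowRatio_mul hu i j k, rowRatio_mul hu i j k, e1] at e2
  apply mul_left_cancel₀ (hn i j a)
  linear_combination -e2

theorem isTwoType_of_two_triangle (hu : ∀ i j, ‖h i j‖ = 1)
    (hr : ∀ i j, i ≠ j → IsTwoType (rowRatio h i j) ∨ IsThreeType (rowRatio h i j))
    {i j k : Fin 6} (h1 : IsTwoType (rowRatio h i k)) (h2 : IsTwoType (rowRatio h j k))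
    (h3 : IsTwoType (rowRatio h i j)) {x y : Fin 6} (hxy : x ≠ y) :
    IsTwoType (rowRatio h x y) := by
  have h1' := isTwoType_rowRatio_comm.mp h1
  have h2' := isTwoType_rowRatio_comm.mp h2
  have h3' := isTwoType_rowRatio_comm.mp h3
  have to_i : ∀ x, x ≠ i → IsTwoType (rowRatio h x i) := by
    intro x hx
    by_cases hj : x = j
    · exact hj ▸ h3'
    by_cases hk : x = k
    · exact hk ▸ h1'
    exact (hr x i hx).resolve_right (not_isThreeType_of_two_triangle hu hr h1 h2 h3 hj hk)
  have to_j : ∀ x, x ≠ j → IsTwoType (rowRatio h x j) := by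
    intro x hx
    by_cases hi : x = i
    · exact hi ▸ h3
    by_cases hk : x = k
    · exact hk ▸ h2'
    exact (hr x j hx).resolve_right (not_isThreeType_of_two_triangle hu hr h2 h1 h3' hi hk)
  by_cases hyi : y = i
  · exact hyi ▸ to_i x (hyi ▸ hxy)
  by_cases hyj : y = j
  · exact hyj ▸ to_j x (hyj ▸ hxy)
  by_cases hxi : x = i
  · exact hxi ▸ isTwoType_rowRatio_comm.mp (to_i y hyi)
  by_cases hxj : x = j
  · exact hxj ▸ isTwoType_rowRatio_comm.mp (to_j y hyj)
  -- The rows `y`, `i`, `j` form another two-type triangle.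
  exact (hr x y hxy).resolve_right (not_isThreeType_of_two_triangle hu hr (i := y) (j := i) (k := j)
    (to_j y hyj) h3 (to_i y hyi) hxi hxj)

end rows

/-! ### Matrices with all rows pairwise of two-type: the Haagerup family. -/

/-- The three cases for the parameter `q` of a Haagerup matrix. -/
def IsPhase (mode : Fin 3) (q : ℂ) : Prop :=
  ‖q‖ = 1 ∧ ![q ^ 8 ≠ 1, q ^ 2 = I, q = 1] mode

/-- The integer exponent of a monomial in `I` and `q`, when `q ^ 2 = I`. -/
def Mono.octic (x : Mono) : ℤ := 2 * (x.1 : ℤ) + x.2.1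

/-- Formal test for two monomials in `I` and `q` to be equal. -/
def sureEq (mode : Fin 3) (x y : Mono) : Bool :=
  ![x.1 % 4 == y.1 % 4 && x.2.1 == y.2.1, (x.octic - y.octic) % 8 == 0, x.1 % 4 == y.1 % 4] mode

/-- Formal test for two monomials in `I` and `q` to be possibly equal. -/
def maybeEq (mode : Fin 3) (x y : Mono) : Bool :=
  ![x.1 % 4 == y.1 % 4 && x.2.1 == y.2.1 || 3 ≤ (x.2.1 - y.2.1).natAbs,
    (x.octic - y.octic) % 8 == 0, x.1 % 4 == y.1 % 4] mode

theorem I_pow_eq_iff {a b : ℕ} : I ^ a = I ^ b ↔ a % 4 = b % 4 := by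
  have h : ∀ n, I ^ n = I ^ (n % 4) := fun n => by
    conv_lhs => rw [← Nat.div_add_mod n 4, pow_add, pow_mul, I_pow_four, one_pow, one_mul]
  refine ⟨fun hab => ?_, fun hab => by rw [h, hab, ← h]⟩
  rw [h, h b] at hab
  exact isPrimitiveRoot_I.pow_inj (Nat.mod_lt _ (by norm_num)) (Nat.mod_lt _ (by norm_num)) hab

theorem Mono.eval_octic {q : ℂ} (hq0 : q ≠ 0) (hq : q ^ 2 = I) (x : Mono) :
    x.eval I q 1 = q ^ x.octic := by
  rw [Mono.eval, _root_.one_zpow, mul_one, octic, zpow_add₀ hq0, _root_.zpow_mul, ← hq]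
  norm_cast

theorem Mono.eval_eq_iff_octic {q : ℂ} (hq : q ^ 2 = I) (x y : Mono) :
    x.eval I q 1 = y.eval I q 1 ↔ (x.octic - y.octic) % 8 = 0 := by
  have h4 : q ^ 4 = -1 := by rw [show 4 = 2 * 2 from rfl, pow_mul, hq, I_sq]
  have h8 : q ^ 8 = 1 := by rw [show 8 = 4 * 2 from rfl, pow_mul, h4]; norm_num
  have hq0 : q ≠ 0 := by rintro rfl; norm_num at h8
  have hp : IsPrimitiveRoot q 8 := by
    have : ¬ q ^ 2 ^ 2 = 1 := by rw [show 2 ^ 2 = 4 from rfl, h4]; norm_num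
    exact IsPrimitiveRoot.iff_orderOf.mpr (orderOf_eq_prime_pow this h8)
  rw [eval_octic hq0 hq, eval_octic hq0 hq, ← div_eq_one_iff_eq (zpow_ne_zero _ hq0),
    ← zpow_sub₀ hq0, hp.zpow_eq_one_iff_dvd]
  exact Int.dvd_iff_emod_eq_zero

theorem eval_eq_of_sureEq {mode : Fin 3} {q : ℂ} (hq : IsPhase mode q) {x y : Mono}
    (h : sureEq mode x y) : x.eval I q 1 = y.eval I q 1 := by
  obtain ⟨-, hq⟩ := hq
  fin_cases mode <;> simp [sureEq] at h hq
  · rw [Mono.eval, Mono.eval, h.2, I_pow_eq_iff.mpr h.1, _root_.one_zpow, _root_.one_zpow]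
  · exact (Mono.eval_eq_iff_octic hq x y).mpr (Int.emod_eq_zero_of_dvd h)
  · simp [Mono.eval, hq, I_pow_eq_iff.mpr h]

theorem maybeEq_of_eval_eq {mode : Fin 3} {q : ℂ} (hq : IsPhase mode q) {x y : Mono}
    (h : x.eval I q 1 = y.eval I q 1) : maybeEq mode x y := by
  obtain ⟨hq1, hq⟩ := hq
  have hq0 := ne_zero_of_norm hq1
  fin_cases mode <;> simp [maybeEq] at hq ⊢
  · rw [Mono.eval, Mono.eval, _root_.one_zpow, _root_.one_zpow, mul_one, mul_one] at h
    by_contra hcon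
    push Not at hcon
    obtain ⟨h1, h2⟩ := hcon
    by_cases he : x.2.1 = y.2.1
    · rw [he] at h
      exact h1 (I_pow_eq_iff.mp (mul_right_cancel₀ (zpow_ne_zero _ hq0) h)) he
    -- Fourth powers remove the powers of `i`; an exponent difference of 1 or 2 in absolute value
    -- then implies `q ^ 8 = 1`.
    · have e4 : q ^ (4 * (x.2.1 - y.2.1)) = 1 := by
        have h4 := congrArg (· ^ 4) h
        simp only [mul_pow, ← pow_mul, mul_comm _ 4] at h4
        rw [pow_mul, pow_mul, I_pow_four, one_pow, one_pow, one_mul, one_mul] at h4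
        rw [mul_sub, zpow_sub₀ hq0, div_eq_one_iff_eq (zpow_ne_zero _ hq0), mul_comm, mul_comm 4,
          _root_.zpow_mul, _root_.zpow_mul]
        exact_mod_cast h4
      have hd : x.2.1 - y.2.1 = 1 ∨ x.2.1 - y.2.1 = -1 ∨ x.2.1 - y.2.1 = 2 ∨
          x.2.1 - y.2.1 = -2 := by omega
      have e8 : q ^ (8 : ℤ) = 1 → False := fun h => hq (by exact_mod_cast h)
      rcases hd with hd | hd | hd | hd <;> rw [hd] at e4 <;> apply e8
      · rw [show (8 : ℤ) = 4 * 1 * 2 from rfl, _root_.zpow_mul, e4, _root_.one_zpow]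
      · rw [show (8 : ℤ) = 4 * -1 * -2 from rfl, _root_.zpow_mul, e4, _root_.one_zpow]
      · exact e4
      · rw [show (8 : ℤ) = 4 * -2 * -1 from rfl, _root_.zpow_mul, e4, _root_.one_zpow]
  · exact Int.dvd_of_emod_eq_zero ((Mono.eval_eq_iff_octic hq x y).mp h)
  · simpa [Mono.eval, hq, I_pow_eq_iff] using h

/-- The second row of a normalized matrix. -/
def secondRow : Fin 6 → Mono :=
  ![(0, 0, 0), (2, 0, 0), (1, 0, 0), (3, 0, 0), (0, 1, 0), (2, 1, 0)]

/-- The inverse of the second row of a normalized matrix. -/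
def secondRowInv : Fin 6 → Mono :=
  ![(0, 0, 0), (2, 0, 0), (3, 0, 0), (1, 0, 0), (0, -1, 0), (2, -1, 0)]

/-- The possible further rows of a normalized matrix. -/
def furtherRow : Fin 16 → Fin 6 → Mono :=
  ![![(0, 0, 0), (0, -1, 0), (2, -1, 0), (1, 0, 0), (3, 0, 0), (2, 0, 0)],
    ![(0, 0, 0), (1, 0, 0), (2, 0, 0), (3, 0, 0), (2, 1, 0), (0, 1, 0)],
    ![(0, 0, 0), (2, -1, 0), (0, -1, 0), (1, 0, 0), (2, 0, 0), (3, 0, 0)],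
    ![(0, 0, 0), (3, 0, 0), (3, 0, 0), (2, 0, 0), (1, 0, 0), (1, 0, 0)],
    ![(0, 0, 0), (0, -1, 0), (3, 0, 0), (2, -1, 0), (1, 0, 0), (2, 0, 0)],
    ![(0, 0, 0), (1, 0, 0), (2, 0, 0), (1, 0, 0), (3, 0, 0), (3, 0, 0)],
    ![(0, 0, 0), (2, -1, 0), (3, 0, 0), (0, -1, 0), (2, 0, 0), (1, 0, 0)],
    ![(0, 0, 0), (3, 0, 0), (1, 0, 0), (2, 0, 0), (2, 1, 0), (0, 1, 0)],
    ![(0, 0, 0), (0, 1, 0), (1, 1, 0), (2, 0, 0), (2, 1, 0), (3, 1, 0)],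
    ![(0, 0, 0), (1, 0, 0), (3, 0, 0), (0, 0, 0), (2, 0, 0), (2, 0, 0)],
    ![(0, 0, 0), (2, 1, 0), (3, 1, 0), (2, 0, 0), (1, 1, 0), (0, 1, 0)],
    ![(0, 0, 0), (3, 0, 0), (2, 0, 0), (1, 0, 0), (3, 1, 0), (1, 1, 0)],
    ![(0, 0, 0), (0, 1, 0), (2, 0, 0), (3, 1, 0), (2, 1, 0), (1, 1, 0)],
    ![(0, 0, 0), (1, 0, 0), (3, 0, 0), (2, 0, 0), (1, 1, 0), (3, 1, 0)],
    ![(0, 0, 0), (2, 1, 0), (2, 0, 0), (1, 1, 0), (3, 1, 0), (0, 1, 0)],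
    ![(0, 0, 0), (3, 0, 0), (0, 0, 0), (1, 0, 0), (2, 0, 0), (2, 0, 0)]]

/-- The change of value along an edge of the second matching. -/
def secondStep (a b : Fin 6) (x : Mono) : Mono :=
  Mono.mul (2, 0, 0) ((secondRow b).mul ((secondRowInv a).mul x))

/-- The values of a row along an alternating walk. -/
def walkValue (w : Fin 6 → Fin 6) : Fin 6 → Mono :=
  let v₁ : Mono := (2, 0, 0)
  let v₂ := secondStep (w 1) (w 2) v₁
  let v₃ := Mono.mul (2, 0, 0) v₂
  let v₄ := secondStep (w 3) (w 4) v₃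
  ![(0, 0, 0), v₁, v₂, v₃, v₄, Mono.mul (2, 0, 0) v₄]

/-- Two disjoint matchings form a hexagon, along which the value 1 at the point 0 determines the
whole row. The last edge imposes a closing condition, which only the listed rows can satisfy. -/
theorem exists_furtherRow_of_walk : ∀ m₁ m₂ : Fin 15, (∀ a, matching m₁ a ≠ matching m₂ a) →
    Function.Injective (walk (matching m₁) (matching m₂) 0) ∧
    matching m₂ (walk (matching m₁) (matching m₂) 0 5) = 0 ∧ ∀ mode ∈ [(0 : Fin 3), 1],
    maybeEq mode (0, 0, 0) (secondStep (walk (matching m₁) (matching m₂) 0 5) 0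
      (walkValue (walk (matching m₁) (matching m₂) 0) 5)) →
    ∃ l, ∀ i, sureEq mode (walkValue (walk (matching m₁) (matching m₂) 0) i)
      (furtherRow l (walk (matching m₁) (matching m₂) 0 i)) := by
  decide +kernel

/-- Formal test for the quotient of two rows to be possibly of two-type. -/
def maybeTwo (mode : Fin 3) (x y : Fin 6 → Mono) : Prop :=
  ∃ m, ∀ a, maybeEq mode ((x (matching m a)).mul (y a))
    (Mono.mul (2, 0, 0) ((x a).mul (y (matching m a))))

instance (mode : Fin 3) (x y : Fin 6 → Mono) : Decidable (maybeTwo mode x y) := by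
  unfold maybeTwo; infer_instance

/-- The possible compatibility of two further rows. -/
def Adjacent (l l' : Fin 16) : Prop :=
  l ≠ l' ∧ (l.val / 4 = l'.val / 4 ∨ l.val % 8 = l'.val % 8)

instance (l l' : Fin 16) : Decidable (Adjacent l l') := by
  unfold Adjacent; infer_instance

theorem adjacent_of_maybeTwo : ∀ mode l l', maybeTwo mode (furtherRow l) (furtherRow l') →
    Adjacent l l' := by
  decide +kernel

/-- The exponents of the Haagerup matrix of parameter `I * q`. -/
def haagerupMonoMul : Fin 6 → Fin 6 → Mono :=
  ![![(0, 0, 0), (0, 0, 0), (0, 0, 0), (0, 0, 0), (0, 0, 0), (0, 0, 0)],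
    ![(0, 0, 0), (2, 0, 0), (1, 0, 0), (1, 0, 0), (3, 0, 0), (3, 0, 0)],
    ![(0, 0, 0), (1, 0, 0), (2, 0, 0), (3, 0, 0), (1, 1, 0), (3, 1, 0)],
    ![(0, 0, 0), (1, 0, 0), (3, 0, 0), (2, 0, 0), (3, 1, 0), (1, 1, 0)],
    ![(0, 0, 0), (3, 0, 0), (3, -1, 0), (1, -1, 0), (1, 0, 0), (2, 0, 0)],
    ![(0, 0, 0), (3, 0, 0), (1, -1, 0), (3, -1, 0), (2, 0, 0), (1, 0, 0)]]

theorem haagerupMatrix_mul_eq {q : ℂ} (hq : ‖q‖ = 1) :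
    haagerupMatrix (I * q) = evalMatrix I q 1 haagerupMonoMul := by
  have h3 := I_pow_three
  have hs : (starRingEnd ℂ) q = q⁻¹ := star_eq_inv_of_norm hq
  ext i j
  fin_cases i <;> fin_cases j <;>
    simp [haagerupMatrix, evalMatrix, haagerupMonoMul, Mono.eval, h3, hs]

/-- The row permutations leading to a Haagerup matrix. -/
def haagerupRowPerm (l₂ l₃ l₄ l₅ : Fin 16) : Fin 6 → Fin 6 :=
  let ρ : Fin 16 → Fin 6 := ![4, 2, 5, 1, 4, 1, 5, 3, 4, 1, 5, 2, 4, 3, 5, 1]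
  ![0, if l₂.val / 4 % 2 = 0 then 3 else 2, ρ l₂, ρ l₃, ρ l₄, ρ l₅]

/-- The column permutations leading to a Haagerup matrix. -/
def haagerupColPerm (l : Fin 16) : Fin 6 → Fin 6 :=
  if l < 4 then ![1, 2, 3, 0, 5, 4] else if l < 8 then ![0, 2, 1, 3, 4, 5]
  else if l < 12 then ![2, 1, 0, 3, 4, 5] else ![2, 0, 3, 1, 5, 4]

/-- The normalized matrix with given further rows. -/
def normalizedMono (l₂ l₃ l₄ l₅ : Fin 16) : Fin 6 → Fin 6 → Mono :=
  ![fun _ => (0, 0, 0), secondRow, furtherRow l₂, furtherRow l₃, furtherRow l₄, furtherRow l₅]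

/-- Formal test for a normalized matrix to be equivalent to a Haagerup matrix. -/
def HaagerupTest (l₂ l₃ l₄ l₅ : Fin 16) : Prop :=
  Function.Injective (haagerupRowPerm l₂ l₃ l₄ l₅) ∧ Function.Injective (haagerupColPerm l₂) ∧
    equivTest 4 (normalizedMono l₂ l₃ l₄ l₅)
      (if l₂.val / 4 % 2 = 0 then haagerupMonoMul else haagerupMono)
      (haagerupRowPerm l₂ l₃ l₄ l₅) (haagerupColPerm l₂)

instance (l₂ l₃ l₄ l₅ : Fin 16) : Decidable (HaagerupTest l₂ l₃ l₄ l₅) := by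
  unfold HaagerupTest; infer_instance

/-- The adjacency graph is four complete blocks of four vertices, with single edges joining `l` to
`l + 8`. So the further rows fill one block, and the parity of the block decides between the
parameters `i * q` and `q`. -/
theorem haagerupTest_of_adjacent : ∀ l₂ l₃, Adjacent l₂ l₃ → ∀ l₄, Adjacent l₂ l₄ →
    Adjacent l₃ l₄ → ∀ l₅, Adjacent l₂ l₅ → Adjacent l₃ l₅ → Adjacent l₄ l₅ →
    HaagerupTest l₂ l₃ l₄ l₅ := by
  decide +kernel

theorem eval_secondRow (q : ℂ) (a : Fin 6) :
    (secondRow a).eval I q 1 = ![1, -1, I, -I, q, -q] a := by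
  fin_cases a <;> simp [secondRow, Mono.eval, I_pow_three]

theorem eval_mul_of_norm {q : ℂ} (hq : ‖q‖ = 1) (x y : Mono) :
    (x.mul y).eval I q 1 = x.eval I q 1 * y.eval I q 1 :=
  Mono.eval_mul (ne_zero_of_norm hq) one_ne_zero x y

theorem eval_two (q : ℂ) : Mono.eval I q 1 (2, 0, 0) = -1 := by
  simp [Mono.eval]

theorem eval_zero (q : ℂ) : Mono.eval I q 1 (0, 0, 0) = 1 := by
  simp [Mono.eval]

theorem eval_ne_zero {q : ℂ} (hq : ‖q‖ = 1) (x : Mono) : x.eval I q 1 ≠ 0 :=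
  ne_zero_of_norm (x.norm_eval norm_I hq norm_one)

theorem eval_secondRowInv {q : ℂ} (hq : ‖q‖ = 1) (a : Fin 6) :
    (secondRowInv a).eval I q 1 = ((secondRow a).eval I q 1)⁻¹ := by
  refine eq_inv_of_mul_eq_one_left ?_
  have h : ∀ a, Mono.rel 4 0 ((secondRowInv a).mul (secondRow a)) (0, 0, 0) := by decide
  rw [← eval_mul_of_norm hq, Mono.eval_of_rel I_pow_four (h a), eval_zero, pow_zero, one_mul]

/-- The case `q = 1` needs its own enumeration, over rows of fourth roots of unity: the second row
then has repeated values, so the two matchings may share edges and no hexagon is guaranteed. -/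
theorem exists_furtherRow_of_pow_four : ∀ a b c d e : Fin 4,
    (∃ m, ∀ i, ![0, a, b, c, d, e] (matching m i) = ![0, a, b, c, d, e] i + 2) →
    (∃ m, ∀ i, ![0, a, b, c, d, e] (matching m i) + ![0, 2, 1, 3, 0, 2] i =
      ![0, a, b, c, d, e] i + ![0, 2, 1, 3, 0, 2] (matching m i) + 2) →
    ∃ l, ∀ i, sureEq 2 ((![0, a, b, c, d, e] i).val, 0, 0) (furtherRow l i) := by
  decide +kernel

theorem secondRow_injective : ∀ mode : Fin 3, mode ≠ 2 → ∀ a b,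
    maybeEq mode (secondRow a) (secondRow b) → a = b := by
  decide +kernel

theorem I_pow_val_add (a b : Fin 4) : I ^ (a + b).val = I ^ a.val * I ^ b.val := by
  rw [← pow_add, I_pow_eq_iff, Fin.val_add, Nat.mod_mod]

theorem I_pow_val_injective {a b : Fin 4} (h : I ^ a.val = I ^ b.val) : a = b := by
  rw [I_pow_eq_iff, Nat.mod_eq_of_lt a.2, Nat.mod_eq_of_lt b.2] at h
  exact Fin.ext h

/-- The rows compatible with the first two rows of a normalized matrix. -/
theorem exists_furtherRow {mode : Fin 3} {q : ℂ} (hq : IsPhase mode q) {z : Fin 6 → ℂ}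
    (hz : ∀ a, z a ≠ 0) (h4 : mode = 2 → ∀ a, z a ^ 4 = 1) (z0 : z 0 = 1) (h1 : IsTwoType z)
    (h2 : IsTwoType fun a => z a / (secondRow a).eval I q 1) :
    ∃ l, ∀ a, z a = (furtherRow l a).eval I q 1 := by
  obtain ⟨m₁, h1⟩ := h1
  obtain ⟨m₂, h2⟩ := h2
  have hn := eval_ne_zero hq.1
  by_cases hm : mode = 2
  · subst hm
    have hq1 : q = 1 := hq.2
    have hk : ∀ a, ∃ k : Fin 4, z a = I ^ k.val := fun a => by
      obtain ⟨i, hi, h⟩ := isPrimitiveRoot_I.eq_pow_of_pow_eq_one (h4 rfl a)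
      exact ⟨⟨i, hi⟩, h.symm⟩
    choose k hk using hk
    have I2 : I ^ (2 : Fin 4).val = -1 := I_sq
    have hs : ∀ a, (secondRow a).eval I q 1 =
        I ^ ((![0, 2, 1, 3, 0, 2] : Fin 6 → Fin 4) a).val := fun a => by
      rw [eval_secondRow, hq1]
      fin_cases a <;> simp [I_pow_three]
    have k0 : k 0 = 0 := I_pow_val_injective (by rw [← hk, z0]; rfl)
    have hk' : k = ![0, k 1, k 2, k 3, k 4, k 5] := by
      ext a; fin_cases a <;> simp [k0]
    have key := exists_furtherRow_of_pow_four (k 1) (k 2) (k 3) (k 4) (k 5)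
    rw [← hk'] at key
    obtain ⟨l, hl⟩ := key
      ⟨m₁, fun a => I_pow_val_injective (by rw [I_pow_val_add, I2, ← hk, ← hk, h1]; ring)⟩
      ⟨m₂, fun a => I_pow_val_injective (by
        have := h2 a
        simp only [hs, hk] at this
        field_simp at this
        rw [I_pow_val_add, I_pow_val_add, I_pow_val_add, I2]
        linear_combination this)⟩
    refine ⟨l, fun a => ?_⟩
    rw [← eval_eq_of_sureEq hq (hl a), hk]
    simp [Mono.eval]
  · have hmode : mode ∈ [(0 : Fin 3), 1] := by
      have : ∀ mode : Fin 3, mode ≠ 2 → mode ∈ [(0 : Fin 3), 1] := by decide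
      exact this mode hm
    -- A common edge would give two equal entries in the second row.
    have hdis : ∀ a, matching m₁ a ≠ matching m₂ a := by
      intro a e
      have := h2 a
      simp only [← e, h1] at this
      have e' : (secondRow (matching m₁ a)).eval I q 1 = (secondRow a).eval I q 1 := by
        have n0 := hz a
        have n1 := hn (secondRow (matching m₁ a))
        have n2 := hn (secondRow a)
        field_simp at this
        linear_combination this
      exact matching_ne _ _ (secondRow_injective mode hm _ _ (maybeEq_of_eval_eq hq e'))
    obtain ⟨hinj, hc, H⟩ := exists_furtherRow_of_walk m₁ m₂ hdis
    have step : ∀ a x, z a = Mono.eval I q 1 x →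
        z (matching m₂ a) = (secondStep a (matching m₂ a) x).eval I q 1 := by
      intro a x h
      have := h2 a
      have n1 := hn (secondRow a)
      have n2 := hn (secondRow (matching m₂ a))
      rw [secondStep, eval_mul_of_norm hq.1, eval_mul_of_norm hq.1, eval_mul_of_norm hq.1,
        eval_secondRowInv hq.1, eval_two, ← h]
      field_simp at this ⊢
      linear_combination this
    have step' : ∀ a x, z a = Mono.eval I q 1 x →
        z (matching m₁ a) = (Mono.mul (2, 0, 0) x).eval I q 1 := by
      intro a x h
      rw [eval_mul_of_norm hq.1, eval_two, ← h, h1]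
      ring
    have v0 : z 0 = Mono.eval I q 1 (0, 0, 0) := by rw [z0, eval_zero]
    have v1 := step' _ _ v0
    have v2 := step _ _ v1
    have v3 := step' _ _ v2
    have v4 := step _ _ v3
    have v5 := step' _ _ v4
    have v6 := step _ _ v5
    have hc' : matching m₂ (matching m₁ (matching m₂ (matching m₁ (matching m₂ (matching m₁ 0))))) = 0 :=
      hc
    rw [hc', z0] at v6
    obtain ⟨l, hl⟩ := H mode hmode (maybeEq_of_eval_eq hq ((eval_zero q).trans v6))
    refine ⟨l, fun a => ?_⟩
    obtain ⟨i, rfl⟩ := (Finite.injective_iff_bijective.mp hinj).surjective a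
    rw [← eval_eq_of_sureEq hq (hl i)]
    fin_cases i
    exacts [v0, v1, v2, v3, v4, v5]

/-- A normalized matrix is classified. -/
theorem isClassified_of_secondRow {mode : Fin 3} {q : ℂ} (hq : IsPhase mode q)
    {k : Matrix (Fin 6) (Fin 6) ℂ} (hk0 : ∀ i a, k i a ≠ 0) (h4 : mode = 2 → ∀ i a, k i a ^ 4 = 1)
    (k0 : ∀ a, k 0 a = 1) (k0' : ∀ i, k i 0 = 1)
    (k1 : ∀ a, k 1 a = (secondRow a).eval I q 1)
    (h2 : ∀ i j, i ≠ j → IsTwoType (rowRatio k i j)) : IsClassified k := by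
  have hrow : ∀ i, i ≠ 0 → i ≠ 1 → ∃ l, ∀ a, k i a = (furtherRow l a).eval I q 1 := by
    intro i i0 i1
    refine exists_furtherRow hq (hk0 i) (fun h => h4 h i) (k0' i) ?_ ?_
    · have := h2 i 0 i0
      unfold rowRatio at this
      simpa only [k0, div_one] using this
    · have := h2 i 1 i1
      unfold rowRatio at this
      simpa only [k1] using this
  have hadj : ∀ i j l l', i ≠ j → (∀ a, k i a = (furtherRow l a).eval I q 1) →
      (∀ a, k j a = (furtherRow l' a).eval I q 1) → Adjacent l l' := by
    intro i j l l' hij hl hl'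
    obtain ⟨m, hm⟩ := h2 i j hij
    refine adjacent_of_maybeTwo mode l l' ⟨m, fun a => maybeEq_of_eval_eq hq ?_⟩
    have := hm a
    simp only [rowRatio, hl, hl'] at this
    have n1 := eval_ne_zero hq.1 (furtherRow l' a)
    have n2 := eval_ne_zero hq.1 (furtherRow l' (matching m a))
    simp only [eval_mul_of_norm hq.1, eval_two]
    field_simp at this
    linear_combination this
  obtain ⟨l₂, e2⟩ := hrow 2 (by decide) (by decide)
  obtain ⟨l₃, e3⟩ := hrow 3 (by decide) (by decide)
  obtain ⟨l₄, e4⟩ := hrow 4 (by decide) (by decide)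
  obtain ⟨l₅, e5⟩ := hrow 5 (by decide) (by decide)
  obtain ⟨hσ, hτ, H⟩ := haagerupTest_of_adjacent l₂ l₃ (hadj 2 3 _ _ (by decide) e2 e3)
    l₄ (hadj 2 4 _ _ (by decide) e2 e4) (hadj 3 4 _ _ (by decide) e3 e4)
    l₅ (hadj 2 5 _ _ (by decide) e2 e5) (hadj 3 5 _ _ (by decide) e3 e5)
    (hadj 4 5 _ _ (by decide) e4 e5)
  have hk : k = evalMatrix I q 1 (normalizedMono l₂ l₃ l₄ l₅) := by
    ext i a
    rw [evalMatrix, Matrix.of_apply]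
    fin_cases i
    exacts [(k0 a).trans (eval_zero q).symm, k1 a, e2 a, e3 a, e4 a, e5 a]
  have E := hadamardEquiv_of_equivTest norm_I hq.1 norm_one I_pow_four hσ hτ H
  rw [← hk] at E
  split_ifs at E
  · exact Or.inr (Or.inl ⟨I * q, by rw [norm_mul, norm_I, hq.1, one_mul],
      by rwa [haagerupMatrix_mul_eq hq.1]⟩)
  · exact Or.inr (Or.inl ⟨q, hq.1, by rwa [haagerupMatrix_eq hq.1]⟩)

/-- Multiplying the values by `-i` replaces the parameter `q` by `-iq`. -/
theorem exists_perm_rotate {w : Fin 6 → ℂ} {e : Equiv.Perm (Fin 6)} {c q : ℂ}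
    (h : ∀ a, w (e a) = c * ![1, -1, I, -I, q, -q] a) : ∃ (e' : Equiv.Perm (Fin 6)) (c' : ℂ),
      ∀ a, w (e' a) = c' * ![1, -1, I, -I, -I * q, -(-I * q)] a := by
  have hinj : Function.Injective (![2, 3, 1, 0, 4, 5] : Fin 6 → Fin 6) := by decide
  refine ⟨(Equiv.ofBijective _ (Finite.injective_iff_bijective.mp hinj)).trans e, c * I,
    fun a => ?_⟩
  rw [Equiv.trans_apply, Equiv.ofBijective_apply, h]
  fin_cases a <;> simp <;> first
    | linear_combination -c * I_sq
    | linear_combination c * I_sq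
    | linear_combination -c * q * I_sq
    | linear_combination c * q * I_sq

theorem exists_isPhase {w : Fin 6 → ℂ} (hw : ∀ a, ‖w a‖ = 1) {e : Equiv.Perm (Fin 6)} {c q : ℂ}
    (h : ∀ a, w (e a) = c * ![1, -1, I, -I, q, -q] a) :
    ∃ (e' : Equiv.Perm (Fin 6)) (c' q' : ℂ) (mode : Fin 3), IsPhase mode q' ∧
      (∀ a, w (e' a) = c' * ![1, -1, I, -I, q', -q'] a) ∧
      (mode = 2 → ∀ a b, w a ^ 4 = w b ^ 4) := by
  have hc : ‖c‖ = 1 := by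
    have := hw (e 0)
    rw [h] at this
    simpa using this
  have hq : ‖q‖ = 1 := by
    have := hw (e 4)
    rw [h] at this
    simpa [hc] using this
  by_cases h8 : q ^ 8 = 1
  swap
  · exact ⟨e, c, q, 0, ⟨hq, h8⟩, h, fun h => absurd h (by decide)⟩
  -- For `q ^ 4 = 1` repeated rotation leads to `q = 1`; for `q ^ 4 = -1` at most one rotation leads
  -- to `q ^ 2 = i`.
  have f1 : (q ^ 4 - 1) * (q ^ 4 + 1) = 0 := by linear_combination h8
  rcases mul_eq_zero.mp f1 with h4 | h4
  · have h4 : q ^ 4 = 1 := by linear_combination h4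
    have hw4 : ∀ a b, w a ^ 4 = w b ^ 4 := by
      have : ∀ a, w a ^ 4 = c ^ 4 := fun a => by
        obtain ⟨x, rfl⟩ := e.surjective a
        rw [h, mul_pow]
        fin_cases x <;> simp [h4, Even.neg_pow (show Even 4 by decide)]
      exact fun a b => (this a).trans (this b).symm
    have rot : ∀ (n : ℕ) (e : Equiv.Perm (Fin 6)) (c : ℂ),
        (∀ a, w (e a) = c * ![1, -1, I, -I, I ^ n, -I ^ n] a) →
        ∃ (e' : Equiv.Perm (Fin 6)) (c' : ℂ), ∀ a, w (e' a) = c' * ![1, -1, I, -I, 1, -1] a := by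
      intro n
      induction n with
      | zero => intro e c h; exact ⟨e, c, by simpa using h⟩
      | succ n ih =>
        intro e c h
        obtain ⟨e', c', h'⟩ := exists_perm_rotate h
        have hI : -I * I ^ (n + 1) = I ^ n := by
          rw [pow_succ]; linear_combination -I ^ n * I_sq
        rw [hI] at h'
        exact ih e' c' h'
    obtain ⟨n, -, rfl⟩ := isPrimitiveRoot_I.eq_pow_of_pow_eq_one h4
    obtain ⟨e', c', h'⟩ := rot n e c h
    exact ⟨e', c', 1, 2, ⟨norm_one, rfl⟩, h', fun _ => hw4⟩
  · have f2 : (q ^ 2 - I) * (q ^ 2 + I) = 0 := by linear_combination h4 - I_sq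
    rcases mul_eq_zero.mp f2 with h2 | h2
    · exact ⟨e, c, q, 1, ⟨hq, sub_eq_zero.mp h2⟩, h, fun h => absurd h (by decide)⟩
    · obtain ⟨e', c', h'⟩ := exists_perm_rotate h
      refine ⟨e', c', -I * q, 1, ⟨by simp [hq], ?_⟩, h', fun h => absurd h (by decide)⟩
      change (-I * q) ^ 2 = I
      linear_combination q ^ 2 * I_sq - h2

theorem isClassified_of_phase {h : Matrix (Fin 6) (Fin 6) ℂ} (hu : ∀ i j, ‖h i j‖ = 1)
    (h2 : ∀ i j, i ≠ j → IsTwoType (rowRatio h i j)) {i j : Fin 6} (hij : j ≠ i)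
    {e : Equiv.Perm (Fin 6)} {c q : ℂ} {mode : Fin 3} (hq : IsPhase mode q)
    (he : ∀ a, rowRatio h j i (e a) = c * ![1, -1, I, -I, q, -q] a)
    (h4 : mode = 2 → ∀ i j, i ≠ j → ∀ a b, rowRatio h i j a ^ 4 = rowRatio h i j b ^ 4) :
    IsClassified h := by
  obtain ⟨σ, hσ0, hσ1⟩ : ∃ σ : Equiv.Perm (Fin 6), σ 0 = i ∧ σ 1 = j := by
    have : ∀ i j : Fin 6, j ≠ i → (Equiv.swap 0 i) ((Equiv.swap 1 ((Equiv.swap 0 i) j)) 0) = i ∧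
        (Equiv.swap 0 i) ((Equiv.swap 1 ((Equiv.swap 0 i) j)) 1) = j := by decide
    exact ⟨(Equiv.swap 1 ((Equiv.swap 0 i) j)).trans (Equiv.swap 0 i), this i j hij⟩
  have hH := hadamardEquiv_dephase hu σ e
  have hn : ∀ i j, h i j ≠ 0 := fun i j => ne_zero_of_norm (hu i j)
  have hr : ∀ x a, dephase h σ e x a = rowRatio h (σ x) i (e a) / rowRatio h (σ x) i (e 0) := by
    intro x a
    have n1 := hn i (e 0)
    have n2 := hn i (e a)
    have n3 := hn (σ x) (e 0)
    simp only [dephase, Matrix.of_apply, rowRatio, hσ0]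
    field_simp
  have hd : ∀ x a, dephase h σ e x a ≠ 0 := fun x a => by
    rw [hr]
    exact div_ne_zero (ne_zero_of_norm (norm_rowRatio hu _ _ _))
      (ne_zero_of_norm (norm_rowRatio hu _ _ _))
  refine IsClassified.of_equiv hH.symm (isClassified_of_secondRow hq hd ?_ ?_ ?_ ?_ ?_)
  · intro hm x a
    rw [hr, div_pow]
    by_cases hx : σ x = i
    · simp [hx, rowRatio, hn]
    · rw [h4 hm _ _ hx (e a) (e 0)]
      exact div_self (pow_ne_zero 4 (ne_zero_of_norm (norm_rowRatio hu _ _ _)))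
  · intro a
    simp [hr, hσ0, rowRatio, hn]
  · intro x
    rw [hr]
    exact div_self (ne_zero_of_norm (norm_rowRatio hu _ _ _))
  · intro a
    have hc : c ≠ 0 := by
      have := norm_rowRatio hu j i (e 0)
      rw [he] at this
      exact left_ne_zero_of_mul (ne_zero_of_norm this)
    rw [hr, hσ1, he, he, eval_secondRow]
    simp [hc]
  · intro x y hxy
    obtain ⟨σ', τ', a, b, ha, hb, H⟩ := hH
    rw [rowRatio_of_equiv hb H]
    exact (h2 _ _ (σ'.injective.ne hxy)).const_mul_comp τ' _

/-- A matrix whose rows are pairwise of two-type is classified. -/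
theorem isClassified_of_isTwoType {h : Matrix (Fin 6) (Fin 6) ℂ} (hu : ∀ i j, ‖h i j‖ = 1)
    (h2 : ∀ i j, i ≠ j → IsTwoType (rowRatio h i j)) : IsClassified h := by
  have pat : ∀ i j, j ≠ i → ∃ (e : Equiv.Perm (Fin 6)) (c q : ℂ) (mode : Fin 3), IsPhase mode q ∧
      (∀ a, rowRatio h j i (e a) = c * ![1, -1, I, -I, q, -q] a) ∧
      (mode = 2 → ∀ a b, rowRatio h j i a ^ 4 = rowRatio h j i b ^ 4) := by
    intro i j hij
    obtain ⟨k, hki, hkj⟩ : ∃ k, k ≠ i ∧ k ≠ j := by revert i j; decide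
    obtain ⟨e, c, q, he⟩ := exists_perm_of_sq_eq_neg_sq
      (fun _ => ne_zero_of_norm (norm_rowRatio hu _ _ _)) (h2 j i hij)
      (exists_sq_rowRatio_eq_neg_sq hu (h2 j k hkj.symm) (h2 i k hki.symm) (h2 j i hij))
    exact exists_isPhase (norm_rowRatio hu j i) he
  -- The case `q = 1` is usable only if all dephased entries are fourth roots of unity. If some
  -- quotient has nonconstant fourth powers, normalizing with its two rows avoids that case.
  by_cases hall : ∀ i j, i ≠ j → ∀ a b, rowRatio h i j a ^ 4 = rowRatio h i j b ^ 4
  · obtain ⟨e, c, q, mode, hq, he, -⟩ := pat 0 1 (by decide)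
    exact isClassified_of_phase hu h2 (by decide) hq he fun _ => hall
  · push Not at hall
    obtain ⟨j, i, hij, a, b, hab⟩ := hall
    obtain ⟨e, c, q, mode, hq, he, hm⟩ := pat i j hij
    exact isClassified_of_phase hu h2 hij hq he fun h => absurd (hm h a b) hab

/-! ### The classification. -/

theorem theorem11p2 (h : Matrix (Fin 6) (Fin 6) ℂ) :
    IsRegularHadamard h ↔
      HadamardEquiv h taoMatrix ∨
      (∃ q : ℂ, ‖q‖ = 1 ∧ HadamardEquiv h (haagerupMatrix q)) ∨
      (∃ r s : ℂ, ‖r‖ = 1 ∧ ‖s‖ = 1 ∧ HadamardEquiv h (ditaF23 r s)) ∨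
      (∃ r s : ℂ, ‖r‖ = 1 ∧ ‖s‖ = 1 ∧ HadamardEquiv h (ditaF32 r s)) := by
  constructor
  · intro hh
    obtain ⟨hu, hr⟩ := isRegularHadamard_iff.mp hh
    rcases exists_monochromatic_triple fun i j => IsThreeType (rowRatio h i j) with
      ⟨i, j, k, hij, hjk, hik, h1, h2, h3⟩ | ⟨i, j, k, hij, hjk, hik, h1, h2, h3⟩
    · exact isClassified_of_three_rows hh.1 hij hjk hik h1 h2 h3
    · exact isClassified_of_isTwoType hu fun x y hxy => isTwoType_of_two_triangle hu hr
        ((hr k j hjk.symm).resolve_right h3) ((hr i j hij).resolve_right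
          (mt isThreeType_rowRatio_comm.mp h1)) ((hr k i hik.symm).resolve_right h2) hxy
  · rintro (H | ⟨q, hq, H⟩ | ⟨r, s, hr, hs, H⟩ | ⟨r, s, hr, hs, H⟩)
    · exact isRegularHadamard_taoMatrix.of_equiv H
    · exact (isRegularHadamard_haagerupMatrix hq).of_equiv H
    · exact (isRegularHadamard_ditaF23 hr hs).of_equiv H
    · exact (isRegularHadamard_ditaF32 hr hs).of_equiv H
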